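/- Let $n\ge 1$. A set $C\subseteq\mathbb{RP}^n=\mathbb P(\mathbb R^{n+1})$ is convex if it meets every projective line in a connected (possibly empty) set, properly convex if moreover its closure $\overline C$ is contained in the complement of some projective hyperplane, and strictly convex if it is properly convex and no point of $\partial\overline C$ (the topological boundary of $\overline C$) lies on a line segment of positive length contained in $\partial\overline C$. An ellipsoid in $\mathbb{RP}^n$ is the image of the unit sphere $\{[x_0:\dots:x_n] : x_0^2+\dots+x_{n-1}^2=x_n^2\}$ under a projective transformation. For a properly convex open set $\Omega$, let $SL(\Omega)$ be the group of real $(n+1)\times(n+1)$ matrices of determinant $\pm1$ that preserve each of the two components of the cone over $\Omega$ in $\mathbb R^{n+1}\setminus\{0\}$ (it is naturally isomorphic to the group of projective transformations preserving $\Omega$), and for $p\in\partial\overline\Omega$ let $SL(\Omega,p)$ be the subgroup of elements that fix $p$. Let $O(n,1)$ be the group of real matrices preserving the quadratic form $x_0^2+\dots+x_{n-1}^2-x_n^2$. Its parabolic subgroups are here the stabilizers in $O(n,1)$ of points of the unit sphere. The pure translations in a parabolic subgroup are the elements all of whose complex eigenvalues are equal to $1$ (the identity included); they form a group. **Theorem.**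 Let $\Omega\subseteq\mathbb{RP}^n$ be open and strictly convex. 1. Let $p\in\partial\overline\Omega$ and let $W\subseteq SL(\Omega,p)$ be a nilpotent subgroup (not assumed closed) that acts simply transitively on $\partial\overline\Omega\setminus\{p\}$. Then $\partial\overline\Omega$ is an ellipsoid, and $W$ is conjugate, by a matrix of determinant $\pm1$, to the group of pure translations in some parabolic subgroup of $O(n,1)$. 2. Conversely, if $\partial\overline\Omega$ is an ellipsoid, then there are a point $p\in\partial\overline\Omega$ and a nilpotent subgroup $W\subseteq SL(\Omega,p)$ that acts simply transitively on $\partial\overline\Omega\setminus\{p\}$. -/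

import Mathlib

open scoped LinearAlgebra.Projectivization MatrixGroups Pointwise

noncomputable section

namespace ConvexProjective

/-- Real projective space `ℝPⁿ = ℙ(ℝⁿ⁺¹)`. -/
abbrev RP (n : ℕ) : Type := ℙ ℝ (Fin (n + 1) → ℝ)

/-- The quotient topology on `ℝPⁿ` from `ℝⁿ⁺¹ ∖ {0}`. -/
instance instTopologicalSpaceRP (n : ℕ) : TopologicalSpace (RP n) :=
  TopologicalSpace.coinduced
    (fun v : {v : Fin (n + 1) → ℝ // v ≠ 0} => Projectivization.mk ℝ v.1 v.2) inferInstance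

/-- The projective subspace `ℙ(U)` of `ℝPⁿ` given by a linear subspace `U` of `ℝⁿ⁺¹`. -/
def projSubspace {n : ℕ} (U : Submodule ℝ (Fin (n + 1) → ℝ)) : Set (RP n) :=
  {x | x.submodule ≤ U}

/-- A projective line is `ℙ(U)` with `dim U = 2`. -/
def IsLine {n : ℕ} (L : Set (RP n)) : Prop :=
  ∃ U : Submodule ℝ (Fin (n + 1) → ℝ), Module.finrank ℝ U = 2 ∧ L = projSubspace U

/-- An affine patch is the complement of a projective hyperplane. -/
def IsAffinePatch {n : ℕ} (P : Set (RP n)) : Prop :=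
  ∃ U : Submodule ℝ (Fin (n + 1) → ℝ), Module.finrank ℝ U = n ∧ P = (projSubspace U)ᶜ

/-- A set is convex if its intersection with every line is connected (possibly empty). -/
def IsConvex {n : ℕ} (C : Set (RP n)) : Prop :=
  ∀ L : Set (RP n), IsLine L → IsPreconnected (L ∩ C)

/-- A convex set is properly convex if its closure is contained in an affine patch. -/
def IsProperlyConvex {n : ℕ} (C : Set (RP n)) : Prop :=
  IsConvex C ∧ ∃ P : Set (RP n), IsAffinePatch P ∧ closure C ⊆ P

/-- The projective image of the segment `[a, b]` of `ℝⁿ⁺¹`. When `a` and `b` are linearly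
independent this is a line segment of positive length, and all those arise in this way. -/
def projSegment {n : ℕ} (a b : Fin (n + 1) → ℝ) : Set (RP n) :=
  {x | ∃ (v : Fin (n + 1) → ℝ) (hv : v ≠ 0), v ∈ segment ℝ a b ∧ x = Projectivization.mk ℝ v hv}

/-- The boundary of the closure of a set, `∂C̄`. -/
def bdry {n : ℕ} (C : Set (RP n)) : Set (RP n) := frontier (closure C)

/-- A point of `∂C̄` is strictly convex if it lies in no line segment of positive length
contained in `∂C̄`. -/
def IsStrictlyConvexPoint {n : ℕ} (C : Set (RP n)) (p : RP n) : Prop :=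
  p ∈ bdry C ∧ ∀ a b : Fin (n + 1) → ℝ, LinearIndependent ℝ ![a, b] →
    projSegment a b ⊆ bdry C → p ∉ projSegment a b

/-- A set `C` is strictly convex if it is properly convex and strictly convex at every point
of `∂C̄`. -/
def IsStrictlyConvex {n : ℕ} (C : Set (RP n)) : Prop :=
  IsProperlyConvex C ∧ ∀ p ∈ bdry C, IsStrictlyConvexPoint C p

/-- The group of real matrices of size `n + 1` and determinant `± 1`. -/
def SLpm (n : ℕ) : Subgroup (GL (Fin (n + 1)) ℝ) :=
  (Subgroup.zpowers (-1 : ℝˣ)).comap Matrix.GeneralLinearGroup.det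

/-- The preimage in `ℝⁿ⁺¹ ∖ {0}` of a subset of `ℝPⁿ`. For a nonempty properly convex set it has
two connected components, which are opposite convex cones. -/
def coneOver {n : ℕ} (C : Set (RP n)) : Set (Fin (n + 1) → ℝ) :=
  {v | ∃ hv : v ≠ 0, Projectivization.mk ℝ v hv ∈ C}

/-- `SL(Ω)`: the matrices of determinant `± 1` which preserve (each of the two components of
the cone over) `Ω`. -/
def SLdom {n : ℕ} (Ω : Set (RP n)) : Subgroup (GL (Fin (n + 1)) ℝ) :=
  SLpm n ⊓ ⨅ v ∈ coneOver Ω,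
    MulAction.stabilizer (GL (Fin (n + 1)) ℝ) (connectedComponentIn (coneOver Ω) v)

/-- `SL(Ω, p)`: the elements of `SL(Ω)` which fix `p`. -/
def SLfix {n : ℕ} (Ω : Set (RP n)) (p : RP n) : Subgroup (GL (Fin (n + 1)) ℝ) :=
  SLdom Ω ⊓ MulAction.stabilizer (GL (Fin (n + 1)) ℝ) p

/-- For all `x, y` in `S` there is exactly one element of `W` taking `x` to `y`. -/
def ActsSimplyTransitivelyOn {n : ℕ} (W : Subgroup (GL (Fin (n + 1)) ℝ)) (S : Set (RP n)) : Prop :=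
  ∀ x ∈ S, ∀ y ∈ S, ∃! w : GL (Fin (n + 1)) ℝ, w ∈ W ∧ w • x = y

/-- The quadratic form `x₀² + ⋯ + xₙ₋₁² - xₙ²` of signature `(n, 1)`. -/
def lorentz {n : ℕ} (v : Fin (n + 1) → ℝ) : ℝ :=
  (∑ i : Fin n, v i.castSucc ^ 2) - v (Fin.last n) ^ 2

/-- The unit sphere of the affine patch `xₙ = 1` in `ℝPⁿ`, the zero set of the quadratic form. -/
def unitSphere (n : ℕ) : Set (RP n) := {x | ∀ v ∈ x.submodule, lorentz v = 0}

/-- An ellipsoid in `ℝPⁿ` is the image of the unit sphere under a projective transformation. -/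
def IsEllipsoid {n : ℕ} (S : Set (RP n)) : Prop :=
  ∃ g : GL (Fin (n + 1)) ℝ, S = g • unitSphere n

/-- The group `O(n, 1)`. -/
def lorentzGroup (n : ℕ) : Subgroup (GL (Fin (n + 1)) ℝ) where
  carrier := {A | ∀ v : Fin (n + 1) → ℝ, lorentz (A • v) = lorentz v}
  one_mem' := fun v => by rw [one_smul]
  mul_mem' := fun {A B} hA hB v => by rw [mul_smul, hA, hB]
  inv_mem' := fun {A} hA v => by rw [← hA (A⁻¹ • v), smul_inv_smul]

/-- The parabolic subgroup of `O(n, 1)` attached to a point `x` of the unit sphere, that is,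
to a point at infinity of hyperbolic space. -/
def parabolicSubgroup {n : ℕ} (x : RP n) : Subgroup (GL (Fin (n + 1)) ℝ) :=
  lorentzGroup n ⊓ MulAction.stabilizer (GL (Fin (n + 1)) ℝ) x

/-- The pure translations (including the identity) in the parabolic subgroup attached to `x`:
the elements all of whose complex eigenvalues are `1`. -/
def pureTranslations {n : ℕ} (x : RP n) : Set (GL (Fin (n + 1)) ℝ) :=
  {A | A ∈ parabolicSubgroup x ∧
    ∀ μ : ℂ, Polynomial.aeval μ (A : Matrix (Fin (n + 1)) (Fin (n + 1)) ℝ).charpoly = 0 → μ = 1}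

/-- `W` is conjugate, by a matrix of determinant `± 1`, to the group of pure translations in some
parabolic subgroup of `O(n, 1)`. -/
def IsConjToPureTranslations {n : ℕ} (W : Subgroup (GL (Fin (n + 1)) ℝ)) : Prop :=
  ∃ g ∈ SLpm n, ∃ x ∈ unitSphere n,
    (fun w : GL (Fin (n + 1)) ℝ => g * w * g⁻¹) '' (W : Set (GL (Fin (n + 1)) ℝ)) =
      pureTranslations x

end ConvexProjective

end

open scoped LinearAlgebra.Projectivization MatrixGroups Pointwise


/-! Lift `Ω` to an open convex cone `K` in `ℝⁿ⁺¹` and `p` to a boundary vector `e`. By simple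
transitivity a nontrivial `w ∈ W` fixes no boundary point except `p`. A Perron–Frobenius argument
then shows that the eigenvalue of `w` at `e` bounds the growth of every orbit of the powers of `w`.
Since `|det w| = 1`, this eigenvalue is at least `1`. The same holds for `w⁻¹`, so `w` fixes `e` and
its powers grow more slowly than every exponential (`smul_eq_and_slowGrowth`). The functionals that
support `K` at `e` form a cone preserved by `W`, and a nilpotent group of slowly growing maps has a
fixed vector in such a cone (`exists_fixed_of_nilpotent`). Hence `W` fixes a functional `ζ` whose
kernel is a supporting hyperplane at `p`.

In the affine chart `ζ = 1` the domain is the strict epigraph, in the direction `e`, of a strictly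
convex function `f` on an open convex set `U`. The group moves the points of `U` transitively by
affine maps that change `f` only by affine functions. The heart of the proof is that such an `f` is
a quadratic polynomial and `U` the whole space (`AffinelyHomogeneous.eq_quadratic`). Neither
smoothness nor nilpotency is needed for this. Let `E` be a minimal nonzero invariant subspace for
the linear parts. Traces of slowly growing maps are bounded, and irreducibility makes the trace form
nondegenerate, so the action on `E` is bounded. Hence `U` is a union of cosets of `E`, and there are
bounded invariant open subsets of `E` over which to average. The second differences of `f` along
`E`, as functions of the base point in a coset, have constant `L²` norm, and their average equals
their value at any one point. Equality in the `L²` convexity inequality makes them constant, so `f`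
is quadratic on each coset. Convexity and homogeneity make the leading forms equal on all cosets and
the linear terms affine in the coset. This splits `E` off, and induction applies to the quotient.

So `∂Ω` is a paraboloid together with its point at infinity, that is, an ellipsoid. In these
coordinates `W` acts on the base by a transitive group of Euclidean isometries. Since `W` is
nilpotent, they are all translations (`linear_part_eq_one_of_nilpotent`), and by transitivity every
translation occurs. These are exactly the unipotent elements of the parabolic subgroup. Conversely
the translations of a paraboloid form an abelian group that is simply transitive on its finite
points; a connectedness argument shows that it preserves the cone. -/

namespace ConvexProjective

open Module Polynomial

/-! ### Spectral bounds for maps of subexponential growth -/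

section Growth

variable {E : Type*} [NormedAddCommGroup E] [NormedSpace ℝ E]

/-- All orbits of the powers of `A` grow more slowly than every exponential `s ^ k`, `s > 1`. -/
def SlowGrowth (A : End ℝ E) : Prop :=
  ∀ v : E, ∀ s : ℝ, 1 < s → ∃ C : ℝ, ∀ k : ℕ, ‖(A ^ k) v‖ ≤ C * s ^ k

/-- A real number whose powers are dominated by those of every `s > 1` is at most `1`. -/
theorem le_one_of_pow_le {r a : ℝ} (ha : 0 < a)
    (h : ∀ s : ℝ, 1 < s → ∃ C : ℝ, ∀ k : ℕ, r ^ k * a ≤ C * s ^ k) : r ≤ 1 := by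
  by_contra! hr1
  obtain ⟨s, hs1, hsr⟩ := exists_between hr1
  obtain ⟨C, hC⟩ := h s hs1
  have hs0 : 0 < s := by linarith
  have h1 : 1 < r / s := (one_lt_div hs0).2 hsr
  obtain ⟨k, hk⟩ := pow_unbounded_of_one_lt (C / a) h1
  have := hC k
  rw [div_pow, div_lt_div_iff₀ ha (pow_pos hs0 k)] at hk
  linarith

variable [FiniteDimensional ℝ E]

/-- For a complex eigenvector `v` with `v i ≠ 0`, the number `μ ^ k * v i` is a fixed combination of
the `i`-th coordinates of the vectors `A ^ k (b j)`, which grow slowly. -/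
theorem SlowGrowth.norm_root_le_one {A : End ℝ E} (hA : SlowGrowth A) {ι : Type*} [Fintype ι]
    [DecidableEq ι] (b : Basis ι ℝ E) {μ : ℂ}
    (hμ : μ ∈ ((LinearMap.toMatrix b b A).map (algebraMap ℝ ℂ)).charpoly.roots) : ‖μ‖ ≤ 1 := by
  set M := LinearMap.toMatrix b b A with hM
  set Mc := M.map (algebraMap ℝ ℂ) with hMc
  have hroot : Mc.charpoly.IsRoot μ := (Polynomial.mem_roots'.1 hμ).2
  obtain ⟨v, hv0, hv⟩ : ∃ v : ι → ℂ, v ≠ 0 ∧ Mc.mulVec v = μ • v := by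
    have h1 : Module.End.HasEigenvalue (Matrix.toLin' Mc) μ := by
      rw [Module.End.hasEigenvalue_iff_isRoot_charpoly]
      simpa using hroot
    obtain ⟨v, hv⟩ := h1.exists_hasEigenvector
    exact ⟨v, hv.2, by simpa using hv.apply_eq_smul⟩
  obtain ⟨i, hi⟩ : ∃ i, v i ≠ 0 := by
    by_contra! h
    exact hv0 (funext h)
  have hpow : ∀ k : ℕ, (Mc ^ k).mulVec v = μ ^ k • v := by
    intro k
    induction k with
    | zero => simp
    | succ k ih => rw [pow_succ', ← Matrix.mulVec_mulVec, ih, Matrix.mulVec_smul, hv, smul_smul,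
        pow_succ]
  have hentry : ∀ k : ℕ, ∀ j, (Mc ^ k) i j = ((b.coord i ((A ^ k) (b j)) : ℝ) : ℂ) := by
    intro k j
    have h1 : Mc ^ k = (M ^ k).map (algebraMap ℝ ℂ) := by
      rw [hMc, ← RingHom.mapMatrix_apply, ← RingHom.mapMatrix_apply, map_pow]
    rw [h1, hM, LinearMap.toMatrix_pow b A k]
    simp [LinearMap.toMatrix_apply]
  refine le_one_of_pow_le (norm_pos_iff.2 hi) fun s hs => ?_
  choose C hC using fun j => hA (b j) s hs
  refine ⟨∑ j, ‖LinearMap.toContinuousLinearMap (b.coord i)‖ * C j * ‖v j‖, fun k => ?_⟩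
  have h2 : ‖(μ ^ k • v) i‖ = ‖μ‖ ^ k * ‖v i‖ := by simp
  rw [← h2, ← hpow k, Matrix.mulVec, dotProduct, Finset.sum_mul]
  refine (norm_sum_le _ _).trans (Finset.sum_le_sum fun j _ => ?_)
  rw [norm_mul, hentry k j, Complex.norm_real]
  have h3 : ‖b.coord i ((A ^ k) (b j))‖ ≤
      ‖LinearMap.toContinuousLinearMap (b.coord i)‖ * (C j * s ^ k) :=
    ((LinearMap.toContinuousLinearMap (b.coord i)).le_opNorm _).trans
      (mul_le_mul_of_nonneg_left (hC j k) (norm_nonneg _))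
  calc _ ≤ _ := mul_le_mul_of_nonneg_right h3 (norm_nonneg _)
    _ = _ := by ring

/-- The trace is the sum of at most `dim E` complex roots, each of modulus at most `1`; the
determinant below is their product. -/
theorem SlowGrowth.abs_trace_le {A : End ℝ E} (hA : SlowGrowth A) :
    |LinearMap.trace ℝ E A| ≤ finrank ℝ E := by
  classical
  let b := finBasis ℝ E
  set Mc := (LinearMap.toMatrix b b A).map (algebraMap ℝ ℂ) with hMc
  have h1 : ((LinearMap.trace ℝ E A : ℝ) : ℂ) = Mc.charpoly.roots.sum := by
    rw [← Matrix.trace_eq_sum_roots_charpoly, LinearMap.trace_eq_matrix_trace ℝ b A]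
    simp [hMc, Matrix.trace]
  have h2 : Multiset.card Mc.charpoly.roots ≤ finrank ℝ E := by
    refine (Polynomial.card_roots' _).trans ?_
    rw [Matrix.charpoly_natDegree_eq_dim]
    simp
  rw [← Real.norm_eq_abs, ← Complex.norm_real, h1]
  calc ‖Mc.charpoly.roots.sum‖ ≤ (Mc.charpoly.roots.map fun z => ‖z‖).sum := norm_multiset_sum_le _
    _ ≤ (Multiset.card (Mc.charpoly.roots.map fun z => ‖z‖)) • (1 : ℝ) := by
        refine Multiset.sum_le_card_nsmul _ _ fun x hx => ?_
        obtain ⟨z, hz, rfl⟩ := Multiset.mem_map.1 hx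
        exact hA.norm_root_le_one b hz
    _ ≤ finrank ℝ E := by simpa using h2

theorem SlowGrowth.abs_det_le {A : End ℝ E} (hA : SlowGrowth A) :
    |LinearMap.det A| ≤ 1 := by
  classical
  let b := finBasis ℝ E
  set Mc := (LinearMap.toMatrix b b A).map (algebraMap ℝ ℂ) with hMc
  have h1 : ((LinearMap.det A : ℝ) : ℂ) = Mc.charpoly.roots.prod := by
    rw [← Matrix.det_eq_prod_roots_charpoly, ← LinearMap.det_toMatrix b, hMc]
    exact RingHom.map_det (algebraMap ℝ ℂ) _
  rw [← Real.norm_eq_abs, ← Complex.norm_real, h1]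
  have h3 : ∀ s : Multiset ℂ, (∀ z ∈ s, ‖z‖ ≤ 1) → ‖s.prod‖ ≤ 1 := by
    intro s
    induction s using Multiset.induction_on with
    | empty => simp
    | cons a s ih =>
      intro h
      rw [Multiset.prod_cons, norm_mul]
      exact mul_le_one₀ (h a (by simp)) (norm_nonneg _) (ih fun z hz => h z (by simp [hz]))
  exact h3 _ fun z hz => hA.norm_root_le_one b hz

end Growth

/-! ### Eigenvalue one is detected by traces of powers -/

section Trace

variable {E : Type*} [AddCommGroup E] [Module ℝ E] [FiniteDimensional ℝ E]

/-- An endomorphism with eigenvalue `1` has a positive power of nonzero trace. -/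
theorem exists_trace_pow_succ_ne_zero {y : End ℝ E} {v : E} (hv : v ≠ 0) (hyv : y v = v) :
    ∃ k : ℕ, LinearMap.trace ℝ E (y ^ (k + 1)) ≠ 0 := by
  by_contra! h
  have h1 : ∀ p : ℝ[X], LinearMap.trace ℝ E (aeval y (p * X)) = 0 := by
    intro p
    induction p using Polynomial.induction_on' with
    | add p q hp hq => rw [add_mul, map_add, map_add, hp, hq, add_zero]
    | monomial n a =>
      rw [Polynomial.monomial_mul_X, Polynomial.aeval_monomial, ← Algebra.smul_def, map_smul, h,
        smul_zero]
  have hev : ∀ p : ℝ[X], aeval y p v = p.eval 1 • v := fun p => by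
    have h2 : Module.End.HasEigenvector y 1 v := ⟨by simp [hyv], hv⟩
    exact Module.End.aeval_apply_of_hasEigenvector h2
  -- Write the characteristic polynomial as `(X - 1) ^ m * r`. A Bézout relation between `(X - 1) ^
  -- m` and `X * r` yields `q = β * (X * r)` for which `q(y)` is idempotent and fixes `v`. The
  -- factor `X` makes the trace of `q(y)` vanish, but in characteristic zero this trace is the rank.
  obtain ⟨r, hr, hrd⟩ := Polynomial.exists_eq_pow_rootMultiplicity_mul_and_not_dvd y.charpoly
    (LinearMap.charpoly_monic y).ne_zero 1
  set m := rootMultiplicity 1 y.charpoly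
  have hco : IsCoprime ((X - C (1 : ℝ)) ^ m) (X * r) := by
    apply IsCoprime.pow_left
    rw [(Polynomial.irreducible_X_sub_C (1 : ℝ)).coprime_iff_not_dvd]
    intro hd
    rcases (Polynomial.prime_X_sub_C (1 : ℝ)).dvd_or_dvd hd with h2 | h2
    · rw [Polynomial.dvd_iff_isRoot] at h2
      simp at h2
    · exact hrd h2
  obtain ⟨α, β, hαβ⟩ := hco
  have hm : m ≠ 0 := by
    intro hm
    have h3 : y.charpoly.eval 1 • v = 0 := by
      rw [← hev, LinearMap.aeval_self_charpoly]; simp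
    have h4 : ¬ (y.charpoly).IsRoot 1 := by
      rw [hr, hm, pow_zero, one_mul]
      exact fun h5 => hrd (Polynomial.dvd_iff_isRoot.2 h5)
    exact h4 ((smul_eq_zero.1 h3).resolve_right hv)
  set q := β * (X * r) with hq
  have hq1 : aeval y q v = v := by
    have h5 : q.eval 1 = 1 := by
      have := congrArg (Polynomial.eval 1) hαβ
      simpa [hm, hq] using this
    rw [hev, h5, one_smul]
  have hidem : IsIdempotentElem (aeval y q) := by
    have h6 : q * q = q - α * β * X * y.charpoly := by
      have h7 : q = 1 - α * (X - C (1 : ℝ)) ^ m := by rw [← hαβ]; ring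
      nth_rewrite 1 [h7]
      conv_rhs => rw [hr]
      rw [hq]; ring
    unfold IsIdempotentElem
    rw [← map_mul, h6, map_sub, map_mul (aeval y) _ y.charpoly, LinearMap.aeval_self_charpoly,
      mul_zero, sub_zero]
  have htr : LinearMap.trace ℝ E (aeval y q) = 0 := by
    have : q = β * r * X := by rw [hq]; ring
    rw [this, h1]
  have hz : aeval y q = 0 := by
    have h8 := LinearMap.IsIdempotentElem.isProj_range _ hidem
    rw [h8.trace] at htr
    have h9 : finrank ℝ (LinearMap.range (aeval y q)) = 0 := by exact_mod_cast htr
    rwa [Submodule.finrank_eq_zero, LinearMap.range_eq_bot] at h9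
  rw [hz] at hq1
  exact hv hq1.symm

end Trace

/-! ### Irreducible groups of slow growth are bounded -/

section Bounded

variable {E : Type*} [NormedAddCommGroup E] [NormedSpace ℝ E] [FiniteDimensional ℝ E]
  {G : Type*} [Monoid G]

/-- An irreducible group of endomorphisms of slow growth is bounded. -/
theorem exists_bound_of_irreducible (ρ : G →* End ℝ E) (hρ : ∀ g, SlowGrowth (ρ g))
    (hirr : ∀ S : Submodule ℝ E, (∀ g, ∀ v ∈ S, ρ g v ∈ S) → S = ⊥ ∨ S = ⊤) :
    ∃ C : ℝ, ∀ g v, ‖ρ g v‖ ≤ C * ‖v‖ := by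
  classical
  let A : Submodule ℝ (End ℝ E) := Submodule.span ℝ (Set.range ρ)
  have hmem : ∀ g, ρ g ∈ A := fun g => Submodule.subset_span ⟨g, rfl⟩
  have hmul : ∀ x ∈ A, ∀ y ∈ A, x * y ∈ A := by
    intro x hx y hy
    have h1 : x * y ∈ A * A := Submodule.mul_mem_mul hx hy
    have h2 : A * A ≤ A := by
      change Submodule.span ℝ _ * Submodule.span ℝ _ ≤ _
      rw [Submodule.span_mul_span, Submodule.span_le]
      rintro _ ⟨_, ⟨g, rfl⟩, _, ⟨h, rfl⟩, rfl⟩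
      exact Submodule.subset_span ⟨g * h, map_mul ρ g h⟩
    exact h2 h1
  have hone : (1 : End ℝ E) ∈ A := by simpa using hmem 1
  have hpow : ∀ x ∈ A, ∀ k : ℕ, x ^ k ∈ A := by
    intro x hx k
    induction k with
    | zero => simpa using hone
    | succ k ih => rw [pow_succ]; exact hmul _ ih _ hx
  -- The trace form is nondegenerate on the algebra `A`. If `a v ≠ 0`, irreducibility gives `x ∈ A`
  -- with `x (a v) = v`, so some power of `x * a` has nonzero trace. By cyclicity this trace has the
  -- form `tr (a * x')` with `x' ∈ A`.
  have hnondeg : ∀ a ∈ A, (∀ g, LinearMap.trace ℝ E (a * ρ g) = 0) → a = 0 := by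
    intro a ha htr
    have htr' : ∀ x ∈ A, LinearMap.trace ℝ E (a * x) = 0 := by
      intro x hx
      induction hx using Submodule.span_induction with
      | mem x hx => obtain ⟨g, rfl⟩ := hx; exact htr g
      | zero => simp
      | add x y _ _ hx hy => rw [mul_add, map_add, hx, hy, add_zero]
      | smul c x _ hx => rw [mul_smul_comm, map_smul, hx, smul_zero]
    by_contra hane
    obtain ⟨v, hv⟩ : ∃ v, a v ≠ 0 := by
      by_contra! h
      exact hane (LinearMap.ext h)
    let S : Submodule ℝ E := A.map (LinearMap.applyₗ (a v))
    have hS : S = ⊤ := by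
      refine (hirr S ?_).resolve_left ?_
      · rintro g _ ⟨x, hx, rfl⟩
        exact ⟨ρ g * x, hmul _ (hmem g) _ hx, rfl⟩
      · intro h
        have : a v ∈ S := ⟨1, hone, rfl⟩
        rw [h] at this
        exact hv this
    obtain ⟨x, hx, hxv⟩ : v ∈ S := by rw [hS]; trivial
    have hv0 : v ≠ 0 := by rintro rfl; simp at hv
    obtain ⟨k, hk⟩ := exists_trace_pow_succ_ne_zero (y := x * a) hv0 hxv
    apply hk
    rw [pow_succ, ← mul_assoc, LinearMap.trace_mul_comm]
    exact htr' _ (hmul _ (hpow _ (hmul _ hx _ ha) k) _ hx)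
  let τ : G → Dual ℝ A := fun g =>
    LinearMap.trace ℝ E ∘ₗ LinearMap.mulRight ℝ (ρ g) ∘ₗ A.subtype
  -- The functionals on `A` that are bounded on the group form a subspace. It contains every `τ g`,
  -- because `ρ (h * g)` has trace at most `dim E` in absolute value. By nondegeneracy it is the
  -- whole dual, so matrix coefficients are bounded.
  let B : Submodule ℝ (Dual ℝ A) :=
    { carrier := {φ | ∃ C : ℝ, ∀ g, |φ ⟨ρ g, hmem g⟩| ≤ C}
      zero_mem' := ⟨0, by simp⟩
      add_mem' := by
        rintro φ ψ ⟨C, hC⟩ ⟨D, hD⟩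
        exact ⟨C + D, fun g => (abs_add_le _ _).trans (add_le_add (hC g) (hD g))⟩
      smul_mem' := by
        rintro c φ ⟨C, hC⟩
        refine ⟨|c| * C, fun g => ?_⟩
        simp only [LinearMap.smul_apply, smul_eq_mul, abs_mul]
        exact mul_le_mul_of_nonneg_left (hC g) (abs_nonneg c) }
  have hτB : ∀ g, τ g ∈ B := fun g => ⟨finrank ℝ E, fun h => by
    have : τ g ⟨ρ h, hmem h⟩ = LinearMap.trace ℝ E (ρ (h * g)) := by simp [τ, map_mul]
    rw [this]
    exact (hρ _).abs_trace_le⟩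
  have hBtop : B = ⊤ := by
    have h1 : B.dualCoannihilator = ⊥ := by
      rw [eq_bot_iff]
      intro a ha
      rw [Submodule.mem_dualCoannihilator] at ha
      have := hnondeg a a.2 fun g => by simpa [τ] using ha (τ g) (hτB g)
      simpa using this
    rw [← Subspace.dualCoannihilator_dualAnnihilator_eq (W := B), h1, Submodule.dualAnnihilator_bot]
  let b := finBasis ℝ E
  have hcoord : ∀ i j, ∃ C : ℝ, ∀ g, |b.coord i (ρ g (b j))| ≤ C := by
    intro i j
    have : (b.coord i ∘ₗ LinearMap.applyₗ (b j) ∘ₗ A.subtype : Dual ℝ A) ∈ B := by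
      rw [hBtop]; trivial
    exact this
  choose C hC using hcoord
  refine ⟨∑ j, ‖LinearMap.toContinuousLinearMap (b.coord j)‖ * ∑ i, C i j * ‖b i‖, fun g v => ?_⟩
  have hb : ∀ j, ‖ρ g (b j)‖ ≤ ∑ i, C i j * ‖b i‖ := by
    intro j
    conv_lhs => rw [← b.sum_repr (ρ g (b j))]
    refine (norm_sum_le _ _).trans (Finset.sum_le_sum fun i _ => ?_)
    rw [norm_smul]
    exact mul_le_mul_of_nonneg_right (hC i j g) (norm_nonneg _)
  conv_lhs => rw [← b.sum_repr v, map_sum]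
  rw [Finset.sum_mul]
  refine (norm_sum_le _ _).trans (Finset.sum_le_sum fun j _ => ?_)
  rw [map_smul, norm_smul]
  have h1 : ‖b.repr v j‖ ≤ ‖LinearMap.toContinuousLinearMap (b.coord j)‖ * ‖v‖ :=
    (LinearMap.toContinuousLinearMap (b.coord j)).le_opNorm v
  calc _ ≤ (‖LinearMap.toContinuousLinearMap (b.coord j)‖ * ‖v‖) * ∑ i, C i j * ‖b i‖ :=
        mul_le_mul h1 (hb j) (norm_nonneg _) (by positivity)
    _ = _ := by ring

end Bounded

end ConvexProjective


namespace ConvexProjective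

open Module MeasureTheory

/-! ### An `L²` rigidity principle -/

section Averaging

variable {X Y : Type*}
  [NormedAddCommGroup X] [NormedSpace ℝ X] [FiniteDimensional ℝ X] [MeasurableSpace X]
  [BorelSpace X] [NormedAddCommGroup Y] [NormedSpace ℝ Y] [FiniteDimensional ℝ Y]
  [MeasurableSpace Y] [BorelSpace Y]

theorem integrableOn_of_isBounded {μ : Measure X} [IsFiniteMeasureOnCompacts μ] {O : Set X}
    (hO : Bornology.IsBounded O) {h : X → ℝ} (hh : Continuous h) : IntegrableOn h O μ :=
  have : ProperSpace X := FiniteDimensional.proper ℝ X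
  (hh.continuousOn.integrableOn_compact hO.isCompact_closure).mono_set subset_closure

/-- A nonnegative continuous function with vanishing integral over an open set vanishes there. -/
theorem eq_zero_of_setIntegral_eq_zero {μ : Measure X} [IsFiniteMeasureOnCompacts μ]
    [μ.IsOpenPosMeasure] {O : Set X} (hO : Bornology.IsBounded O) (hO' : IsOpen O) {h : X → ℝ}
    (hh : Continuous h) (h0 : ∀ x ∈ O, 0 ≤ h x) (hint : ∫ x in O, h x ∂μ = 0) :
    ∀ x ∈ O, h x = 0 := by
  have h1 := (setIntegral_eq_zero_iff_of_nonneg_ae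
    ((ae_restrict_iff' hO'.measurableSet).2 (Filter.Eventually.of_forall h0))
    (integrableOn_of_isBounded hO hh)).1 hint
  exact Measure.eqOn_open_of_ae_eq h1 hO' hh.continuousOn continuousOn_const

/-- If a family of functions has constant `L²` norm and averages to one of its members, then it
is constant. -/
theorem eq_of_average_eq {μ : Measure X} {ν : Measure Y} [IsFiniteMeasureOnCompacts μ]
    [μ.IsOpenPosMeasure] [IsFiniteMeasureOnCompacts ν] [ν.IsOpenPosMeasure]
    [SFinite μ] [SFinite ν] {O : Set X} {Q : Set Y} (hO : Bornology.IsBounded O) (hO' : IsOpen O)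
    (hQ : Bornology.IsBounded Q) (hQ' : IsOpen Q) {H : X → Y → ℝ} {a : Y → ℝ}
    (hH : Continuous fun z : X × Y => H z.1 z.2) (ha : Continuous a)
    (havg : ∀ p ∈ Q, ∫ s in O, (H s p - a p) ∂μ = 0)
    (hsq : ∀ s ∈ O, ∫ p in Q, (H s p ^ 2 - a p ^ 2) ∂ν = 0) :
    ∀ s ∈ O, ∀ p ∈ Q, H s p = a p := by
  have ha' : Continuous fun z : X × Y => a z.2 := ha.comp continuous_snd
  have hOQ : Bornology.IsBounded (O ×ˢ Q) := hO.prod hQ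
  have c1 : Continuous fun z : X × Y => H z.1 z.2 ^ 2 - a z.2 ^ 2 := (hH.pow 2).sub (ha'.pow 2)
  have c2 : Continuous fun z : X × Y => a z.2 * (H z.1 z.2 - a z.2) := ha'.mul (hH.sub ha')
  have i1 := integrableOn_of_isBounded (μ := μ.prod ν) hOQ c1
  have i2 := integrableOn_of_isBounded (μ := μ.prod ν) hOQ c2
  have e1 : ∫ z in O ×ˢ Q, (H z.1 z.2 ^ 2 - a z.2 ^ 2) ∂(μ.prod ν) = 0 := by
    rw [setIntegral_prod _ i1]
    exact setIntegral_eq_zero_of_forall_eq_zero hsq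
  have e2 : ∫ z in O ×ˢ Q, (a z.2 * (H z.1 z.2 - a z.2)) ∂(μ.prod ν) = 0 := by
    rw [IntegrableOn, ← Measure.prod_restrict] at i2
    rw [← Measure.prod_restrict, integral_prod_symm _ i2]
    refine setIntegral_eq_zero_of_forall_eq_zero fun p hp => ?_
    simp only
    rw [integral_const_mul, havg p hp, mul_zero]
  -- `(H - a)² = (H² - a²) - 2a(H - a)`. The first term vanishes on integrating over `Q` first, the
  -- second on integrating over `O` first.
  have e3 : ∫ z in O ×ˢ Q, (H z.1 z.2 - a z.2) ^ 2 ∂(μ.prod ν) = 0 := by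
    have : ∀ z : X × Y, (H z.1 z.2 - a z.2) ^ 2 =
        (H z.1 z.2 ^ 2 - a z.2 ^ 2) - 2 * (a z.2 * (H z.1 z.2 - a z.2)) := fun z => by ring
    simp_rw [this]
    rw [integral_sub i1 (i2.const_mul 2), integral_const_mul, e1, e2]
    simp
  have h3 := eq_zero_of_setIntegral_eq_zero hOQ (hO'.prod hQ') ((hH.sub ha').pow 2)
    (fun _ _ => sq_nonneg _) e3
  intro s hs p hp
  have := h3 (s, p) ⟨hs, hp⟩
  exact sub_eq_zero.1 (pow_eq_zero_iff (two_ne_zero)|>.1 this)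

end Averaging

/-! ### Affinely homogeneous functions and their second differences -/

section Homogeneous

variable {F : Type*} [NormedAddCommGroup F] [NormedSpace ℝ F] {G : Type*} [Group G]

/-- Any two points of `U` are exchanged by an affine map which preserves `U`, has linear part in
the image of `ρ`, and preserves `f` up to an affine function. -/
def AffinelyHomogeneous (ρ : G →* End ℝ F) (U : Set F) (f : F → ℝ) : Prop :=
  ∀ x ∈ U, ∀ y ∈ U, ∃ (g : G) (c : F), ρ g x + c = y ∧ (∀ u, ρ g u + c ∈ U ↔ u ∈ U) ∧
    ∃ (ℓ : F →ₗ[ℝ] ℝ) (k : ℝ), ∀ u ∈ U, f (ρ g u + c) = f u + ℓ u + k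

/-- The mixed second difference of `f` at `u`. -/
def secondDiff (f : F → ℝ) (u v t : F) : ℝ := f (u + v + t) - f (u + v) - f (u + t) + f u

/-- Second differences annihilate affine functions, so the correction `ℓ + k` drops out. -/
theorem secondDiff_map {A : End ℝ F} {c : F} {U : Set F} {f : F → ℝ} {ℓ : F →ₗ[ℝ] ℝ} {k : ℝ}
    (h : ∀ u ∈ U, f (A u + c) = f u + ℓ u + k) {u v t : F} (h0 : u ∈ U) (hv : u + v ∈ U)
    (ht : u + t ∈ U) (hvt : u + v + t ∈ U) :
    secondDiff f (A u + c) (A v) (A t) = secondDiff f u v t := by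
  have e1 : A u + c + A v + A t = A (u + v + t) + c := by simp only [map_add]; abel
  have e2 : A u + c + A v = A (u + v) + c := by simp only [map_add]; abel
  have e3 : A u + c + A t = A (u + t) + c := by simp only [map_add]; abel
  unfold secondDiff
  rw [e1, e2, e3, h _ h0, h _ hv, h _ ht, h _ hvt]
  simp only [map_add]
  ring

variable {ρ : G →* End ℝ F} {U : Set F} {f : F → ℝ} {E : Submodule ℝ F} {σ : G →* End ℝ E}

theorem map_inv_apply_self (τ : G →* End ℝ F) (g : G) (v : F) : τ g⁻¹ (τ g v) = v := by
  rw [← Module.End.mul_apply, ← map_mul, inv_mul_cancel, map_one, Module.End.one_apply]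

theorem map_self_apply_inv (τ : G →* End ℝ F) (g : G) (v : F) : τ g (τ g⁻¹ v) = v := by
  rw [← Module.End.mul_apply, ← map_mul, mul_inv_cancel, map_one, Module.End.one_apply]

/-- Homogeneity transports a ball around `u` to any other point `w` of `U`. Since `σ` is bounded,
its trace along `E` keeps a size independent of `w`. Steps of fixed length along `E` therefore never
leave `U`, and finitely many of them reach any `v`. -/
theorem AffinelyHomogeneous.add_mem (hf : AffinelyHomogeneous ρ U f) (hU : IsOpen U)
    (hσ : ∀ g v, ((σ g v : E) : F) = ρ g v) {C : ℝ} (hC : ∀ g v, ‖σ g v‖ ≤ C * ‖v‖)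
    {u : F} (hu : u ∈ U) (v : E) : u + v ∈ U := by
  obtain ⟨δ, hδ, hball⟩ := Metric.isOpen_iff.1 hU u hu
  have hstep : ∀ w ∈ U, ∀ v : E, C * ‖v‖ < δ → w + v ∈ U := by
    intro w hw v hv
    obtain ⟨g, c, h1, h2, -⟩ := hf u hu w hw
    have h3 : ρ g (u + σ g⁻¹ v) + c = w + v := by
      rw [map_add, ← hσ g, map_self_apply_inv σ, ← h1]; abel
    rw [← h3, h2]
    apply hball
    rw [Metric.mem_ball, dist_eq_norm, add_sub_cancel_left]
    exact (hC g⁻¹ v).trans_lt hv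
  obtain ⟨N, hN⟩ := exists_nat_gt (C * ‖v‖ / δ)
  have hN0 : (0 : ℝ) < N + 1 := by positivity
  have hsmall : C * ‖((N + 1 : ℝ)⁻¹ • v : E)‖ < δ := by
    rw [norm_smul, norm_inv, Real.norm_of_nonneg hN0.le]
    rw [div_lt_iff₀ hδ] at hN
    have : C * ((N + 1 : ℝ)⁻¹ * ‖v‖) = (C * ‖v‖) / (N + 1) := by field_simp
    rw [this, div_lt_iff₀ hN0]
    nlinarith
  have hind : ∀ k : ℕ, u + ((k : ℝ) • ((N + 1 : ℝ)⁻¹ • v : E) : E) ∈ U := by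
    intro k
    induction k with
    | zero => simpa using hu
    | succ k ih =>
      have := hstep _ ih _ hsmall
      convert this using 1
      push_cast
      rw [add_smul, one_smul]; abel
  have := hind (N + 1)
  rw [smul_smul] at this
  push_cast at this
  rwa [mul_inv_cancel₀ hN0.ne', one_smul] at this

/-- The union of the `σ`-translates of the ball of radius `R`. -/
def orbitBall (σ : G →* End ℝ E) (R : ℝ) : Set E := {v | ∃ g, ‖σ g v‖ < R}

theorem mem_orbitBall_of_norm_lt {R : ℝ} {v : E} (hv : ‖v‖ < R) : v ∈ orbitBall σ R :=
  ⟨1, by simpa using hv⟩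

theorem neg_mem_orbitBall {R : ℝ} {v : E} (hv : v ∈ orbitBall σ R) : -v ∈ orbitBall σ R := by
  obtain ⟨g, hg⟩ := hv
  exact ⟨g, by simpa using hg⟩

theorem map_mem_orbitBall_iff {R : ℝ} {v : E} (g : G) :
    σ g v ∈ orbitBall σ R ↔ v ∈ orbitBall σ R := by
  constructor
  · rintro ⟨h, hh⟩
    exact ⟨h * g, by simpa [map_mul] using hh⟩
  · rintro ⟨h, hh⟩
    exact ⟨h * g⁻¹, by rwa [map_mul, Module.End.mul_apply, map_inv_apply_self]⟩

/-- This is where the bound on `σ` enters: orbit balls are bounded, open, symmetric and invariant,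
so that averaging over them needs no invariant inner product. -/
theorem isBounded_orbitBall {C : ℝ} (hC : ∀ g v, ‖σ g v‖ ≤ C * ‖v‖) (R : ℝ) :
    Bornology.IsBounded (orbitBall σ R) := by
  rw [isBounded_iff_forall_norm_le]
  refine ⟨|C| * R, ?_⟩
  rintro v ⟨g, hg⟩
  rw [← map_inv_apply_self σ g v]
  calc _ ≤ C * ‖σ g v‖ := hC _ _
    _ ≤ |C| * R := mul_le_mul (le_abs_self C) hg.le (norm_nonneg _) (abs_nonneg C)

variable [FiniteDimensional ℝ F]

theorem isOpen_orbitBall (R : ℝ) : IsOpen (orbitBall σ R) := by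
  have : orbitBall σ R = ⋃ g, {v | ‖σ g v‖ < R} := by ext; simp [orbitBall]
  rw [this]
  exact isOpen_iUnion fun g =>
    isOpen_lt (LinearMap.continuous_of_finiteDimensional (σ g)).norm continuous_const

variable [MeasurableSpace F] [BorelSpace F]

/-- A map with `|det| = 1` preserves Haar measure, and the orbit ball is invariant. -/
theorem setIntegral_orbitBall_comp (hdet : ∀ g, |LinearMap.det (σ g)| = 1) (R : ℝ) (g : G)
    (h : E → ℝ) :
    ∫ v in orbitBall σ R, h (σ g v) ∂Measure.addHaar =
      ∫ v in orbitBall σ R, h v ∂Measure.addHaar := by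
  have hmp : MeasurePreserving (σ g) (Measure.addHaar : Measure E) Measure.addHaar := by
    refine ⟨(LinearMap.continuous_of_finiteDimensional (σ g)).measurable, ?_⟩
    have h0 : LinearMap.det (σ g) ≠ 0 := by
      intro h0
      have := hdet g
      rw [h0, abs_zero] at this
      exact zero_ne_one this
    rw [Measure.map_linearMap_addHaar_eq_smul_addHaar _ h0, abs_inv, hdet g]
    simp
  have hinj : Function.Injective (σ g) := fun x y hxy => by
    rw [← map_inv_apply_self σ g x, hxy, map_inv_apply_self σ g y]
  have hemb : MeasurableEmbedding (σ g) :=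
    (LinearMap.isClosedEmbedding_of_injective (𝕜 := ℝ) (f := σ g)
      (LinearMap.ker_eq_bot.2 hinj)).measurableEmbedding
  rw [← hmp.setIntegral_preimage_emb hemb h]
  congr 2
  ext v
  exact (map_mem_orbitBall_iff (σ := σ) g).symm

theorem setIntegral_orbitBall_linear (R : ℝ) (ℓ : E →ₗ[ℝ] ℝ) :
    ∫ v in orbitBall σ R, ℓ v ∂Measure.addHaar = 0 := by
  have hmp : MeasurePreserving (Neg.neg : E → E) (Measure.addHaar : Measure E) Measure.addHaar :=
    Measure.measurePreserving_neg _
  have h1 := hmp.setIntegral_preimage_emb (MeasurableEquiv.neg E).measurableEmbedding ℓ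
    (orbitBall σ R)
  have h2 : (Neg.neg : E → E) ⁻¹' orbitBall σ R = orbitBall σ R := by
    ext v
    exact ⟨fun h => by simpa using neg_mem_orbitBall h, neg_mem_orbitBall⟩
  rw [h2] at h1
  simp only [map_neg] at h1
  rw [integral_neg] at h1
  linarith

/-- The second differences of `f` in the directions of `E` are constant along `E`. -/
theorem AffinelyHomogeneous.secondDiff_add (hf : AffinelyHomogeneous ρ U f) (hU : IsOpen U)
    (hcont : ContinuousOn f U) (hσ : ∀ g v, ((σ g v : E) : F) = ρ g v) {C : ℝ}
    (hC : ∀ g v, ‖σ g v‖ ≤ C * ‖v‖) (hdet : ∀ g, |LinearMap.det (σ g)| = 1)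
    {u : F} (hu : u ∈ U) (s v t : E) :
    secondDiff f (u + s) v t = secondDiff f u v t := by
  have hUE : ∀ {x : F}, x ∈ U → ∀ w : E, x + w ∈ U := fun hx w => hf.add_mem hU hσ hC hx w
  obtain ⟨R, hR⟩ : ∃ R : ℝ, ‖s‖ < R ∧ ‖v‖ < R ∧ ‖t‖ < R :=
    ⟨‖s‖ + ‖v‖ + ‖t‖ + 1, by
      refine ⟨?_, ?_, ?_⟩ <;> linarith [norm_nonneg s, norm_nonneg v, norm_nonneg t]⟩
  set O := orbitBall σ R with hOdef
  have hOb : Bornology.IsBounded O := isBounded_orbitBall hC R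
  have hOo : IsOpen O := isOpen_orbitBall R
  set μ : Measure E := Measure.addHaar
  have hslice : ∀ {x : F}, x ∈ U → Continuous fun w : E => f (x + w) := fun {x} hx =>
    hcont.comp_continuous (continuous_const.add continuous_subtype_val) (fun w => hUE hx w)
  have hslice_int : ∀ {x : F}, x ∈ U → IntegrableOn (fun w : E => f (x + w) - f x) O μ :=
    fun {x} hx => integrableOn_of_isBounded hOb ((hslice hx).sub continuous_const)
  -- The mean increment of `f` over `O` does not depend on the base point: the affine correction
  -- contributes only `ℓ w`, an odd function on a symmetric set.
  have hmean : ∀ x ∈ U, ∀ y ∈ U,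
      ∫ w in O, (f (x + w) - f x) ∂μ = ∫ w in O, (f (y + w) - f y) ∂μ := by
    intro x hx y hy
    obtain ⟨g, c, h1, h2, ℓ, k, h3⟩ := hf x hx y hy
    rw [← setIntegral_orbitBall_comp hdet R g fun w : E => f (y + w) - f y]
    have h4 : ∀ w : E, f (y + σ g w) - f y = (f (x + w) - f x) + (ℓ ∘ₗ E.subtype) w := by
      intro w
      have h5 : y + σ g w = ρ g (x + w) + c := by rw [map_add, ← h1, hσ]; abel
      rw [h5, h3 _ (hUE hx w), ← h1, h3 _ hx, map_add]
      simp only [LinearMap.comp_apply, Submodule.subtype_apply]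
      ring
    simp_rw [h4]
    rw [integral_add (hslice_int hx) (integrableOn_of_isBounded hOb
      (LinearMap.continuous_of_finiteDimensional _)), setIntegral_orbitBall_linear, add_zero]
  -- The change of a second difference under translation by `w` is a signed sum of four increments
  -- of `f`, with signs adding up to zero, so equal means cancel.
  have havg : ∀ p : E × E, ∫ w in O, (secondDiff f (u + w) p.1 p.2 - secondDiff f u p.1 p.2) ∂μ
      = 0 := by
    rintro ⟨p, q⟩
    have e : ∀ w : E, secondDiff f (u + w) p q - secondDiff f u p q =
        ((f (u + p + q + w) - f (u + p + q)) - (f (u + p + w) - f (u + p))) -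
        ((f (u + q + w) - f (u + q)) - (f (u + w) - f u)) := by
      intro w
      simp only [secondDiff]
      rw [show u + w + p + q = u + p + q + w by abel, show u + w + p = u + p + w by abel,
        show u + (w : F) + q = u + q + w by abel]
      ring
    simp_rw [e]
    have m0 := hu
    have m1 := hUE hu p
    have m2 := hUE hu q
    have m3 := hUE m1 q
    have j1 : IntegrableOn (fun w : E => (f (u + p + q + w) - f (u + p + q)) -
      (f (u + p + w) - f (u + p))) O μ := (hslice_int m3).sub (hslice_int m1)
    have j2 : IntegrableOn (fun w : E => (f (u + q + w) - f (u + q)) - (f (u + w) - f u)) O μ :=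
      (hslice_int m2).sub (hslice_int m0)
    rw [integral_sub j1 j2,
      integral_sub (hslice_int m3) (hslice_int m1), integral_sub (hslice_int m2) (hslice_int m0),
      hmean _ m3 _ m0, hmean _ m1 _ m0, hmean _ m2 _ m0]
    simp
  have hjoint : Continuous fun z : E × (E × E) => secondDiff f (u + z.1) z.2.1 z.2.2 := by
    have c1 : Continuous fun z : E × (E × E) => f (u + (z.1 + z.2.1 + z.2.2 : E)) :=
      (hslice hu).comp (by fun_prop)
    have c2 : Continuous fun z : E × (E × E) => f (u + (z.1 + z.2.1 : E)) :=
      (hslice hu).comp (by fun_prop)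
    have c3 : Continuous fun z : E × (E × E) => f (u + (z.1 + z.2.2 : E)) :=
      (hslice hu).comp (by fun_prop)
    have c4 : Continuous fun z : E × (E × E) => f (u + (z.1 : E)) :=
      (hslice hu).comp (by fun_prop)
    convert ((c1.sub c2).sub c3).add c4 using 2 with z
    simp [secondDiff, add_assoc]
  have hjoint_at : ∀ w : E, Continuous fun z : E × E => secondDiff f (u + w) z.1 z.2 := fun w =>
    hjoint.comp (continuous_const.prodMk continuous_id)
  have ha : Continuous fun z : E × E => secondDiff f u z.1 z.2 := by
    simpa using hjoint_at 0
  have hOO : Bornology.IsBounded (O ×ˢ O) := hOb.prod hOb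
  have hsq_int_at : ∀ w : E, IntegrableOn (fun z : E × E => secondDiff f (u + w) z.1 z.2 ^ 2)
      (O ×ˢ O) (μ.prod μ) := fun w => integrableOn_of_isBounded hOO ((hjoint_at w).pow 2)
  have hsq_int : IntegrableOn (fun z : E × E => secondDiff f u z.1 z.2 ^ 2)
      (O ×ˢ O) (μ.prod μ) := integrableOn_of_isBounded hOO (ha.pow 2)
  -- The affine map that takes `u` to `u + w` carries second differences at `u` to those at `u + w`,
  -- with arguments moved by `σ g`. This preserves the measure on `O ×ˢ O`.
  have hsq_const : ∀ w : E, ∫ z in O ×ˢ O, secondDiff f (u + w) z.1 z.2 ^ 2 ∂(μ.prod μ) =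
      ∫ z in O ×ˢ O, secondDiff f u z.1 z.2 ^ 2 ∂(μ.prod μ) := by
    intro w
    obtain ⟨g, c, h1, h2, ℓ, k, h3⟩ := hf u hu _ (hUE hu w)
    have h4 : ∀ p q : E, secondDiff f (u + w) (σ g p) (σ g q) = secondDiff f u p q := by
      intro p q
      rw [← h1, hσ, hσ]
      exact secondDiff_map h3 hu (hUE hu p) (hUE hu q) (hUE (hUE hu p) q)
    rw [setIntegral_prod _ (hsq_int_at w), setIntegral_prod _ hsq_int,
      ← setIntegral_orbitBall_comp hdet R g]
    congr 1
    ext p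
    simp only
    rw [← setIntegral_orbitBall_comp hdet R g]
    simp_rw [h4]
    rfl
  have hsq : ∀ w : E, ∫ z in O ×ˢ O,
      (secondDiff f (u + w) z.1 z.2 ^ 2 - secondDiff f u z.1 z.2 ^ 2) ∂(μ.prod μ) = 0 := by
    intro w
    rw [integral_sub (hsq_int_at w) hsq_int, hsq_const, sub_self]
  exact eq_of_average_eq hOb hOo hOO (hOo.prod hOo) (H := fun w z => secondDiff f (u + w) z.1 z.2)
    (a := fun z => secondDiff f u z.1 z.2) hjoint ha (fun p _ => havg p) (fun w _ => hsq w)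
    s (mem_orbitBall_of_norm_lt hR.1) (v, t)
    ⟨mem_orbitBall_of_norm_lt hR.2.1, mem_orbitBall_of_norm_lt hR.2.2⟩

end Homogeneous

end ConvexProjective


namespace ConvexProjective

open Module MeasureTheory

/-! ### Quadratic form of the function on cosets -/

section Slices

variable {F : Type*} [NormedAddCommGroup F] [NormedSpace ℝ F] {G : Type*} [Group G]
  {ρ : G →* End ℝ F} {U : Set F} {f : F → ℝ} {E : Submodule ℝ F} {σ : G →* End ℝ E}

theorem coeff_nonneg_of_quadratic_nonneg {a b c : ℝ} (h : ∀ t : ℝ, 0 ≤ a + t * b + t ^ 2 * c) :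
    0 ≤ c := by
  by_contra! hc
  have h1 := h ((|a| + |b| + 1) / (-c) + 1)
  set t := (|a| + |b| + 1) / (-c) + 1 with ht
  have hpos : 0 < (|a| + |b| + 1) / (-c) := div_pos (by positivity) (by linarith)
  have h2 : (t - 1) * (-c) = |a| + |b| + 1 := by
    rw [ht, add_sub_cancel_right, div_mul_cancel₀ _ (neg_ne_zero.2 hc.ne)]
  have h3 : 1 < t := by linarith
  have h4 : t * b ≤ t * |b| := mul_le_mul_of_nonneg_left (le_abs_self b) (by linarith)
  nlinarith [le_abs_self a, abs_nonneg a, abs_nonneg b]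

theorem coeff_eq_zero_of_affine_nonneg {a b : ℝ} (h : ∀ t : ℝ, 0 ≤ a + t * b) : b = 0 := by
  by_contra hb
  have := h (-(a + 1) / b)
  rw [div_mul_cancel₀ _ hb] at this
  linarith

/-- Second differences satisfy a cocycle identity which, once they are constant along `E`, becomes
additivity in each argument; continuity gives linearity. After half the diagonal is subtracted, the
increment of `f` is itself additive and continuous. -/
theorem exists_bilin_of_secondDiff_add {u : F} (hcont : Continuous fun w : E => f (u + w))
    (hadd : ∀ s v t : E, secondDiff f (u + s) v t = secondDiff f u v t) :
    ∃ (b : E →ₗ[ℝ] E →ₗ[ℝ] ℝ) (h : E →ₗ[ℝ] ℝ), (∀ v t, b v t = secondDiff f u v t) ∧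
      (∀ v t, b v t = b t v) ∧ ∀ v : E, f (u + v) = f u + h v + b v v / 2 := by
  have hsymm : ∀ v t : E, secondDiff f u v t = secondDiff f u t v := by
    intro v t
    simp only [secondDiff]
    rw [add_right_comm u (v : F) t]
    ring
  have hl : ∀ v v' t : E, secondDiff f u ((v + v' : E) : F) t =
      secondDiff f u v t + secondDiff f u v' t := by
    intro v v' t
    rw [← hadd v v' t]
    simp only [secondDiff, Submodule.coe_add, ← add_assoc]
    ring
  have hc : ∀ t : E, Continuous fun v : E => secondDiff f u v t := by
    intro t
    have c1 : Continuous fun v : E => f (u + (v + t : E)) := hcont.comp (by fun_prop)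
    have := ((c1.sub hcont).sub (continuous_const (y := f (u + t)))).add
      (continuous_const (y := f u))
    convert this using 2 with v
    simp [secondDiff, add_assoc]
  have hsm : ∀ (c : ℝ) (v t : E), secondDiff f u ((c • v : E) : F) t =
      c • secondDiff f u v t := fun c v t =>
    map_real_smul (AddMonoidHom.mk' (fun v : E => secondDiff f u v t) fun v v' => hl v v' t)
      (hc t) c v
  let b : E →ₗ[ℝ] E →ₗ[ℝ] ℝ := LinearMap.mk₂ ℝ (fun v t => secondDiff f u v t) hl hsm
    (fun v t t' => by simp only [hsymm v]; exact hl t t' v)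
    (fun c v t => by simp only [hsymm v]; exact hsm c t v)
  have hb : ∀ v t, b v t = secondDiff f u v t := fun v t => rfl
  have hbs : ∀ v t, b v t = b t v := fun v t => hsymm v t
  let h0 : E →+ ℝ := AddMonoidHom.mk' (fun v : E => f (u + v) - f u - b v v / 2) fun v t => by
    have h1 := hb v t
    have h2 := hbs v t
    simp only [map_add, LinearMap.add_apply]
    simp only [secondDiff, Submodule.coe_add, ← add_assoc] at h1 ⊢
    linarith
  have hdiag : Continuous fun v : E => b v v := by
    have c1 : Continuous fun v : E => f (u + (v + v : E)) := hcont.comp (by fun_prop)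
    have := ((c1.sub hcont).sub hcont).add (continuous_const (y := f u))
    convert this using 2 with v
    simp [hb, secondDiff, add_assoc]
  have hh0 : Continuous h0 := (hcont.sub continuous_const).sub (hdiag.div_const 2)
  refine ⟨b, (h0.toRealLinearMap hh0 : E →L[ℝ] ℝ), hb, hbs, fun v => ?_⟩
  simp only [h0, AddMonoidHom.coe_toRealLinearMap, ContinuousLinearMap.coe_coe, AddMonoidHom.mk'_apply]
  ring

variable [FiniteDimensional ℝ F] [MeasurableSpace F] [BorelSpace F]

/-- Along the cosets of `E` the function `f` is quadratic, with the same leading term on all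
cosets and with linear term depending affinely on the coset. -/
theorem AffinelyHomogeneous.exists_slice_form (hf : AffinelyHomogeneous ρ U f) (hU : IsOpen U)
    (hsc : StrictConvexOn ℝ U f) (hne : U.Nonempty) (hσ : ∀ g v, ((σ g v : E) : F) = ρ g v) {C : ℝ}
    (hC : ∀ g v, ‖σ g v‖ ≤ C * ‖v‖) (hdet : ∀ g, |LinearMap.det (σ g)| = 1) :
    ∃ (b : E →ₗ[ℝ] E →ₗ[ℝ] ℝ) (h : F → E →ₗ[ℝ] ℝ), (∀ v t, b v t = b t v) ∧
      (∀ v, v ≠ 0 → 0 < b v v) ∧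
      (∀ u ∈ U, ∀ v : E, u + v ∈ U ∧ f (u + v) = f u + h u v + b v v / 2) ∧
      (∀ u ∈ U, ∀ s v : E, h (u + s) v = h u v + b s v) ∧
      ∀ x ∈ U, ∀ y ∈ U, ∀ p q : ℝ, 0 ≤ p → 0 ≤ q → p + q = 1 →
        h (p • x + q • y) = p • h x + q • h y := by
  classical
  have hcont : ContinuousOn f U := hsc.convexOn.continuousOn hU
  have hUE : ∀ {x : F}, x ∈ U → ∀ w : E, x + w ∈ U := fun hx w => hf.add_mem hU hσ hC hx w
  have hslice : ∀ {x : F}, x ∈ U → Continuous fun w : E => f (x + w) := fun {x} hx =>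
    hcont.comp_continuous (continuous_const.add continuous_subtype_val) (fun w => hUE hx w)
  have hloc : ∀ u : F, ∃ (b : E →ₗ[ℝ] E →ₗ[ℝ] ℝ) (h : E →ₗ[ℝ] ℝ), u ∈ U →
      (∀ v t, b v t = secondDiff f u v t) ∧ (∀ v t, b v t = b t v) ∧
      ∀ v : E, f (u + v) = f u + h v + b v v / 2 := by
    intro u
    by_cases hu : u ∈ U
    · obtain ⟨b, h, H⟩ := exists_bilin_of_secondDiff_add (hslice hu)
        (fun s v t => hf.secondDiff_add hU hcont hσ hC hdet hu s v t)
      exact ⟨b, h, fun _ => H⟩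
    · exact ⟨0, 0, fun h => absurd h hu⟩
  choose b h hbh using hloc
  have hline : ∀ u ∈ U, ∀ (v : E) (t : ℝ), f (u + t • (v : F)) =
      f u + t * h u v + t ^ 2 * (b u v v / 2) := by
    intro u hu v t
    have := (hbh u hu).2.2 (t • v)
    simp only [Submodule.coe_smul, map_smul, LinearMap.smul_apply, smul_eq_mul] at this
    rw [this]; ring
  have hdiag_cont : ∀ u, Continuous fun v : E => b u v v := fun u => by
    have h1 : Continuous fun v : E => (LinearMap.toContinuousLinearMap
      (LinearMap.toContinuousLinearMap.toLinearMap ∘ₗ b u)) v v := by fun_prop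
    exact h1
  -- Convexity of `f` between `x + t v` and `y + t v` is an inequality between quadratic polynomials
  -- in `t`. Its leading coefficient shows that `u ↦ b u v v` is midpoint convex.
  have hmid : ∀ x ∈ U, ∀ y ∈ U, ∀ v, b ((1 / 2 : ℝ) • x + (1 / 2 : ℝ) • y) v v ≤
      (b x v v + b y v v) / 2 := by
    intro x hx y hy v
    have hz := hsc.1 hx hy (by norm_num : (0 : ℝ) ≤ 1 / 2) (by norm_num : (0 : ℝ) ≤ 1 / 2)
      (by norm_num)
    set z := (1 / 2 : ℝ) • x + (1 / 2 : ℝ) • y with hzdef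
    have h1 : ∀ t : ℝ, 0 ≤ (f x / 2 + f y / 2 - f z) + t * (h x v / 2 + h y v / 2 - h z v) +
        t ^ 2 * (b x v v / 4 + b y v v / 4 - b z v v / 2) := by
      intro t
      have h2 := hsc.convexOn.2 (hUE hx (t • v)) (hUE hy (t • v))
        (by norm_num : (0 : ℝ) ≤ 1 / 2) (by norm_num : (0 : ℝ) ≤ 1 / 2) (by norm_num)
      have h3 : (1 / 2 : ℝ) • (x + ((t • v : E) : F)) + (1 / 2 : ℝ) • (y + ((t • v : E) : F)) =
          z + t • (v : F) := by
        rw [hzdef]; simp only [Submodule.coe_smul]; module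
      rw [h3, hline z hz v t, Submodule.coe_smul, hline x hx, hline y hy] at h2
      simp only [smul_eq_mul] at h2
      linarith
    have := coeff_nonneg_of_quadratic_nonneg h1
    linarith
  -- By homogeneity the distribution of `w ↦ b u w w` on `O` is the same for all `u`. Equal first
  -- moments force equality in the midpoint inequality; equal second moments then force `b x w w = b
  -- y w w`, as the square is strictly convex.
  have hbeq : ∀ x ∈ U, ∀ y ∈ U, ∀ v, b x v v = b y v v := by
    intro x hx y hy v
    set R := ‖v‖ + 1
    have hv : v ∈ orbitBall σ R := mem_orbitBall_of_norm_lt (by simp [R])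
    have hOb : Bornology.IsBounded (orbitBall σ R) := isBounded_orbitBall hC R
    have hOo : IsOpen (orbitBall σ R) := isOpen_orbitBall R
    set O := orbitBall σ R with hOdef
    set μ : Measure E := Measure.addHaar
    have hinv : ∀ φ : ℝ → ℝ, ∀ x ∈ U, ∀ y ∈ U,
        ∫ w in O, φ (b x w w) ∂μ = ∫ w in O, φ (b y w w) ∂μ := by
      intro φ x hx y hy
      obtain ⟨g, c, h1, h2, ℓ, k, h3⟩ := hf x hx y hy
      rw [← setIntegral_orbitBall_comp hdet R g fun w => φ (b y w w)]
      congr 2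
      ext w
      rw [(hbh x hx).1, (hbh y hy).1, ← h1, hσ, secondDiff_map h3 hx (hUE hx w) (hUE hx w)
        (hUE (hUE hx w) w)]
    have hz := hsc.1 hx hy (by norm_num : (0 : ℝ) ≤ 1 / 2) (by norm_num : (0 : ℝ) ≤ 1 / 2)
      (by norm_num)
    have hm := hmid x hx y hy
    set z := (1 / 2 : ℝ) • x + (1 / 2 : ℝ) • y with hzdef
    have i1 : ∀ u, IntegrableOn (fun w => b u w w) O μ := fun u =>
      integrableOn_of_isBounded hOb (hdiag_cont u)
    have i2 : ∀ u, IntegrableOn (fun w => b u w w ^ 2) O μ := fun u =>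
      integrableOn_of_isBounded hOb ((hdiag_cont u).pow 2)
    have e1 : ∀ w ∈ O, (b x w w + b y w w) / 2 - b z w w = 0 := by
      refine eq_zero_of_setIntegral_eq_zero hOb hOo (μ := μ)
        ((((hdiag_cont x).add (hdiag_cont y)).div_const 2).sub (hdiag_cont z))
        (fun w _ => by linarith [hm w]) ?_
      have i3 : IntegrableOn (fun w => (b x w w + b y w w) / 2) O μ :=
        ((i1 x).add (i1 y)).div_const 2
      rw [integral_sub i3 (i1 z), integral_div, integral_add (i1 x) (i1 y),
        hinv (fun r => r) x hx z hz, hinv (fun r => r) y hy z hz]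
      ring
    have e2 : ∀ w ∈ O, 2 * b x w w ^ 2 + 2 * b y w w ^ 2 - 4 * b z w w ^ 2 = 0 := by
      refine eq_zero_of_setIntegral_eq_zero hOb hOo (μ := μ)
        (((((hdiag_cont x).pow 2).const_mul 2).add (((hdiag_cont y).pow 2).const_mul 2)).sub
          (((hdiag_cont z).pow 2).const_mul 4)) (fun w hw => ?_) ?_
      · have := e1 w hw
        have h4 : b z w w = (b x w w + b y w w) / 2 := by linarith
        rw [h4]
        nlinarith [sq_nonneg (b x w w - b y w w)]
      · have i3 : IntegrableOn (fun w => 2 * b x w w ^ 2 + 2 * b y w w ^ 2) O μ :=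
          ((i2 x).const_mul 2).add ((i2 y).const_mul 2)
        rw [integral_sub i3 ((i2 z).const_mul 4), integral_add ((i2 x).const_mul 2)
          ((i2 y).const_mul 2), integral_const_mul, integral_const_mul, integral_const_mul,
          hinv (· ^ 2) x hx z hz, hinv (· ^ 2) y hy z hz]
        ring
    have h4 := e1 v hv
    have h5 := e2 v hv
    have h6 : b z v v = (b x v v + b y v v) / 2 := by linarith
    rw [h6] at h5
    have h7 : (b x v v - b y v v) ^ 2 = 0 := by linarith
    exact sub_eq_zero.1 (pow_eq_zero_iff two_ne_zero |>.1 h7)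
  obtain ⟨u₀, hu₀⟩ := hne
  have hquad : ∀ u ∈ U, ∀ v : E, f (u + v) = f u + h u v + b u₀ v v / 2 := fun u hu v => by
    rw [(hbh u hu).2.2 v, hbeq u hu u₀ hu₀]
  refine ⟨b u₀, h, (hbh u₀ hu₀).2.1, ?_, fun u hu v => ⟨hUE hu v, hquad u hu v⟩, ?_, ?_⟩
  · intro v hv
    have hne : u₀ + v ≠ u₀ + ((-v : E) : F) := by
      intro h1
      have h2 : v = -v := Subtype.ext (add_left_cancel h1)
      have h3 : (2 : ℝ) • v = 0 := by
        rw [two_smul]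
        nth_rewrite 1 [h2]
        exact neg_add_cancel v
      exact hv ((smul_eq_zero.1 h3).resolve_left two_ne_zero)
    have h1 := hsc.2 (hUE hu₀ v) (hUE hu₀ (-v)) hne (by norm_num : (0 : ℝ) < 1 / 2)
      (by norm_num : (0 : ℝ) < 1 / 2) (by norm_num)
    have h3 : (1 / 2 : ℝ) • (u₀ + (v : F)) + (1 / 2 : ℝ) • (u₀ + ((-v : E) : F)) = u₀ := by
      simp only [Submodule.coe_neg]; module
    rw [h3, hquad u₀ hu₀, hquad u₀ hu₀] at h1
    simp only [map_neg, LinearMap.neg_apply, smul_eq_mul] at h1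
    linarith
  · intro u hu s v
    have h1 := hquad _ (hUE hu s) v
    have h2 := hquad u hu (s + v)
    rw [hquad u hu s, add_assoc, ← Submodule.coe_add, h2] at h1
    simp only [map_add, LinearMap.add_apply] at h1
    have h3 := (hbh u₀ hu₀).2.1 s v
    linarith
  · intro x hx y hy p q hp hq hpq
    have hz := hsc.1 hx hy hp hq hpq
    ext v
    set z := p • x + q • y with hzdef
    -- With a common leading form the quadratic terms in `t` cancel, and an affine function of `t`
    -- that is bounded below has slope zero.
    have h1 : ∀ t : ℝ, 0 ≤ (p * f x + q * f y - f z) + t * (p * h x v + q * h y v - h z v) := by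
      intro t
      have h2 := hsc.convexOn.2 (hUE hx (t • v)) (hUE hy (t • v)) hp hq hpq
      have h3 : p • (x + ((t • v : E) : F)) + q • (y + ((t • v : E) : F)) = z + (t • v : E) := by
        have h4 : z + (t • v : E) = z + (p + q) • ((t • v : E) : F) := by rw [hpq, one_smul]
        rw [h4, hzdef]; module
      rw [h3, hquad z hz, hquad x hx, hquad y hy] at h2
      simp only [smul_eq_mul, map_smul] at h2
      have hq' : q = 1 - p := by linarith
      subst hq'
      linarith
    have := coeff_eq_zero_of_affine_nonneg h1
    simp only [LinearMap.add_apply, LinearMap.smul_apply, smul_eq_mul]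
    linarith

end Slices

end ConvexProjective


namespace ConvexProjective

open Module MeasureTheory

/-! ### Induction on dimension: homogeneous strictly convex functions are quadratic -/

section Quadratic

/-- A map which is affine on a nonempty open convex set extends to an affine map. -/
theorem exists_affine_extension {F W : Type*} [NormedAddCommGroup F] [NormedSpace ℝ F]
    [AddCommGroup W] [Module ℝ W] {U : Set F} (hU : IsOpen U) (hne : U.Nonempty)
    {a : F → W} (ha : ∀ x ∈ U, ∀ y ∈ U, ∀ p q : ℝ, 0 ≤ p → 0 ≤ q → p + q = 1 →
      a (p • x + q • y) = p • a x + q • a y) :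
    ∃ (L : F →ₗ[ℝ] W) (w : W), ∀ u ∈ U, a u = L u + w := by
  obtain ⟨u₀, hu₀⟩ := hne
  obtain ⟨δ, hδ, hball⟩ := Metric.isOpen_iff.1 hU u₀ hu₀
  set A : F → W := fun v => a (u₀ + v) - a u₀ with hA
  have hmem : ∀ v : F, ‖v‖ < δ → u₀ + v ∈ U := fun v hv => hball (by simpa using hv)
  have hscale : ∀ v : F, u₀ + v ∈ U → ∀ s : ℝ, 0 ≤ s → s ≤ 1 → A (s • v) = s • A v := by
    intro v hv s hs0 hs1
    have h1 := ha _ hu₀ _ hv (1 - s) s (by linarith) hs0 (by ring)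
    have h2 : (1 - s) • u₀ + s • (u₀ + v) = u₀ + s • v := by module
    rw [h2] at h1
    simp only [hA, h1]
    module
  -- The scale `τ v` brings `v` into the ball of radius `δ`, and `L v` is the slope of `A` along
  -- `v`. By `key` any other admissible scale gives the same slope.
  set τ : F → ℝ := fun v => δ / (‖v‖ + 1) with hτ
  have hτ0 : ∀ v, 0 < τ v := fun v => by positivity
  have hτlt : ∀ v, τ v * ‖v‖ < δ := fun v => by
    rw [hτ]
    simp only
    rw [div_mul_eq_mul_div, div_lt_iff₀ (by positivity)]
    nlinarith [norm_nonneg v]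
  set L : F → W := fun v => (τ v)⁻¹ • A (τ v • v) with hL
  have key : ∀ (v : F) (s : ℝ), 0 < s → s * ‖v‖ < δ → A (s • v) = s • L v := by
    intro v s hs hsv
    have hn : ∀ r : ℝ, 0 < r → r * ‖v‖ < δ → u₀ + r • v ∈ U := fun r hr hrv =>
      hmem _ (by rwa [norm_smul, Real.norm_of_nonneg hr.le])
    have ht := hτ0 v
    rcases le_total s (τ v) with h | h
    · have h1 := hscale (τ v • v) (hn _ ht (hτlt v)) (s / τ v) (by positivity)
        ((div_le_one ht).2 h)
      rw [smul_smul, div_mul_cancel₀ _ ht.ne'] at h1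
      rw [h1, hL]
      simp only
      rw [smul_smul, div_eq_mul_inv]
    · have h1 := hscale (s • v) (hn _ hs hsv) (τ v / s) (by positivity) ((div_le_one hs).2 h)
      rw [smul_smul, div_mul_cancel₀ _ hs.ne'] at h1
      rw [hL]
      simp only
      rw [h1, smul_smul, smul_smul]
      have : s * (τ v)⁻¹ * (τ v / s) = 1 := by field_simp
      rw [this, one_smul]
  have hexists : ∀ r : ℝ, 0 ≤ r → ∃ s : ℝ, 0 < s ∧ s ≤ 1 ∧ s * r < δ := by
    intro r hr
    refine ⟨min 1 (δ / (r + 1)), by positivity, min_le_left _ _, ?_⟩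
    calc _ ≤ δ / (r + 1) * r := mul_le_mul_of_nonneg_right (min_le_right _ _) hr
      _ < δ := by
        rw [div_mul_eq_mul_div, div_lt_iff₀ (by positivity)]
        nlinarith
  have hadd : ∀ v w, L (v + w) = L v + L w := by
    intro v w
    obtain ⟨s, hs0, -, hs⟩ := hexists (2 * ‖v‖ + 2 * ‖w‖) (by positivity)
    have hv : (2 * s) * ‖v‖ < δ := by nlinarith [norm_nonneg v, norm_nonneg w]
    have hw : (2 * s) * ‖w‖ < δ := by nlinarith [norm_nonneg v, norm_nonneg w]
    have hvw : s * ‖v + w‖ < δ := by nlinarith [norm_add_le v w, norm_nonneg v, norm_nonneg w]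
    have hn : ∀ z : F, (2 * s) * ‖z‖ < δ → u₀ + (2 * s) • z ∈ U := fun z hz =>
      hmem _ (by rwa [norm_smul, Real.norm_of_nonneg (by positivity)])
    have h1 := ha _ (hn v hv) _ (hn w hw) (1 / 2) (1 / 2) (by norm_num) (by norm_num) (by norm_num)
    have h2 : (1 / 2 : ℝ) • (u₀ + (2 * s) • v) + (1 / 2 : ℝ) • (u₀ + (2 * s) • w) =
        u₀ + s • (v + w) := by module
    rw [h2] at h1
    have h3 : A (s • (v + w)) = (1 / 2 : ℝ) • A ((2 * s) • v) + (1 / 2 : ℝ) • A ((2 * s) • w) := by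
      simp only [hA, h1]
      module
    rw [key _ s hs0 hvw, key _ _ (by positivity) hv, key _ _ (by positivity) hw] at h3
    have h4 : s • L (v + w) = s • (L v + L w) := by rw [h3]; module
    exact smul_right_injective W hs0.ne' h4
  have hpos : ∀ (c : ℝ) (v : F), 0 < c → L (c • v) = c • L v := by
    intro c v hc
    obtain ⟨s, hs0, -, hs⟩ := hexists (c * ‖v‖) (by positivity)
    have h1 := key (c • v) s hs0 (by rwa [norm_smul, Real.norm_of_nonneg hc.le])
    rw [smul_smul, key v (s * c) (by positivity) (by rwa [mul_assoc]), mul_smul] at h1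
    exact (smul_right_injective W hs0.ne' h1).symm
  have hzero : L 0 = 0 := by
    have := hadd 0 0
    rw [add_zero] at this
    exact left_eq_add.1 this
  have hneg : ∀ v, L (-v) = - L v := fun v => by
    have := hadd v (-v)
    rw [add_neg_cancel, hzero] at this
    exact (neg_eq_of_add_eq_zero_right this.symm).symm
  refine ⟨{ toFun := L, map_add' := hadd, map_smul' := fun c v => ?_ }, a u₀ - L u₀, ?_⟩
  · rcases lt_trichotomy c 0 with hc | rfl | hc
    · have := hpos (-c) v (by linarith)
      rw [neg_smul, hneg, neg_smul] at this
      exact neg_injective this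
    · simp [hzero]
    · exact hpos c v hc
  · intro u hu
    obtain ⟨s, hs0, hs1, hs⟩ := hexists ‖u - u₀‖ (norm_nonneg _)
    have h1 := key (u - u₀) s hs0 hs
    rw [hscale (u - u₀) (by simpa using hu) s hs0.le hs1] at h1
    have h2 := smul_right_injective W hs0.ne' h1
    have h3 : L (u - u₀) = L u - L u₀ := by rw [sub_eq_add_neg, hadd, hneg, sub_eq_add_neg]
    rw [h3] at h2
    simp only [hA, add_sub_cancel] at h2
    change a u = L u + (a u₀ - L u₀)
    rw [sub_eq_iff_eq_add.1 h2]
    abel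

universe u

/-- A nontrivial group action has a minimal nonzero invariant subspace. -/
theorem exists_minimal_invariant {F : Type*} [AddCommGroup F] [Module ℝ F] [FiniteDimensional ℝ F]
    [Nontrivial F] {G : Type*} [Group G] (ρ : G →* End ℝ F) :
    ∃ (E : Submodule ℝ F) (σ : G →* End ℝ E), E ≠ ⊥ ∧ (∀ g v, ((σ g v : E) : F) = ρ g v) ∧
      ∀ S : Submodule ℝ E, (∀ g, ∀ v ∈ S, σ g v ∈ S) → S = ⊥ ∨ S = ⊤ := by
  classical
  have hex : ∃ n, ∃ E : Submodule ℝ F, E ≠ ⊥ ∧ (∀ g, ∀ v ∈ E, ρ g v ∈ E) ∧ finrank ℝ E = n :=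
    ⟨_, ⊤, top_ne_bot, fun _ _ _ => trivial, rfl⟩
  obtain ⟨E, hE0, hE, hEn⟩ := Nat.find_spec hex
  let σ : G →* End ℝ E :=
    { toFun := fun g => (ρ g).restrict (hE g)
      map_one' := by ext; simp
      map_mul' := fun g h => by ext; simp }
  refine ⟨E, σ, hE0, fun g v => rfl, fun S hS => ?_⟩
  by_cases h0 : S = ⊥
  · exact Or.inl h0
  · right
    have h1 : Nat.find hex ≤ finrank ℝ (S.map E.subtype) := by
      refine Nat.find_min' hex ⟨S.map E.subtype, ?_, ?_, rfl⟩
      · rwa [Ne, (Submodule.map_injective_of_injective E.injective_subtype).eq_iff'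
          (Submodule.map_bot _)]
      · rintro g _ ⟨v, hv, rfl⟩
        exact ⟨σ g v, hS g v hv, rfl⟩
    rw [(Submodule.equivMapOfInjective _ E.injective_subtype S).finrank_eq.symm] at h1
    exact Submodule.eq_top_of_finrank_eq (le_antisymm (Submodule.finrank_le S) (hEn ▸ h1))

/-- A strictly convex function on a nonempty open convex set, homogeneous under affine maps
whose linear parts grow slowly, is a quadratic polynomial on the whole space. -/
theorem AffinelyHomogeneous.eq_quadratic {G : Type*} [Group G] (d : ℕ) :
    ∀ (F : Type u) [NormedAddCommGroup F] [NormedSpace ℝ F] [FiniteDimensional ℝ F]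
      (ρ : G →* End ℝ F) (U : Set F) (f : F → ℝ), finrank ℝ F = d →
      AffinelyHomogeneous ρ U f → (∀ g, SlowGrowth (ρ g)) → IsOpen U → U.Nonempty →
      StrictConvexOn ℝ U f →
      U = Set.univ ∧ ∃ (b : F →ₗ[ℝ] F →ₗ[ℝ] ℝ) (ℓ : F →ₗ[ℝ] ℝ) (k : ℝ),
        (∀ v t, b v t = b t v) ∧ (∀ v, v ≠ 0 → 0 < b v v) ∧ ∀ v, f v = b v v + ℓ v + k := by
  induction d using Nat.strong_induction_on with
  | _ d ih =>
  intro F _ _ _ ρ U f hd hf hρ hU hne hsc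
  rcases subsingleton_or_nontrivial F with hF | hF
  · refine ⟨Set.eq_univ_of_forall fun x => ?_, 0, 0, f 0, by simp,
      fun v hv => absurd (Subsingleton.elim v 0) hv, fun v => by
        rw [Subsingleton.elim v 0]; simp⟩
    obtain ⟨u, hu⟩ := hne
    rwa [Subsingleton.elim x u]
  let _ : MeasurableSpace F := borel F
  have _ : BorelSpace F := ⟨rfl⟩
  obtain ⟨E, σ, hE0, hσ, hirr⟩ := exists_minimal_invariant ρ
  have hσpow : ∀ g (k : ℕ) (v : E), (((σ g ^ k) v : E) : F) = (ρ g ^ k) v := by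
    intro g k v
    rw [← map_pow, ← map_pow, hσ]
  have hσslow : ∀ g, SlowGrowth (σ g) := by
    intro g v s hs
    obtain ⟨C, hC⟩ := hρ g v s hs
    exact ⟨C, fun k => by
      have := hC k
      rwa [← hσpow] at this⟩
  obtain ⟨C, hC⟩ := exists_bound_of_irreducible σ hσslow hirr
  have hdet : ∀ g, |LinearMap.det (σ g)| = 1 := by
    intro g
    have h1 := (hσslow g).abs_det_le
    have h2 := (hσslow g⁻¹).abs_det_le
    have h3 : |LinearMap.det (σ g)| * |LinearMap.det (σ g⁻¹)| = 1 := by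
      rw [← abs_mul, ← map_mul, ← map_mul, mul_inv_cancel, map_one, map_one, abs_one]
    nlinarith [abs_nonneg (LinearMap.det (σ g)), abs_nonneg (LinearMap.det (σ g⁻¹))]
  obtain ⟨b, h, hbs, hbpos, hform, hshift, haff⟩ := hf.exists_slice_form hU hsc hne hσ hC hdet
  obtain ⟨H, h₀, hH⟩ := exists_affine_extension hU hne haff
  have hinj : Function.Injective b := by
    rw [← LinearMap.ker_eq_bot, LinearMap.ker_eq_bot']
    intro v hv
    by_contra hv0
    have := hbpos v hv0
    rw [hv] at this
    simp at this
  let B : E ≃ₗ[ℝ] Dual ℝ E :=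
    LinearMap.linearEquivOfInjective b hinj Subspace.dual_finrank_eq.symm
  have hB : ∀ φ : Dual ℝ E, b (B.symm φ) = φ := fun φ => B.apply_symm_apply φ
  -- `D x` represents through `b` the linear part `H x` of the slope along the coset of `x`. It is a
  -- projection onto `E`, and on its kernel the slope along `E` is the constant `h₀`. This kernel is
  -- the complement along which `f` splits.
  let D : F →ₗ[ℝ] E := B.symm.toLinearMap ∘ₗ H
  have hD : ∀ x, b (D x) = H x := fun x => hB (H x)
  have hDE : ∀ s : E, D s = s := by
    intro s
    apply hinj
    rw [hD]
    ext v
    obtain ⟨u, hu⟩ := hne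
    have h1 := hshift u hu s v
    rw [hH u hu, hH _ (hform u hu s).1, map_add] at h1
    simp only [LinearMap.add_apply] at h1
    linarith
  set E' : Submodule ℝ F := LinearMap.ker D with hE'
  let π : F →ₗ[ℝ] E' := LinearMap.codRestrict E' (LinearMap.id - E.subtype ∘ₗ D) fun x => by
    simp [hE', hDE]
  have hπ : ∀ x, ((π x : E') : F) = x - D x := fun x => rfl
  have hπE : ∀ s : E, π s = 0 := fun s => Subtype.ext (by rw [hπ, hDE]; simp)
  have hπE' : ∀ x : E', π x = x := fun x => Subtype.ext (by
    rw [hπ, LinearMap.mem_ker.1 x.2]; simp)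
  have hπρ : ∀ g x, π (ρ g (π x)) = π (ρ g x) := by
    intro g x
    rw [hπ, map_sub, map_sub, ← hσ, hπE, sub_zero]
  -- The complement `E'` need not be invariant; `ρ'` is the action on the quotient by `E`, read on
  -- `E'`.
  let ρ' : G →* End ℝ E' :=
    { toFun := fun g => π ∘ₗ ρ g ∘ₗ E'.subtype
      map_one' := by
        ext x
        simp [hπE']
      map_mul' := fun g g' => by
        ext x
        simp [hπρ] }
  have hρ' : ∀ g x, ρ' g x = π (ρ g x) := fun g x => rfl
  have hlt : finrank ℝ E' < d := by
    rw [← hd]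
    refine Submodule.finrank_lt fun h => ?_
    obtain ⟨s, hs, hs0⟩ := Submodule.exists_mem_ne_zero_of_ne_bot hE0
    have h1 : s ∈ E' := by rw [h]; trivial
    rw [hE', LinearMap.mem_ker, hDE ⟨s, hs⟩] at h1
    exact hs0 (congrArg Subtype.val h1)
  have hUiff : ∀ x : F, x ∈ U ↔ ((π x : E') : F) ∈ U := by
    intro x
    constructor
    · intro hx
      have := (hform x hx (-D x)).1
      rwa [Submodule.coe_neg, ← sub_eq_add_neg, ← hπ] at this
    · intro hx
      have := (hform _ hx (D x)).1
      rwa [hπ, sub_add_cancel] at this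
  have hfsplit : ∀ x ∈ U, f x = f (π x) + h₀ (D x) + b (D x) (D x) / 2 := by
    intro x hx
    have h1 := (hform _ ((hUiff x).1 hx) (D x)).2
    have h2 : h ((π x : E') : F) = h₀ := by
      rw [hH _ ((hUiff x).1 hx), ← hD, LinearMap.mem_ker.1 (π x).2, map_zero, zero_add]
    rw [h2] at h1
    rw [← h1, hπ, sub_add_cancel]
  have hind := ih (finrank ℝ E') hlt E' ρ' (Subtype.val ⁻¹' U) (fun x => f x) rfl ?_ ?_
    (hU.preimage continuous_subtype_val) ?_ ?_
  · obtain ⟨hU', b', ℓ', k', hbs', hbpos', hf'⟩ := hind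
    have hUuniv : U = Set.univ := by
      refine Set.eq_univ_of_forall fun x => (hUiff x).2 ?_
      have : π x ∈ (Subtype.val ⁻¹' U : Set E') := by rw [hU']; trivial
      exact this
    refine ⟨hUuniv, b'.compl₁₂ π π + (1 / 2 : ℝ) • b.compl₁₂ D D, ℓ' ∘ₗ π + h₀ ∘ₗ D, k', ?_, ?_, ?_⟩
    · intro v t
      simp [hbs' (π v), hbs (D v)]
    · intro v hv
      simp only [LinearMap.add_apply, LinearMap.compl₁₂_apply, LinearMap.smul_apply, smul_eq_mul]
      have p1 : 0 ≤ b' (π v) (π v) := by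
        by_cases h0 : π v = 0
        · rw [h0]; simp
        · exact (hbpos' _ h0).le
      have p2 : 0 ≤ b (D v) (D v) := by
        by_cases h0 : D v = 0
        · rw [h0]; simp
        · exact (hbpos _ h0).le
      by_cases h0 : D v = 0
      · have : π v ≠ 0 := by
          intro h1
          apply hv
          have := hπ v
          rw [h1, h0] at this
          simpa using this.symm
        have := hbpos' _ this
        linarith
      · have := hbpos _ h0
        linarith
    · intro v
      rw [hfsplit v (by rw [hUuniv]; trivial), hf' (π v)]
      simp only [LinearMap.add_apply, LinearMap.compl₁₂_apply, LinearMap.smul_apply, smul_eq_mul,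
        LinearMap.comp_apply]
      ring
  · intro x hx y hy
    obtain ⟨g, c, h1, h2, ℓ, k, h3⟩ := hf x hx y hy
    have hgU : ∀ u : E', ρ' g u + π c = π (ρ g u + c) := fun u => by rw [hρ', map_add]
    refine ⟨g, π c, ?_, ?_, ℓ ∘ₗ E'.subtype,
      k - h₀ (D (ρ g x + c)) - b (D (ρ g x + c)) (D (ρ g x + c)) / 2, ?_⟩
    · rw [hgU, h1, hπE']
    · intro u
      rw [hgU, Set.mem_preimage, ← hUiff, h2]
      rfl
    · intro u hu
      -- Comparing slopes along `E` before and after the affine map, `b (D (ρ g w + c)) (σ g v)` is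
      -- independent of `w ∈ E'`. So the image of `E'` has constant `E`-component, and the `E`-part
      -- of `f` contributes only a constant.
      have hDconst : D (ρ g u + c) = D (ρ g x + c) := by
        have hval : ∀ w : E', (w : F) ∈ U → ∀ v : E, b (D (ρ g w + c)) (σ g v) =
            h₀ v + ℓ v + b v v / 2 - b (σ g v) (σ g v) / 2 - h₀ (σ g v) := by
          intro w hw v
          have hgw : ρ g w + c ∈ U := (h2 w).2 hw
          have e1 := h3 _ (hform w hw v).1
          have e2 : ρ g ((w : F) + v) + c = (ρ g w + c) + σ g v := by rw [map_add, hσ]; abel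
          rw [e2, (hform _ hgw _).2, (hform _ hw v).2, h3 _ hw, hH _ hgw, hH _ hw, ← hD, ← hD,
            LinearMap.mem_ker.1 w.2] at e1
          simp only [map_add, map_zero, zero_add, LinearMap.add_apply] at e1 ⊢
          linarith
        rw [← sub_eq_zero]
        by_contra hne0
        have e3 := hval u hu (σ g⁻¹ (D (ρ g u + c) - D (ρ g x + c)))
        rw [← hval x hx, map_self_apply_inv] at e3
        have := hbpos _ hne0
        rw [map_sub b, LinearMap.sub_apply] at this
        linarith
      have hgu : ρ g u + c ∈ U := (h2 u).2 hu
      have e4 := hfsplit _ hgu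
      rw [h3 _ hu, hDconst] at e4
      rw [hgU]
      simp only [LinearMap.comp_apply, Submodule.subtype_apply]
      linarith
  · intro g x s hs
    obtain ⟨K, hK⟩ := hρ g x s hs
    have hpow : ∀ k : ℕ, (ρ' g ^ k) x = π ((ρ g ^ k) x) := fun k => by
      rw [← map_pow, ← map_pow, hρ']
    refine ⟨‖LinearMap.toContinuousLinearMap π‖ * K, fun k => ?_⟩
    rw [hpow, mul_assoc]
    exact ((LinearMap.toContinuousLinearMap π).le_opNorm _).trans
      (mul_le_mul_of_nonneg_left (hK k) (norm_nonneg _))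
  · obtain ⟨u, hu⟩ := hne
    exact ⟨π u, (hUiff u).1 hu⟩
  · refine ⟨hsc.1.linear_preimage E'.subtype, fun x hx y hy hxy p q hp hq hpq => ?_⟩
    exact hsc.2 hx hy (fun h => hxy (Subtype.ext h)) hp hq hpq

end Quadratic

end ConvexProjective


namespace ConvexProjective

open Module Filter Topology

/-! ### Perron–Frobenius theory and fixed vectors of nilpotent groups -/

section Cones

variable {V : Type*} [NormedAddCommGroup V] [NormedSpace ℝ V]

/-- A closed convex cone on which the linear functional `ξ` dominates the norm. -/
structure IsSharpCone (N : Set V) (ξ : V →ₗ[ℝ] ℝ) : Prop where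
  isClosed : IsClosed N
  add_mem : ∀ x ∈ N, ∀ y ∈ N, x + y ∈ N
  smul_mem : ∀ c : ℝ, 0 ≤ c → ∀ x ∈ N, c • x ∈ N
  norm_le : ∀ x ∈ N, ‖x‖ ≤ ξ x

namespace IsSharpCone

variable {N : Set V} {ξ : V →ₗ[ℝ] ℝ}

theorem nonneg (hN : IsSharpCone N ξ) {x : V} (hx : x ∈ N) : 0 ≤ ξ x :=
  (norm_nonneg x).trans (hN.norm_le x hx)

theorem eq_zero_of_neg_mem (hN : IsSharpCone N ξ) {x : V} (hx : x ∈ N) (hx' : -x ∈ N) : x = 0 := by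
  have h1 := hN.norm_le x hx
  have h2 := hN.norm_le _ hx'
  rw [norm_neg, map_neg] at h2
  exact norm_le_zero_iff.1 (by linarith)

theorem sum_mem (hN : IsSharpCone N ξ) (h0 : (0 : V) ∈ N) {ι : Type*} (s : Finset ι) (x : ι → V)
    (hx : ∀ i ∈ s, x i ∈ N) : ∑ i ∈ s, x i ∈ N := by
  classical
  induction s using Finset.induction_on with
  | empty => simpa
  | insert a s ha ih =>
    rw [Finset.sum_insert ha]
    exact hN.add_mem _ (hx a (by simp)) _ (ih fun i hi => hx i (by simp [hi]))

variable [FiniteDimensional ℝ V]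

/-- A nonzero finite-dimensional cone has an order unit. -/
theorem exists_order_unit (hN : IsSharpCone N ξ) (hne : ∃ x ∈ N, x ≠ 0) :
    ∃ x ∈ N, x ≠ 0 ∧
      ∀ v ∈ Submodule.span ℝ N, ∃ C : ℝ, 0 < C ∧ C • x - v ∈ N ∧ C • x + v ∈ N := by
  classical
  obtain ⟨y, hy, hy0⟩ := hne
  have h0 : (0 : V) ∈ N := by simpa using hN.smul_mem 0 le_rfl y hy
  -- The order unit is the sum of a basis of the span chosen inside `N`.
  obtain ⟨b, hbN, hspan, hli⟩ := exists_linearIndependent ℝ N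
  have hfin : b.Finite := hli.setFinite
  set x := ∑ i ∈ hfin.toFinset, i with hx
  have hbN' : ∀ i ∈ hfin.toFinset, i ∈ N := fun i hi => hbN (hfin.mem_toFinset.1 hi)
  have hxN : x ∈ N := hN.sum_mem h0 _ _ hbN'
  have hunit : ∀ v ∈ Submodule.span ℝ N, ∃ C : ℝ, 0 < C ∧ C • x - v ∈ N ∧ C • x + v ∈ N := by
    rw [← hspan]
    intro v hv
    induction hv using Submodule.span_induction with
    | mem v hv =>
      have hv' := hfin.mem_toFinset.2 hv
      refine ⟨1, one_pos, ?_, ?_⟩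
      · rw [one_smul, hx, ← Finset.add_sum_erase _ _ hv', add_sub_cancel_left]
        exact hN.sum_mem h0 _ _ fun i hi => hbN' i (Finset.mem_of_mem_erase hi)
      · rw [one_smul]
        exact hN.add_mem _ hxN _ (hbN hv)
    | zero => exact ⟨1, one_pos, by simpa using hxN, by simpa using hxN⟩
    | add v w _ _ hv hw =>
      obtain ⟨C, hC, h1, h2⟩ := hv
      obtain ⟨D, hD, h3, h4⟩ := hw
      refine ⟨C + D, by positivity, ?_, ?_⟩
      · convert hN.add_mem _ h1 _ h3 using 1; module
      · convert hN.add_mem _ h2 _ h4 using 1; module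
    | smul c v _ hv =>
      obtain ⟨C, hC, h1, h2⟩ := hv
      have e1 : ∀ w, w ∈ N → x + |c| • w ∈ N := fun w hw =>
        hN.add_mem _ hxN _ (hN.smul_mem _ (abs_nonneg c) _ hw)
      refine ⟨|c| * C + 1, by positivity, ?_, ?_⟩
      · rcases le_total 0 c with hc | hc
        · convert e1 _ h1 using 1; rw [abs_of_nonneg hc]; module
        · convert e1 _ h2 using 1; rw [abs_of_nonpos hc]; module
      · rcases le_total 0 c with hc | hc
        · convert e1 _ h2 using 1; rw [abs_of_nonneg hc]; module
        · convert e1 _ h1 using 1; rw [abs_of_nonpos hc]; module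
  refine ⟨x, hxN, ?_, hunit⟩
  intro hx0
  obtain ⟨C, -, h1, -⟩ := hunit y (Submodule.subset_span hy)
  rw [hx0, smul_zero, zero_sub] at h1
  exact hy0 (hN.eq_zero_of_neg_mem hy h1)

/-- Perron–Frobenius: an injective map preserving a cone has an eigenvector in the cone whose
eigenvalue bounds the growth of all orbits in the span of the cone. -/
theorem exists_eigenvector (hN : IsSharpCone N ξ) (hne : ∃ x ∈ N, x ≠ 0) {A : End ℝ V}
    (hinj : Function.Injective A) (hA : ∀ x ∈ N, A x ∈ N) :
    ∃ r : ℝ, 0 < r ∧ (∃ y ∈ N, y ≠ 0 ∧ A y = r • y) ∧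
      ∀ v ∈ Submodule.span ℝ N, ∀ s, r < s → ∃ C : ℝ, ∀ k : ℕ, ‖(A ^ k) v‖ ≤ C * s ^ k := by
  obtain ⟨x, hx, hx0, hunit⟩ := hN.exists_order_unit hne
  have h0 : (0 : V) ∈ N := by simpa using hN.smul_mem 0 le_rfl x hx
  have hApow : ∀ k : ℕ, ∀ y ∈ N, (A ^ k) y ∈ N := by
    intro k
    induction k with
    | zero => intro y hy; simpa using hy
    | succ k ih => intro y hy; rw [pow_succ]; exact ih _ (hA y hy)
  -- In the order of `N`: the scalars `s` with `A y ≤ s y` for some `y ≥ x` (Collatz–Wielandt). Each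
  -- bounds the growth of all orbits in the span, and the infimum will be the eigenvalue.
  set R : Set ℝ := {s | 0 < s ∧ ∃ y ∈ N, y - x ∈ N ∧ s • y - A y ∈ N} with hR
  have hRne : R.Nonempty := by
    obtain ⟨C, hC, h1, -⟩ := hunit (A x) (Submodule.subset_span (hA x hx))
    exact ⟨C, hC, x, hx, by simpa using h0, h1⟩
  have hRbdd : BddBelow R := ⟨0, fun s hs => hs.1.le⟩
  have hgrow : ∀ s ∈ R, ∀ v ∈ Submodule.span ℝ N, ∃ C : ℝ, ∀ k : ℕ, ‖(A ^ k) v‖ ≤ C * s ^ k := by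
    rintro s ⟨hs, y, hy, hyx, hsy⟩ v hv
    obtain ⟨C, hC, h1, h2⟩ := hunit v hv
    have hpow : ∀ k : ℕ, s ^ k • y - (A ^ k) y ∈ N := by
      intro k
      induction k with
      | zero => simpa using h0
      | succ k ih =>
        have h3 := hN.add_mem _ (hN.smul_mem (s ^ k) (by positivity) _ hsy) _ (hA _ ih)
        convert h3 using 1
        rw [pow_succ' A, Module.End.mul_apply, map_sub, map_smul]
        module
    have h1' : C • y - v ∈ N := by
      convert hN.add_mem _ (hN.smul_mem C hC.le _ hyx) _ h1 using 1; module
    have h2' : C • y + v ∈ N := by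
      convert hN.add_mem _ (hN.smul_mem C hC.le _ hyx) _ h2 using 1; module
    refine ⟨C * ξ y, fun k => ?_⟩
    have n1 := hN.norm_le _ (hApow k _ h1')
    have n2 := hN.norm_le _ (hApow k _ h2')
    have n3 := hN.nonneg (hpow k)
    simp only [map_sub, map_add, map_smul, smul_eq_mul] at n1 n2 n3
    have h4 : (2 : ℝ) • (A ^ k) v = (C • (A ^ k) y + (A ^ k) v) - (C • (A ^ k) y - (A ^ k) v) := by
      module
    have h5 : 2 * ‖(A ^ k) v‖ ≤ ‖C • (A ^ k) y + (A ^ k) v‖ + ‖C • (A ^ k) y - (A ^ k) v‖ := by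
      rw [← Real.norm_of_nonneg (zero_le_two (α := ℝ)), ← norm_smul, h4]
      exact norm_sub_le _ _
    nlinarith
  set r := sInf R with hr
  have hr0 : 0 ≤ r := Real.sInf_nonneg fun s hs => hs.1.le
  have hbelow : ∀ s, r < s → ∃ s' ∈ R, s' < s := fun s hs => exists_lt_of_csInf_lt hRne hs
  -- A truncated Neumann series for `(s - A)⁻¹ x` at `s = r + 1/(j+1)`. The remainder `s⁻ᵐ Aᵐ x` is
  -- small for large `m`, since some member of `R` lies below `s`.
  have happrox : ∀ j : ℕ, ∃ z ∈ N, ∃ e : V, ‖e‖ ≤ 1 / ((j : ℝ) + 1) ∧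
      (r + 1 / ((j : ℝ) + 1)) • z - A z = x - e := by
    intro j
    have hj : (0 : ℝ) < 1 / ((j : ℝ) + 1) := by positivity
    set s := r + 1 / ((j : ℝ) + 1) with hs
    have hs0 : 0 < s := by linarith
    obtain ⟨s', hs'R, hs's⟩ := hbelow s (by linarith)
    obtain ⟨C, hC⟩ := hgrow s' hs'R x (Submodule.subset_span hx)
    have hlim : Tendsto (fun m : ℕ => C * (s' / s) ^ m) atTop (𝓝 (C * 0)) :=
      (tendsto_pow_atTop_nhds_zero_of_lt_one (div_nonneg hs'R.1.le hs0.le)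
        ((div_lt_one hs0).2 hs's)).const_mul C
    rw [mul_zero] at hlim
    obtain ⟨m, hm⟩ := (hlim.eventually (gt_mem_nhds hj)).exists
    refine ⟨∑ k ∈ Finset.range m, (s⁻¹) ^ (k + 1) • (A ^ k) x, ?_, (s⁻¹) ^ m • (A ^ m) x, ?_, ?_⟩
    · exact hN.sum_mem h0 _ _ fun k _ => hN.smul_mem _ (by positivity) _ (hApow k x hx)
    · rw [norm_smul, Real.norm_of_nonneg (by positivity)]
      refine le_trans ?_ hm.le
      calc (s⁻¹) ^ m * ‖(A ^ m) x‖ ≤ (s⁻¹) ^ m * (C * s' ^ m) :=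
            mul_le_mul_of_nonneg_left (hC m) (by positivity)
        _ = C * (s' / s) ^ m := by rw [div_pow, inv_pow]; ring
    · induction m with
      | zero => simp
      | succ m ih =>
        clear hm
        have ih' : s • ∑ k ∈ Finset.range m, (s⁻¹) ^ (k + 1) • (A ^ k) x -
            A (∑ k ∈ Finset.range m, (s⁻¹) ^ (k + 1) • (A ^ k) x) = x - (s⁻¹) ^ m • (A ^ m) x := by
          clear ih
          induction m with
          | zero => simp
          | succ m ih =>
            rw [Finset.sum_range_succ, smul_add, map_add, add_sub_add_comm, ih, map_smul,
              pow_succ' A, Module.End.mul_apply, smul_smul, pow_succ' s⁻¹ m, ← mul_assoc,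
              mul_inv_cancel₀ hs0.ne']
            module
        rw [Finset.sum_range_succ, smul_add, map_add, add_sub_add_comm, ih', map_smul,
          pow_succ' A, Module.End.mul_apply, smul_smul, pow_succ' s⁻¹ m, ← mul_assoc,
          mul_inv_cancel₀ hs0.ne']
        module
  choose z hzN e he hze using happrox
  -- Whether or not `z j` stays bounded, `(t, t z)` lies in a compact ball. A limit `(τ, w)`
  -- satisfies `r w - A w = τ x` and `‖w‖ = 1 - τ`.
  set t : ℕ → ℝ := fun j => (1 + ‖z j‖)⁻¹ with ht
  have ht0 : ∀ j, 0 < t j := fun j => by positivity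
  have htw : ∀ j, ‖t j • z j‖ = 1 - t j := fun j => by
    rw [norm_smul, Real.norm_of_nonneg (ht0 j).le, ht]
    simp only
    field_simp
    ring
  have hbd : ∀ j, ((t j, t j • z j) : ℝ × V) ∈ Metric.closedBall (0 : ℝ × V) 1 := fun j => by
    have h1 := norm_nonneg (t j • z j)
    rw [mem_closedBall_zero_iff, Prod.norm_mk, max_le_iff, Real.norm_of_nonneg (ht0 j).le, htw]
    rw [htw] at h1
    exact ⟨by linarith, by linarith [ht0 j]⟩
  have : ProperSpace V := FiniteDimensional.proper ℝ V
  obtain ⟨⟨τ, w⟩, -, φ, hφ, hlim⟩ := (isCompact_closedBall (0 : ℝ × V) 1).tendsto_subseq hbd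
  have hlim1 : Tendsto (fun j => t (φ j)) atTop (𝓝 τ) := (continuous_fst.tendsto _).comp hlim
  have hlim2 : Tendsto (fun j => t (φ j) • z (φ j)) atTop (𝓝 w) :=
    (continuous_snd.tendsto _).comp hlim
  have hτ0 : 0 ≤ τ := ge_of_tendsto' hlim1 fun j => (ht0 _).le
  have hwN : w ∈ N := hN.isClosed.mem_of_tendsto hlim2
    (Eventually.of_forall fun j => hN.smul_mem _ (ht0 _).le _ (hzN _))
  have hwnorm : ‖w‖ = 1 - τ := by
    refine tendsto_nhds_unique hlim2.norm ?_
    simp only [htw]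
    exact tendsto_const_nhds.sub hlim1
  have hj0 : Tendsto (fun j => 1 / ((φ j : ℝ) + 1)) atTop (𝓝 0) :=
    tendsto_one_div_add_atTop_nhds_zero_nat.comp hφ.tendsto_atTop
  have heq : r • w - A w = τ • x := by
    have l1 : Tendsto (fun j => (r + 1 / ((φ j : ℝ) + 1)) • (t (φ j) • z (φ j)) -
        A (t (φ j) • z (φ j))) atTop (𝓝 ((r + 0) • w - A w)) :=
      ((tendsto_const_nhds.add hj0).smul hlim2).sub
        (((LinearMap.continuous_of_finiteDimensional A).tendsto _).comp hlim2)
    have l2 : Tendsto (fun j => t (φ j) • (x - e (φ j))) atTop (𝓝 (τ • (x - 0))) :=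
      hlim1.smul (tendsto_const_nhds.sub
        (squeeze_zero_norm (fun j => he (φ j)) hj0))
    rw [add_zero] at l1
    rw [sub_zero] at l2
    refine tendsto_nhds_unique l1 (l2.congr fun j => ?_)
    rw [← hze, map_smul, smul_sub, smul_comm]
  -- If `τ > 0` then `r w - A w = τ x ≥ (τ / C) w`, so a multiple of `w` puts `r - τ / C` into `R`,
  -- below its infimum.
  have hτ : τ = 0 := by
    by_contra hne
    have hτpos : 0 < τ := lt_of_le_of_ne hτ0 (Ne.symm hne)
    obtain ⟨C, hC, h1, -⟩ := hunit w (Submodule.subset_span hwN)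
    have h2 : (r - τ / C) • w - A w ∈ N := by
      convert hN.smul_mem (τ / C) (by positivity) _ h1 using 1
      rw [smul_sub, smul_smul, div_mul_cancel₀ _ hC.ne', ← heq]
      module
    have hx_eq : x = τ⁻¹ • (r • w - A w) := by rw [heq, smul_smul, inv_mul_cancel₀ hne, one_smul]
    have hpos : 0 < r - τ / C := by
      by_contra! hle
      have h3 := hN.add_mem _ h2 _ (hN.smul_mem (-(r - τ / C)) (by linarith) _ hwN)
      have h4 : -(A w) ∈ N := by convert h3 using 1; module
      have h5 := hN.eq_zero_of_neg_mem (hA w hwN) h4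
      have h6 : w = 0 := hinj (by rw [h5, map_zero])
      rw [h6] at hx_eq
      simp at hx_eq
      exact hx0 hx_eq
    have hmem : r - τ / C ∈ R := by
      refine ⟨hpos, (τ⁻¹ * r) • w, hN.smul_mem _ (by positivity) _ hwN, ?_, ?_⟩
      · convert hN.smul_mem τ⁻¹ (by positivity) _ (hA w hwN) using 1
        rw [hx_eq]; module
      · convert hN.smul_mem (τ⁻¹ * r) (by positivity) _ h2 using 1
        rw [map_smul]; module
    have h7 := csInf_le hRbdd hmem
    have h8 : 0 < τ / C := by positivity
    linarith
  have hw0 : w ≠ 0 := by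
    rintro rfl
    rw [hτ] at hwnorm
    simp at hwnorm
  have hAw : A w = r • w := by
    rw [hτ, zero_smul] at heq
    exact (sub_eq_zero.1 heq).symm
  have hrpos : 0 < r := by
    refine lt_of_le_of_ne hr0 fun h => hw0 (hinj ?_)
    rw [hAw, ← h, zero_smul, map_zero]
  refine ⟨r, hrpos, ⟨w, hwN, hw0, hAw⟩, fun v hv s hs => ?_⟩
  obtain ⟨s', hs', hlt⟩ := hbelow s hs
  obtain ⟨C, hC⟩ := hgrow s' hs' v hv
  refine ⟨|C|, fun k => (hC k).trans ?_⟩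
  exact mul_le_mul (le_abs_self C) (pow_le_pow_left₀ hs'.1.le hlt.le k) (pow_nonneg hs'.1.le k)
    (abs_nonneg C)

end IsSharpCone

universe u

/-- A nontrivial representation of a nilpotent group has an element which acts nontrivially and
commutes with the action. -/
theorem exists_central_of_nilpotent {G M : Type*} [Group G] [Group.IsNilpotent G] [Monoid M]
    (ρ : G →* M) (hρ : ∃ g, ρ g ≠ 1) : ∃ z, ρ z ≠ 1 ∧ ∀ g, ρ z * ρ g = ρ g * ρ z := by
  classical
  obtain ⟨c, hc⟩ := Group.IsNilpotent.nilpotent G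
  have hex : ∃ k, ∃ z ∈ Subgroup.upperCentralSeries G k, ρ z ≠ 1 := by
    obtain ⟨g, hg⟩ := hρ
    exact ⟨c, g, by rw [hc]; trivial, hg⟩
  obtain ⟨z, hz, hz1⟩ := Nat.find_spec hex
  refine ⟨z, hz1, fun g => ?_⟩
  -- At the lowest level of the upper central series that acts nontrivially, commutators lie one
  -- level lower and act trivially.
  rcases hk : Nat.find hex with _ | k
  · rw [hk, Subgroup.upperCentralSeries_zero, Subgroup.mem_bot] at hz
    rw [hz, map_one] at hz1
    exact absurd rfl hz1
  · rw [hk, Subgroup.mem_upperCentralSeries_succ_iff] at hz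
    have h1 : ρ (z * g * z⁻¹ * g⁻¹) = 1 := by
      by_contra h
      exact Nat.find_min hex (m := k) (by omega) ⟨_, hz g, h⟩
    have h2 : z * g = (z * g * z⁻¹ * g⁻¹) * (g * z) := by group
    rw [← map_mul, h2, map_mul, h1, one_mul, map_mul]

/-- A nilpotent group of maps of slow growth which preserves a nonzero cone fixes a nonzero
vector of the cone. -/
theorem exists_fixed_of_nilpotent {G : Type*} [Group G] [Group.IsNilpotent G] (d : ℕ) :
    ∀ (V : Type u) [NormedAddCommGroup V] [NormedSpace ℝ V] [FiniteDimensional ℝ V]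
      (ρ : G →* End ℝ V) (N : Set V) (ξ : V →ₗ[ℝ] ℝ), finrank ℝ V = d →
      (∀ g, SlowGrowth (ρ g)) → IsSharpCone N ξ → (∀ g, ∀ x ∈ N, ρ g x ∈ N) →
      (∃ x ∈ N, x ≠ 0) → ∃ y ∈ N, y ≠ 0 ∧ ∀ g, ρ g y = y := by
  induction d using Nat.strong_induction_on with
  | _ d ih =>
  intro V _ _ _ ρ N ξ hd hρ hN hρN hne
  by_cases htriv : ∃ g, ρ g ≠ 1
  · obtain ⟨z, hz1, hzc⟩ := exists_central_of_nilpotent ρ htriv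
    have hinj : Function.Injective (ρ z) := fun x y hxy => by
      rw [← map_inv_apply_self ρ z x, hxy, map_inv_apply_self]
    obtain ⟨r, hr, ⟨y, hyN, hy0, hy⟩, -⟩ := hN.exists_eigenvector hne hinj (hρN z)
    -- Applied to `z` and to `z⁻¹`, this forces the eigenvalue `1`.
    have hle : ∀ (g : G) (r : ℝ), 0 < r → ρ g y = r • y → r ≤ 1 := by
      intro g r hr hg
      refine le_one_of_pow_le (norm_pos_iff.2 hy0) fun s hs => ?_
      obtain ⟨C, hC⟩ := hρ g y s hs
      refine ⟨C, fun k => ?_⟩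
      have hpow : (ρ g ^ k) y = r ^ k • y := by
        induction k with
        | zero => simp
        | succ k ih => rw [pow_succ', Module.End.mul_apply, ih, map_smul, hg, smul_smul, pow_succ]
      have := hC k
      rwa [hpow, norm_smul, Real.norm_of_nonneg (by positivity)] at this
    have hy' : ρ z⁻¹ y = r⁻¹ • y := by
      have h1 := map_inv_apply_self ρ z y
      rw [hy, map_smul] at h1
      rw [← h1, smul_smul, inv_mul_cancel₀ hr.ne', one_smul, h1]
    have hr1 : r = 1 := le_antisymm (hle z r hr hy) (by
      have := hle z⁻¹ r⁻¹ (by positivity) hy'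
      rwa [inv_le_one₀ hr] at this)
    rw [hr1, one_smul] at hy
    -- The fixed space of `ρ z` is invariant because `ρ z` is central, proper because `ρ z ≠ 1`, and
    -- it meets the cone in `y`; the induction continues there.
    set S : Submodule ℝ V := LinearMap.eqLocus (ρ z) 1 with hS
    have hSmem : ∀ x, x ∈ S ↔ ρ z x = x := fun x => Iff.rfl
    have hSinv : ∀ g, ∀ x ∈ S, ρ g x ∈ S := by
      intro g x hx
      rw [hSmem] at hx ⊢
      rw [← Module.End.mul_apply, hzc, Module.End.mul_apply, hx]
    let σ : G →* End ℝ S :=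
      { toFun := fun g => (ρ g).restrict (hSinv g)
        map_one' := by ext; simp
        map_mul' := fun g h => by ext; simp }
    have hσ : ∀ g (x : S), ((σ g x : S) : V) = ρ g x := fun g x => rfl
    have hlt : finrank ℝ S < d := by
      rw [← hd]
      refine Submodule.finrank_lt fun h => hz1 (LinearMap.ext fun x => ?_)
      have : x ∈ S := by rw [h]; trivial
      exact this
    obtain ⟨w, hwN, hw0, hw⟩ := ih _ hlt S σ (Subtype.val ⁻¹' N) (ξ ∘ₗ S.subtype) rfl
      (fun g v s hs => by
        obtain ⟨C, hC⟩ := hρ g v s hs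
        refine ⟨C, fun k => ?_⟩
        have h1 := hC k
        have h2 : (((σ g ^ k) v : S) : V) = (ρ g ^ k) v := by rw [← map_pow, ← map_pow, hσ]
        rwa [← h2] at h1)
      ⟨hN.isClosed.preimage continuous_subtype_val, fun x hx y hy => hN.add_mem _ hx _ hy,
        fun c hc x hx => hN.smul_mem c hc _ hx, fun x hx => hN.norm_le _ hx⟩
      (fun g x hx => hρN g _ hx) ⟨⟨y, hy⟩, hyN, fun h => hy0 (congrArg Subtype.val h)⟩
    exact ⟨w, hwN, fun h => hw0 (Subtype.ext h), fun g => congrArg Subtype.val (hw g)⟩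
  · push Not at htriv
    obtain ⟨y, hy, hy0⟩ := hne
    exact ⟨y, hy, hy0, fun g => by rw [htriv g]; rfl⟩

end Cones

end ConvexProjective


namespace ConvexProjective

open Module

/-! ### Transitive nilpotent groups of Euclidean isometries -/

section Isometric

universe u

/-- The larger `i`, the smaller the part of the group assumed to act trivially. One level higher the
elements act centrally, and a central isometry of a transitive group displaces all points by the
same distance. So it is a translation, by a vector fixed by all linear parts. On the orthogonal
complement of these vectors that level acts trivially too, and the induction hypothesis applies. -/
theorem linear_part_eq_one_of_upperCentralSeries {G : Type*} [Group G] {n : ℕ}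
    (hn : Subgroup.upperCentralSeries G n = ⊤) (i : ℕ) :
    ∀ (F : Type u) [NormedAddCommGroup F] [InnerProductSpace ℝ F] [FiniteDimensional ℝ F]
      (ρ : G →* End ℝ F) (c : G → F), (∀ g h, c (g * h) = ρ g (c h) + c g) →
      (∀ g v, ‖ρ g v‖ = ‖v‖) → Function.Surjective c →
      (∀ z ∈ Subgroup.upperCentralSeries G (n - i), ρ z = 1 ∧ c z = 0) → ∀ g, ρ g = 1 := by
  induction i with
  | zero =>
    intro F _ _ _ ρ c hc hiso hsurj hz g
    exact (hz g (by rw [Nat.sub_zero, hn]; trivial)).1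
  | succ i ih =>
  intro F _ _ _ ρ c hc hiso hsurj hz
  -- For `i ≥ n` natural subtraction gives `n - i = n - (i + 1) = 0`, so nothing changes.
  rcases Nat.lt_or_ge i n with hin | hin
  swap
  · exact ih F ρ c hc hiso hsurj (by rwa [show n - i = n - (i + 1) by omega])
  have hinner : ∀ g x y, inner ℝ (ρ g x) (ρ g y) = inner ℝ x y := fun g x y =>
    LinearIsometry.inner_map_map (⟨ρ g, hiso g⟩ : F →ₗᵢ[ℝ] F) x y
  have hcentral : ∀ z ∈ Subgroup.upperCentralSeries G (n - i), ρ z = 1 ∧ ∀ g, ρ g (c z) = c z := by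
    intro z hzmem
    rw [show n - i = (n - (i + 1)) + 1 by omega, Subgroup.mem_upperCentralSeries_succ_iff] at hzmem
    have h1 : ∀ g, ρ z (c g) + c z = ρ g (c z) + c g := by
      intro g
      obtain ⟨h2, h3⟩ := hz (z * g * z⁻¹ * g⁻¹) (hzmem g)
      have h4 : z * g = (z * g * z⁻¹ * g⁻¹) * (g * z) := by group
      rw [← hc, ← hc, h4, hc, h2, h3, add_zero, Module.End.one_apply]
    -- The displacement by `z` at `x = c g` equals `ρ g (c z)`. A displacement of bounded norm has
    -- zero linear part.
    have h5 : ∀ x, ‖(ρ z x - x) + c z‖ = ‖c z‖ := by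
      intro x
      obtain ⟨g, rfl⟩ := hsurj x
      rw [← hiso g (c z)]
      congr 1
      rw [← sub_eq_iff_eq_add.2 (h1 g)]
      abel
    have h6 : ρ z = 1 := by
      ext x
      rw [Module.End.one_apply, ← sub_eq_zero]
      by_contra hne
      have hpos := norm_pos_iff.2 hne
      obtain ⟨k, hk⟩ := exists_nat_gt (2 * ‖c z‖ / ‖ρ z x - x‖)
      rw [div_lt_iff₀ hpos] at hk
      have h7 := h5 ((k : ℝ) • x)
      rw [map_smul, ← smul_sub] at h7
      have h8 : ‖(k : ℝ) • (ρ z x - x)‖ ≤ ‖(k : ℝ) • (ρ z x - x) + c z‖ + ‖c z‖ := by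
        simpa using norm_sub_le ((k : ℝ) • (ρ z x - x) + c z) (c z)
      rw [h7, norm_smul, Real.norm_natCast] at h8
      linarith
    refine ⟨h6, fun g => ?_⟩
    have := h1 g
    rw [h6, Module.End.one_apply, add_comm] at this
    exact (add_right_cancel this).symm
  set T : Submodule ℝ F :=
    Submodule.span ℝ (c '' (Subgroup.upperCentralSeries G (n - i) : Set G)) with hT
  have hTfix : ∀ g, ∀ t ∈ T, ρ g t = t := by
    intro g t ht
    have h1 : T ≤ LinearMap.eqLocus (ρ g) 1 := by
      rw [hT, Submodule.span_le]
      rintro _ ⟨z, hzm, rfl⟩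
      exact (hcentral z hzm).2 g
    exact h1 ht
  have hperp : ∀ g, ∀ x ∈ Tᗮ, ρ g x ∈ Tᗮ := by
    intro g x hx
    rw [Submodule.mem_orthogonal] at hx ⊢
    intro t ht
    rw [← hTfix g t ht, hinner]
    exact hx t ht
  let ρ' : G →* End ℝ Tᗮ :=
    { toFun := fun g => (ρ g).restrict (hperp g)
      map_one' := by ext; simp
      map_mul' := fun g h => by ext; simp }
  have hρ' : ∀ g (x : Tᗮ), ((ρ' g x : Tᗮ) : F) = ρ g x := fun g x => rfl
  let P : F →L[ℝ] Tᗮ := Tᗮ.orthogonalProjectionOnto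
  have hPT : ∀ t ∈ T, P t = 0 := fun t ht =>
    Submodule.orthogonalProjectionOnto_apply_of_mem_orthogonal
      (Submodule.le_orthogonal_orthogonal T ht)
  have hPself : ∀ x : Tᗮ, P x = x := fun x =>
    Submodule.orthogonalProjectionOnto_mem_subspace_eq_self x
  have hdecomp : ∀ x, x - P x ∈ T := by
    intro x
    have h1 := Submodule.sub_starProjection_mem_orthogonal (K := Tᗮ) x
    rwa [Submodule.orthogonal_orthogonal] at h1
  have hPρ : ∀ g x, P (ρ g x) = ρ' g (P x) := by
    intro g x
    have h1 : ρ g x = (x - P x) + ((ρ' g (P x) : Tᗮ) : F) := by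
      rw [hρ', ← hTfix g _ (hdecomp x), ← map_add, sub_add_cancel]
    rw [h1, map_add, hPT _ (hdecomp x), hPself, zero_add]
  have hρ'1 := ih Tᗮ ρ' (fun g => P (c g))
    (fun g h => by rw [hc, map_add, hPρ])
    (fun g v => hiso g v)
    (fun x => by
      obtain ⟨g, hg⟩ := hsurj x
      exact ⟨g, by simp only [hg, hPself]⟩)
    (fun z hzm => by
      refine ⟨?_, hPT _ (Submodule.subset_span ⟨z, hzm, rfl⟩)⟩
      ext x
      rw [hρ', (hcentral z hzm).1]
      rfl)
  intro g
  ext x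
  have h1 : ρ g x = (x - P x) + ((ρ' g (P x) : Tᗮ) : F) := by
    rw [hρ', ← hTfix g _ (hdecomp x), ← map_add, sub_add_cancel]
  rw [h1, hρ'1 g]
  simp

/-- A transitive isometric action of a nilpotent group on a Euclidean space is by translations. -/
theorem linear_part_eq_one_of_nilpotent {G : Type*} [Group G] [Group.IsNilpotent G]
    {F : Type u} [NormedAddCommGroup F] [InnerProductSpace ℝ F] [FiniteDimensional ℝ F]
    (ρ : G →* End ℝ F) (c : G → F) (hc : ∀ g h, c (g * h) = ρ g (c h) + c g)
    (hiso : ∀ g v, ‖ρ g v‖ = ‖v‖) (hsurj : Function.Surjective c) (g : G) : ρ g = 1 := by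
  obtain ⟨n, hn⟩ := Group.IsNilpotent.nilpotent G
  refine linear_part_eq_one_of_upperCentralSeries hn n F ρ c hc hiso hsurj ?_ g
  intro z hz
  rw [Nat.sub_self, Subgroup.upperCentralSeries_zero, Subgroup.mem_bot] at hz
  subst hz
  refine ⟨map_one ρ, ?_⟩
  have := hc 1 1
  rw [mul_one, map_one, Module.End.one_apply] at this
  exact left_eq_add.1 this

end Isometric

end ConvexProjective


namespace ConvexProjective

open Module Topology

/-! ### Topology of projective space read on cones -/

section Dictionary

variable {n : ℕ}

/-- The quotient map `ℝⁿ⁺¹ ∖ {0} → ℝPⁿ`. -/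
noncomputable def toRP (n : ℕ) (v : {v : Fin (n + 1) → ℝ // v ≠ 0}) : RP n :=
  Projectivization.mk ℝ v.1 v.2

theorem isQuotientMap_toRP (n : ℕ) : IsQuotientMap (toRP n) :=
  ⟨⟨rfl⟩, fun x => ⟨⟨x.rep, x.rep_nonzero⟩, x.mk_rep⟩⟩

/-- The saturation of an open set is the union of its multiples by nonzero scalars. Openness lets
closures and interiors be computed on the cone. -/
theorem isOpenMap_toRP (n : ℕ) : IsOpenMap (toRP n) := by
  intro U hU
  rw [← (isQuotientMap_toRP n).isOpen_preimage]
  have h1 : toRP n ⁻¹' (toRP n '' U) = ⋃ c : ℝˣ,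
      (fun v : {v : Fin (n + 1) → ℝ // v ≠ 0} =>
        (⟨c • v.1, (smul_ne_zero_iff_ne c).2 v.2⟩ : {v : Fin (n + 1) → ℝ // v ≠ 0})) ⁻¹' U := by
    ext v
    simp only [Set.mem_preimage, Set.mem_image, Set.mem_iUnion]
    constructor
    · rintro ⟨w, hw, hwv⟩
      obtain ⟨c, hc⟩ := (Projectivization.mk_eq_mk_iff ℝ _ _ w.2 v.2).1 hwv
      refine ⟨c, ?_⟩
      convert hw using 1
      exact Subtype.ext hc
    · rintro ⟨c, hc⟩
      exact ⟨_, hc, (Projectivization.mk_eq_mk_iff ℝ _ _ _ v.2).2 ⟨c, rfl⟩⟩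
  rw [h1]
  refine isOpen_iUnion fun c => hU.preimage ?_
  exact (continuous_subtype_val.const_smul c).subtype_mk _

theorem preimage_val_coneOver (C : Set (RP n)) :
    (Subtype.val ⁻¹' coneOver C : Set {v : Fin (n + 1) → ℝ // v ≠ 0}) = toRP n ⁻¹' C := by
  ext v
  exact ⟨fun ⟨_, h⟩ => h, fun h => ⟨v.2, h⟩⟩

theorem isOpenMap_subtype_ne_zero :
    IsOpenMap (Subtype.val : {v : Fin (n + 1) → ℝ // v ≠ 0} → Fin (n + 1) → ℝ) :=
  (isOpen_compl_singleton (x := (0 : Fin (n + 1) → ℝ))).isOpenMap_subtype_val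

theorem mk_mem_closure_iff {C : Set (RP n)} {v : Fin (n + 1) → ℝ} (hv : v ≠ 0) :
    Projectivization.mk ℝ v hv ∈ closure C ↔ v ∈ closure (coneOver C) := by
  have h1 := (isOpenMap_toRP n).preimage_closure_eq_closure_preimage
    (isQuotientMap_toRP n).continuous C
  have h2 := (isOpenMap_subtype_ne_zero (n := n)).preimage_closure_eq_closure_preimage
    continuous_subtype_val (coneOver C)
  rw [preimage_val_coneOver, ← h1] at h2
  exact (Set.ext_iff.1 h2 ⟨v, hv⟩).symm

theorem mk_mem_interior_iff {C : Set (RP n)} {v : Fin (n + 1) → ℝ} (hv : v ≠ 0) :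
    Projectivization.mk ℝ v hv ∈ interior C ↔ v ∈ interior (coneOver C) := by
  have h1 := (isOpenMap_toRP n).preimage_interior_eq_interior_preimage
    (isQuotientMap_toRP n).continuous C
  have h2 := (isOpenMap_subtype_ne_zero (n := n)).preimage_interior_eq_interior_preimage
    continuous_subtype_val (coneOver C)
  rw [preimage_val_coneOver, ← h1] at h2
  exact (Set.ext_iff.1 h2 ⟨v, hv⟩).symm

theorem mk_mem_bdry_iff {C : Set (RP n)} {v : Fin (n + 1) → ℝ} (hv : v ≠ 0) :
    Projectivization.mk ℝ v hv ∈ bdry C ↔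
      v ∈ closure (coneOver C) ∧ v ∉ interior (closure (coneOver C)) := by
  have h1 : interior (coneOver (closure C)) = interior (closure (coneOver C) ∩ {0}ᶜ) := by
    congr 1
    ext w
    constructor
    · rintro ⟨hw, h⟩
      exact ⟨(mk_mem_closure_iff hw).1 h, hw⟩
    · rintro ⟨h, hw⟩
      exact ⟨hw, (mk_mem_closure_iff hw).2 h⟩
  rw [bdry, frontier, Set.mem_sdiff, closure_closure, mk_mem_closure_iff, mk_mem_interior_iff, h1,
    interior_inter, isOpen_compl_singleton.interior_eq]
  simp [hv]

theorem isOpen_coneOver {C : Set (RP n)} (hC : IsOpen C) : IsOpen (coneOver C) := by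
  have h1 := isOpenMap_subtype_ne_zero (n := n) _ (hC.preimage (isQuotientMap_toRP n).continuous)
  convert h1 using 1
  ext v
  exact ⟨fun ⟨hv, h⟩ => ⟨⟨v, hv⟩, h, rfl⟩, fun ⟨w, hw, hwv⟩ => hwv ▸ ⟨w.2, hw⟩⟩

theorem smul_mem_coneOver {C : Set (RP n)} {v : Fin (n + 1) → ℝ} (hv : v ∈ coneOver C) {c : ℝ}
    (hc : c ≠ 0) : c • v ∈ coneOver C := by
  obtain ⟨hv0, h⟩ := hv
  refine ⟨smul_ne_zero hc hv0, ?_⟩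
  convert h using 1
  exact (Projectivization.mk_eq_mk_iff' ℝ _ _ _ _).2 ⟨c, rfl⟩

/-- `K` is the component on which `ξ > 0` of the cone over a strictly convex open set `Ω`. -/
structure IsConeOver (Ω : Set (RP n)) (K : Set (Fin (n + 1) → ℝ))
    (ξ : (Fin (n + 1) → ℝ) →ₗ[ℝ] ℝ) : Prop where
  isOpen : IsOpen K
  convex : Convex ℝ K
  smul_mem : ∀ c : ℝ, 0 < c → ∀ x ∈ K, c • x ∈ K
  pos : ∀ x ∈ closure K, x ≠ 0 → 0 < ξ x
  coneOver_eq : coneOver Ω = K ∪ -K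
  mem_bdry_iff : ∀ (v : Fin (n + 1) → ℝ) (hv : v ≠ 0), 0 < ξ v →
    (Projectivization.mk ℝ v hv ∈ bdry Ω ↔ v ∈ closure K ∧ v ∉ K)
  ne_zero_of_mem_bdry : ∀ (v : Fin (n + 1) → ℝ) (hv : v ≠ 0),
    Projectivization.mk ℝ v hv ∈ bdry Ω → ξ v ≠ 0
  pos_of_mem : ∀ x ∈ K, 0 < ξ x

theorem exists_ker_eq {U : Submodule ℝ (Fin (n + 1) → ℝ)} (hU : finrank ℝ U = n) :
    ∃ ξ : (Fin (n + 1) → ℝ) →ₗ[ℝ] ℝ, LinearMap.ker ξ = U := by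
  have hlt : U < ⊤ := by
    rw [lt_top_iff_ne_top]
    rintro rfl
    simp at hU
  obtain ⟨f, hf0, hf⟩ := Submodule.exists_le_ker_of_lt_top U hlt
  refine ⟨f, (Submodule.eq_of_le_of_finrank_eq hf ?_).symm⟩
  have h1 := Module.Dual.finrank_ker_add_one_of_ne_zero hf0
  simp at h1
  omega

/-- On the projective line through `a` and `b`, the point of the segment and the zero of `ξ`
separate `a` from `b`. If `Ω` missed both, its trace on the line would be disconnected. -/
theorem isConvex_coneOver_pos {Ω : Set (RP n)} (hΩ : IsConvex Ω)
    {ξ : (Fin (n + 1) → ℝ) →ₗ[ℝ] ℝ} (hξ : ∀ v ∈ coneOver Ω, ξ v ≠ 0) :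
    Convex ℝ (coneOver Ω ∩ {v | 0 < ξ v}) := by
  rw [convex_iff_forall_pos]
  rintro a ⟨ha, ha'⟩ b ⟨hb, hb'⟩ p q hp hq -
  rw [Set.mem_ofPred_eq] at ha' hb'
  have hξc : 0 < ξ (p • a + q • b) := by
    rw [map_add, map_smul, map_smul, smul_eq_mul, smul_eq_mul]; positivity
  refine ⟨?_, hξc⟩
  by_cases hab : b ∈ Submodule.span ℝ {a}
  · obtain ⟨c, rfl⟩ := Submodule.mem_span_singleton.1 hab
    rw [map_smul, smul_eq_mul] at hb'
    have hc : 0 < c := (pos_iff_pos_of_mul_pos hb').2 ha'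
    rw [smul_smul, ← add_smul]
    exact smul_mem_coneOver ha (by positivity)
  obtain ⟨η, hηb, hηa⟩ := Submodule.exists_le_ker_of_notMem hab
  have hηa' : η a = 0 := hηa (Submodule.mem_span_singleton_self a)
  set c := p • a + q • b with hc
  have hc0 : c ≠ 0 := by
    intro h
    rw [h, map_zero] at hξc
    exact lt_irrefl _ hξc
  have hηc : η c = q * η b := by rw [hc, map_add, map_smul, map_smul, hηa']; simp
  by_contra hcΩ
  have hcΩ' : ∀ x ∈ coneOver Ω, x ∈ Submodule.span ℝ {a, b} → η x * ξ c ≠ η c * ξ x := by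
    intro x hx hxs h
    obtain ⟨α, β, rfl⟩ := Submodule.mem_span_pair.1 hxs
    have hξx := hξ _ hx
    rw [hηc] at h
    simp only [map_add, map_smul, hηa', smul_eq_mul, mul_zero, zero_add, hc] at h hξx
    have h2 : η b * ξ a * (β * p - q * α) = 0 := by linear_combination h
    have h3 : β * p = q * α := by
      rcases mul_eq_zero.1 h2 with h2 | h2
      · exact absurd h2 (mul_ne_zero hηb ha'.ne')
      · linarith
    apply hcΩ
    have hβ : β ≠ 0 := by
      rintro rfl
      have : α = 0 := by
        rw [zero_mul] at h3
        exact (mul_eq_zero.1 h3.symm).resolve_left hq.ne'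
      rw [this] at hξx
      simp at hξx
    have h4 : c = (q / β) • (α • a + β • b) := by
      rw [hc, smul_add, smul_smul, smul_smul, div_mul_cancel₀ _ hβ]
      congr 2
      field_simp
      linarith
    rw [h4]
    exact smul_mem_coneOver hx (div_ne_zero hq.ne' hβ)
  have hηb2 : ∀ x : Fin (n + 1) → ℝ, ∀ r : ℝ, r ≠ 0 → ∀ s : ℝ,
      (s * η (r • x) * ξ (r • x) < s * η c / ξ c * ξ (r • x) ^ 2 ↔
        s * η x * ξ x < s * η c / ξ c * ξ x ^ 2) := by
    intro x r hr s
    have hr2 : 0 < r ^ 2 := by positivity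
    rw [map_smul, map_smul, smul_eq_mul, smul_eq_mul]
    rw [← mul_lt_mul_iff_right₀ hr2 (b := s * η x * ξ x)]
    have e1 : s * (r * η x) * (r * ξ x) = r ^ 2 * (s * η x * ξ x) := by ring
    have e2 : s * η c / ξ c * (r * ξ x) ^ 2 = r ^ 2 * (s * η c / ξ c * ξ x ^ 2) := by ring
    rw [e1, e2]
  -- For `s = ±σ` these are the two sides `η / ξ < η c / ξ c` and `η / ξ > η c / ξ c`.
  -- Multiplication by `ξ²` makes the condition independent of the representative; `σ` will carry
  -- the sign of `η b`.
  let O : ℝ → Set (RP n) := fun s =>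
    {z | s * η z.rep * ξ z.rep < s * η c / ξ c * ξ z.rep ^ 2}
  have hO : ∀ s (v : Fin (n + 1) → ℝ) (hv : v ≠ 0), Projectivization.mk ℝ v hv ∈ O s ↔
      s * η v * ξ v < s * η c / ξ c * ξ v ^ 2 := by
    intro s v hv
    obtain ⟨r, hr⟩ := Projectivization.exists_smul_eq_mk_rep ℝ v hv
    change s * η (Projectivization.mk ℝ v hv).rep * ξ (Projectivization.mk ℝ v hv).rep < _ ↔ _
    rw [← hr]
    exact hηb2 v r r.ne_zero s
  have hOopen : ∀ s, IsOpen (O s) := by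
    intro s
    rw [← (isQuotientMap_toRP n).isOpen_preimage]
    have h1 : toRP n ⁻¹' O s = {v | s * η v.1 * ξ v.1 < s * η c / ξ c * ξ v.1 ^ 2} := by
      ext v
      exact hO s v.1 v.2
    rw [h1]
    have hηc' := LinearMap.continuous_of_finiteDimensional η
    have hξc' := LinearMap.continuous_of_finiteDimensional ξ
    exact isOpen_lt (by fun_prop) (by fun_prop)
  have hli : LinearIndependent ℝ ![a, b] := by
    refine LinearIndependent.pair_iff.2 fun s t hst => ?_
    have h1 := congrArg η hst
    simp only [map_add, map_smul, hηa', smul_eq_mul, mul_zero, zero_add, map_zero] at h1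
    have ht : t = 0 := (mul_eq_zero.1 h1).resolve_right hηb
    have h2 := congrArg ξ hst
    simp only [ht, map_smul, zero_smul, add_zero, smul_eq_mul, map_zero] at h2
    exact ⟨(mul_eq_zero.1 h2).resolve_right ha'.ne', ht⟩
  have hpre := hΩ (projSubspace (Submodule.span ℝ {a, b})) ⟨_, by
    have := finrank_span_eq_card hli
    rwa [Matrix.range_cons, Matrix.range_cons, Matrix.range_empty, Set.union_empty,
      Set.singleton_union, Fintype.card_fin] at this, rfl⟩
  have hmemL : ∀ (v : Fin (n + 1) → ℝ) (hv : v ≠ 0), Projectivization.mk ℝ v hv ∈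
      projSubspace (Submodule.span ℝ {a, b}) ↔ v ∈ Submodule.span ℝ {a, b} := by
    intro v hv
    simp [projSubspace, Projectivization.submodule_mk]
  obtain ⟨ha0, haΩ⟩ := ha
  obtain ⟨hb0, hbΩ⟩ := hb
  have hσ : ∃ σ : ℝ, 0 < σ * η b := by
    rcases lt_or_gt_of_ne hηb with h | h
    · exact ⟨-1, by linarith⟩
    · exact ⟨1, by linarith⟩
  obtain ⟨σ, hσ⟩ := hσ
  have hσ0 : σ ≠ 0 := by rintro rfl; simp at hσ
  have hresult := hpre (O σ) (O (-σ)) (hOopen _) (hOopen _) ?_ ?_ ?_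
  · obtain ⟨z, -, hz1, hz2⟩ := hresult
    have h1 : σ * η z.rep * ξ z.rep < σ * η c / ξ c * ξ z.rep ^ 2 := hz1
    have h2 : -σ * η z.rep * ξ z.rep < -σ * η c / ξ c * ξ z.rep ^ 2 := hz2
    rw [neg_mul, neg_mul, neg_mul, neg_div, neg_mul] at h2
    linarith
  · rintro z ⟨hz1, hz2⟩
    induction z using Projectivization.ind with
    | h v hv =>
    rw [Set.mem_union, hO, hO]
    have h1 := hcΩ' v ⟨hv, hz2⟩ ((hmemL v hv).1 hz1)
    have h2 : ξ v ≠ 0 := hξ v ⟨hv, hz2⟩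
    have h3 : σ * η v * ξ v ≠ σ * η c / ξ c * ξ v ^ 2 := by
      intro h
      apply h1
      have : σ * ξ v * (η v * ξ c - η c * ξ v) = 0 := by
        have h4 : σ * η c / ξ c * ξ v ^ 2 * ξ c = σ * η c * ξ v ^ 2 := by
          field_simp
        linear_combination ξ c * h + h4
      rcases mul_eq_zero.1 this with h5 | h5
      · exact absurd h5 (mul_ne_zero hσ0 h2)
      · linarith
    rcases lt_or_gt_of_ne h3 with h | h
    · exact Or.inl h
    · right
      rw [neg_mul, neg_mul, neg_mul, neg_div, neg_mul]
      linarith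
  · refine ⟨_, ⟨(hmemL a ha0).2 (Submodule.subset_span (by simp)), haΩ⟩, ?_⟩
    rw [hO, hηa', hηc]
    have : 0 < σ * (q * η b) / ξ c * ξ a ^ 2 := by
      have : σ * (q * η b) = q * (σ * η b) := by ring
      rw [this]; positivity
    simpa using this
  · refine ⟨_, ⟨(hmemL b hb0).2 (Submodule.subset_span (by simp)), hbΩ⟩, ?_⟩
    rw [hO, hηc]
    have h1 : q * ξ b < ξ c := by
      rw [hc, map_add, map_smul, map_smul, smul_eq_mul, smul_eq_mul]
      nlinarith [mul_pos hp ha']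
    have h2 : σ * (q * η b) / ξ c * ξ b ^ 2 = (σ * η b * ξ b) * (q * ξ b / ξ c) := by ring
    have h3 : q * ξ b / ξ c < 1 := (div_lt_one hξc).2 h1
    have h4 : 0 < σ * η b * ξ b := by positivity
    rw [neg_mul, neg_mul, neg_mul, neg_div, neg_mul, h2]
    nlinarith

end Dictionary

end ConvexProjective


namespace ConvexProjective

open Module Topology

/-! ### The convex cone over a properly convex domain -/

section Dictionary

variable {n : ℕ}

/-- Every properly convex open set has a cone. -/
theorem exists_isConeOver {Ω : Set (RP n)} (hopen : IsOpen Ω) (hΩ : IsProperlyConvex Ω) :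
    ∃ (K : Set (Fin (n + 1) → ℝ)) (ξ : (Fin (n + 1) → ℝ) →ₗ[ℝ] ℝ), IsConeOver Ω K ξ := by
  obtain ⟨hconv, _, ⟨U, hU, rfl⟩, hsub⟩ := hΩ
  obtain ⟨ξ, hξU⟩ := exists_ker_eq hU
  have hξc : Continuous ξ := LinearMap.continuous_of_finiteDimensional ξ
  have hne_cl : ∀ v ∈ closure (coneOver Ω), v ≠ 0 → ξ v ≠ 0 := by
    intro v hv hv0 h
    have h1 := hsub ((mk_mem_closure_iff hv0).2 hv)
    apply h1
    rw [projSubspace, Set.mem_ofPred_eq, Projectivization.submodule_mk,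
      Submodule.span_singleton_le_iff_mem, ← hξU]
    exact h
  have hne : ∀ v ∈ coneOver Ω, ξ v ≠ 0 := fun v hv => by
    obtain ⟨hv0, -⟩ := id hv
    exact hne_cl v (subset_closure hv) hv0
  have hconvK := isConvex_coneOver_pos hconv hne
  have hopenc := isOpen_coneOver hopen
  have hopos : IsOpen {v : Fin (n + 1) → ℝ | 0 < ξ v} := isOpen_lt continuous_const hξc
  set K := coneOver Ω ∩ {v | 0 < ξ v} with hK
  have hKopen : IsOpen K := hopenc.inter hopos
  have heq : coneOver Ω = K ∪ -K := by
    ext v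
    constructor
    · intro hv
      rcases lt_or_gt_of_ne (hne v hv) with h | h
      · right
        refine ⟨?_, ?_⟩
        · simpa using smul_mem_coneOver hv (c := -1) (by norm_num)
        · rw [Set.mem_ofPred_eq, map_neg]; linarith
      · exact Or.inl ⟨hv, h⟩
    · rintro (hv | hv)
      · exact hv.1
      · simpa using smul_mem_coneOver (Set.mem_neg.1 hv).1 (c := -1) (by norm_num)
  have hclK : closure K ⊆ {v | 0 ≤ ξ v} := closure_minimal (fun v hv => (show 0 ≤ ξ v from le_of_lt hv.2))
    (isClosed_le continuous_const hξc)
  refine ⟨K, ξ, hKopen, hconvK, ?_, ?_, heq, ?_, ?_, fun x hx => hx.2⟩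
  · rintro c hc x ⟨hx, hx'⟩
    refine ⟨smul_mem_coneOver hx hc.ne', ?_⟩
    rw [Set.mem_ofPred_eq, map_smul, smul_eq_mul]
    exact mul_pos hc hx'
  · intro x hx hx0
    exact lt_of_le_of_ne (hclK hx) (hne_cl x (closure_mono Set.inter_subset_left hx) hx0).symm
  · intro v hv hξv
    rw [mk_mem_bdry_iff hv]
    have h1 : closure (coneOver Ω) ∩ {v | 0 < ξ v} = closure K ∩ {v | 0 < ξ v} := by
      rw [heq, closure_union, Set.union_inter_distrib_right]
      refine Set.union_eq_left.2 ?_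
      rintro w ⟨hw, hw'⟩
      exfalso
      have h2 : closure (-K) ⊆ {v | ξ v ≤ 0} := closure_minimal (fun v hv => by
        have h3 := (Set.mem_neg.1 hv).2
        rw [Set.mem_ofPred_eq, map_neg] at h3
        rw [Set.mem_ofPred_eq]; linarith) (isClosed_le hξc continuous_const)
      have h4 : ξ w ≤ 0 := h2 hw
      exact absurd hw' (not_lt.2 h4)
    have h2 : v ∈ closure (coneOver Ω) ↔ v ∈ closure K := by
      have := Set.ext_iff.1 h1 v
      exact ⟨fun h => (this.1 ⟨h, hξv⟩).1, fun h => (this.2 ⟨h, hξv⟩).1⟩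
    have h3 : v ∈ interior (closure (coneOver Ω)) ↔ v ∈ interior (closure K) := by
      have := congrArg interior h1
      rw [interior_inter, interior_inter, hopos.interior_eq] at this
      have := Set.ext_iff.1 this v
      exact ⟨fun h => (this.1 ⟨h, hξv⟩).1, fun h => (this.2 ⟨h, hξv⟩).1⟩
    rw [h2, h3]
    rcases K.eq_empty_or_nonempty with hKe | hKne
    · simp [hKe]
    -- An open convex set is the interior of its closure.
    · rw [hconvK.interior_closure_eq_interior_of_nonempty_interior (by rwa [hKopen.interior_eq]),
        hKopen.interior_eq]
  · intro v hv hmem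
    exact hne_cl v ((mk_mem_bdry_iff hv).1 hmem).1 hv

namespace IsConeOver

variable {Ω : Set (RP n)} {K : Set (Fin (n + 1) → ℝ)} {ξ : (Fin (n + 1) → ℝ) →ₗ[ℝ] ℝ}

theorem zero_mem_closure (h : IsConeOver Ω K ξ) (hne : K.Nonempty) :
    (0 : Fin (n + 1) → ℝ) ∈ closure K := by
  obtain ⟨x, hx⟩ := hne
  have h1 : Filter.Tendsto (fun j : ℕ => (1 / ((j : ℝ) + 1)) • x) Filter.atTop (𝓝 ((0 : ℝ) • x)) :=
    tendsto_one_div_add_atTop_nhds_zero_nat.smul_const x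
  rw [zero_smul] at h1
  exact mem_closure_of_tendsto h1 (Filter.Eventually.of_forall fun j =>
    h.smul_mem _ (by positivity) x hx)

theorem smul_mem_closure (h : IsConeOver Ω K ξ) {c : ℝ} (hc : 0 < c) {x : Fin (n + 1) → ℝ}
    (hx : x ∈ closure K) : c • x ∈ closure K :=
  map_mem_closure (continuous_const_smul c) hx fun y hy => h.smul_mem c hc y hy

theorem add_mem_closure (h : IsConeOver Ω K ξ) {x y : Fin (n + 1) → ℝ}
    (hx : x ∈ closure K) (hy : y ∈ closure K) : x + y ∈ closure K := by
  have h1 := h.convex.closure hx hy (by norm_num : (0 : ℝ) ≤ 1 / 2) (by norm_num : (0 : ℝ) ≤ 1 / 2)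
    (by norm_num)
  convert h.smul_mem_closure zero_lt_two h1 using 1
  module

theorem add_mem (h : IsConeOver Ω K ξ) {x y : Fin (n + 1) → ℝ}
    (hx : x ∈ K) (hy : y ∈ closure K) : x + y ∈ K := by
  have h1 := h.convex.combo_interior_closure_mem_interior (x := x) (y := y)
    (by rwa [h.isOpen.interior_eq]) hy (by norm_num : (0 : ℝ) < 1 / 2)
    (by norm_num : (0 : ℝ) ≤ 1 / 2) (by norm_num)
  rw [h.isOpen.interior_eq] at h1
  convert h.smul_mem 2 zero_lt_two _ h1 using 1
  module

theorem zero_notMem (h : IsConeOver Ω K ξ) : (0 : Fin (n + 1) → ℝ) ∉ K := fun h0 => by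
  simpa using h.pos_of_mem 0 h0

/-- By compactness `ξ` has a positive minimum on the unit vectors of the closed cone; `c` is its
inverse. -/
theorem isSharpCone (h : IsConeOver Ω K ξ) (hne : K.Nonempty) :
    ∃ c : ℝ, IsSharpCone (closure K) (c • ξ) := by
  have hcomp : IsCompact (closure K ∩ Metric.sphere 0 1) :=
    (isCompact_sphere (0 : Fin (n + 1) → ℝ) 1).inter_left isClosed_closure
  have hξc : Continuous ξ := LinearMap.continuous_of_finiteDimensional ξ
  obtain ⟨x, hx⟩ := hne
  have hx0 : x ≠ 0 := fun h0 => h.zero_notMem (h0 ▸ hx)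
  have hnorm : ∀ y ∈ closure K, y ≠ 0 → ‖y‖⁻¹ • y ∈ closure K ∩ Metric.sphere 0 1 := by
    intro y hy hy0
    refine ⟨h.smul_mem_closure (inv_pos.2 (norm_pos_iff.2 hy0)) hy, ?_⟩
    rw [mem_sphere_zero_iff_norm, norm_smul, norm_inv, norm_norm,
      inv_mul_cancel₀ (norm_ne_zero_iff.2 hy0)]
  obtain ⟨m, hm, hmin⟩ := hcomp.exists_isMinOn ⟨_, hnorm x (subset_closure hx) hx0⟩
    hξc.continuousOn
  have hm0 : m ≠ 0 := by
    rintro rfl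
    simpa using hm.2
  have hξm := h.pos m hm.1 hm0
  refine ⟨(ξ m)⁻¹, isClosed_closure, fun x hx y hy => h.add_mem_closure hx hy, ?_, ?_⟩
  · intro c hc y hy
    rcases hc.eq_or_lt with rfl | hc
    · rw [zero_smul]; exact h.zero_mem_closure ⟨x, hx⟩
    · exact h.smul_mem_closure hc hy
  · intro y hy
    by_cases hy0 : y = 0
    · rw [hy0]; simp
    · have h1 : ξ m ≤ ξ (‖y‖⁻¹ • y) := hmin (hnorm y hy hy0)
      rw [map_smul, smul_eq_mul] at h1
      rw [LinearMap.smul_apply, smul_eq_mul]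
      have h2 := norm_pos_iff.2 hy0
      rw [inv_mul_eq_div, le_div_iff₀ h2] at h1
      rw [inv_mul_eq_div, le_div_iff₀ hξm]
      linarith

/-- Strict convexity of the cone. -/
theorem add_mem_of_linearIndependent (h : IsConeOver Ω K ξ) (hΩ : IsStrictlyConvex Ω)
    {a b : Fin (n + 1) → ℝ} (ha : a ∈ closure K) (hb : b ∈ closure K)
    (hab : LinearIndependent ℝ ![a, b]) : a + b ∈ K := by
  by_contra hnot
  -- If some `p a + q b` were in `K`, adding `(1 - p) a + (1 - q) b` from the closed cone would put
  -- `a + b` in `K`.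
  have hsub : projSegment a b ⊆ bdry Ω := by
    rintro _ ⟨v, hv, ⟨p, q, hp, hq, hpq, rfl⟩, rfl⟩
    have hcl : p • a + q • b ∈ closure K := h.convex.closure ha hb hp hq hpq
    rw [h.mem_bdry_iff _ hv (h.pos _ hcl hv)]
    refine ⟨hcl, fun hK => hnot ?_⟩
    have hne : K.Nonempty := ⟨_, hK⟩
    obtain ⟨c, hs⟩ := h.isSharpCone hne
    have h1 := hs.add_mem _ (hs.smul_mem (1 - p) (by linarith) a ha) _
      (hs.smul_mem (1 - q) (by linarith) b hb)
    convert h.add_mem hK h1 using 1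
    module
  have ha0 : a ≠ 0 := hab.ne_zero 0
  have hmem : Projectivization.mk ℝ a ha0 ∈ projSegment a b := ⟨a, ha0, left_mem_segment ℝ a b, rfl⟩
  exact (hΩ.2 _ (hsub hmem)).2 a b hab hsub hmem

theorem connectedComponentIn_eq (h : IsConeOver Ω K ξ) {v : Fin (n + 1) → ℝ} (hv : v ∈ K) :
    connectedComponentIn (coneOver Ω) v = K := by
  have hvΩ : v ∈ coneOver Ω := by rw [h.coneOver_eq]; exact Or.inl hv
  have hξc : Continuous ξ := LinearMap.continuous_of_finiteDimensional ξ
  apply Set.Subset.antisymm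
  · have h1 : connectedComponentIn (coneOver Ω) v ⊆ {x | 0 < ξ x} := by
      refine isPreconnected_connectedComponentIn.subset_left_of_subset_union
        (v := {x | ξ x < 0}) (isOpen_lt continuous_const hξc) (isOpen_lt hξc continuous_const) ?_ ?_
        ⟨v, mem_connectedComponentIn hvΩ, h.pos_of_mem v hv⟩
      · rw [Set.disjoint_left]
        intro x hx hx'
        exact lt_asymm (show 0 < ξ x from hx) hx'
      · intro x hx
        have h2 := connectedComponentIn_subset _ _ hx
        rw [h.coneOver_eq] at h2
        rcases h2 with h2 | h2
        · exact Or.inl (h.pos_of_mem x h2)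
        · have h3 := h.pos_of_mem _ h2
          rw [map_neg] at h3
          right
          rw [Set.mem_ofPred_eq]; linarith
    intro x hx
    have h2 := connectedComponentIn_subset _ _ hx
    rw [h.coneOver_eq] at h2
    rcases h2 with h2 | h2
    · exact h2
    · have h3 := h.pos_of_mem _ h2
      rw [map_neg] at h3
      have h4 : 0 < ξ x := h1 hx
      linarith
  · exact h.convex.isPreconnected.subset_connectedComponentIn hv
      (by rw [h.coneOver_eq]; exact Set.subset_union_left)

/-- The cone over `Ω` has an opposite description, with `K` replaced by `-K`. -/
theorem connectedComponentIn_neg_eq (h : IsConeOver Ω K ξ) {v : Fin (n + 1) → ℝ} (hv : v ∈ -K) :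
    connectedComponentIn (coneOver Ω) v = -K := by
  have h1 := h.connectedComponentIn_eq (Set.mem_neg.1 hv)
  have hsymm : (Homeomorph.neg (Fin (n + 1) → ℝ)) '' coneOver Ω = coneOver Ω := by
    rw [h.coneOver_eq, Homeomorph.coe_neg, Set.image_neg_eq_neg, Set.union_neg, neg_neg,
      Set.union_comm]
  have hmem : -v ∈ coneOver Ω := by rw [h.coneOver_eq]; exact Or.inl hv
  have h2 := (Homeomorph.neg (Fin (n + 1) → ℝ)).image_connectedComponentIn hmem
  rw [hsymm, h1, Homeomorph.coe_neg, Set.image_neg_eq_neg, neg_neg] at h2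
  exact h2.symm

theorem smul_eq_of_mem_SLdom (h : IsConeOver Ω K ξ) (hne : K.Nonempty)
    {g : GL (Fin (n + 1)) ℝ} (hg : g ∈ SLdom Ω) : g • K = K := by
  obtain ⟨v, hv⟩ := hne
  have h1 := (Subgroup.mem_inf.1 hg).2
  simp only [Subgroup.mem_iInf] at h1
  have h2 := h1 v (by rw [h.coneOver_eq]; exact Or.inl hv)
  rwa [h.connectedComponentIn_eq hv, MulAction.mem_stabilizer_iff] at h2

theorem mem_SLdom (h : IsConeOver Ω K ξ) {g : GL (Fin (n + 1)) ℝ} (hg : g ∈ SLpm n)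
    (hK : g • K = K) : g ∈ SLdom Ω := by
  refine Subgroup.mem_inf.2 ⟨hg, ?_⟩
  simp only [Subgroup.mem_iInf]
  intro v hv
  rw [h.coneOver_eq] at hv
  rw [MulAction.mem_stabilizer_iff]
  rcases hv with hv | hv
  · rw [h.connectedComponentIn_eq hv, hK]
  · rw [h.connectedComponentIn_neg_eq hv, Set.smul_set_neg, hK]

end IsConeOver

end Dictionary

end ConvexProjective


namespace ConvexProjective

open Module Topology

/-! ### Growth of automorphisms of the cone with one boundary fixed point -/

section Parabolic

variable {n : ℕ}

/-- The linear action of `GL` on column vectors. -/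
noncomputable def actEnd (n : ℕ) : GL (Fin (n + 1)) ℝ →* End ℝ (Fin (n + 1) → ℝ) :=
  DistribMulAction.toModuleEnd ℝ (Fin (n + 1) → ℝ)

@[simp]
theorem actEnd_apply (g : GL (Fin (n + 1)) ℝ) (v : Fin (n + 1) → ℝ) : actEnd n g v = g • v := rfl

theorem actEnd_eq_toLin' (g : GL (Fin (n + 1)) ℝ) :
    actEnd n g = Matrix.toLin' (g : Matrix (Fin (n + 1)) (Fin (n + 1)) ℝ) := rfl

theorem actEnd_injective : Function.Injective (actEnd n) := by
  intro g g' h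
  rw [actEnd_eq_toLin', actEnd_eq_toLin'] at h
  exact Units.ext (Matrix.toLin'.injective h)

theorem mem_SLpm_iff {g : GL (Fin (n + 1)) ℝ} :
    g ∈ SLpm n ↔ |(g : Matrix (Fin (n + 1)) (Fin (n + 1)) ℝ).det| = 1 := by
  have h1 : g ∈ SLpm n ↔ Matrix.GeneralLinearGroup.det g ∈ Subgroup.zpowers (-1 : ℝˣ) := Iff.rfl
  rw [h1, Subgroup.mem_zpowers_iff, ← Matrix.GeneralLinearGroup.val_det_apply]
  constructor
  · rintro ⟨k, hk⟩
    rw [← hk]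
    rcases Int.even_or_odd k with hk | hk
    · rw [hk.neg_one_zpow]; simp
    · rw [hk.neg_one_zpow]; simp
  · intro h
    rcases eq_or_eq_neg_of_abs_eq h with h | h
    · exact ⟨0, by rw [zpow_zero]; exact Units.ext h.symm⟩
    · exact ⟨1, by rw [zpow_one]; exact Units.ext (by rw [h]; simp)⟩

theorem abs_det_actEnd {g : GL (Fin (n + 1)) ℝ} (hg : g ∈ SLpm n) :
    |LinearMap.det (actEnd n g)| = 1 := by
  rw [actEnd_eq_toLin', LinearMap.det_toLin']
  exact mem_SLpm_iff.1 hg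

namespace IsConeOver

variable {Ω : Set (RP n)} {K : Set (Fin (n + 1) → ℝ)} {ξ : (Fin (n + 1) → ℝ) →ₗ[ℝ] ℝ}

theorem exists_add_smul_mem (h : IsConeOver Ω K ξ) {x : Fin (n + 1) → ℝ} (hx : x ∈ K)
    (v : Fin (n + 1) → ℝ) : ∃ t : ℝ, 0 < t ∧ x + t • v ∈ K := by
  have hc : Filter.Tendsto (fun t : ℝ => x + t • v) (𝓝[>] 0) (𝓝 x) := by
    have : Filter.Tendsto (fun t : ℝ => x + t • v) (𝓝 0) (𝓝 (x + (0 : ℝ) • v)) := by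
      apply Continuous.tendsto; fun_prop
    rw [zero_smul, add_zero] at this
    exact this.mono_left nhdsWithin_le_nhds
  have h1 := (hc.eventually (h.isOpen.mem_nhds hx)).and self_mem_nhdsWithin
  obtain ⟨t, ht, ht0⟩ := h1.exists
  exact ⟨t, ht0, ht⟩

theorem span_closure_eq_top (h : IsConeOver Ω K ξ) (hne : K.Nonempty) :
    Submodule.span ℝ (closure K) = ⊤ := by
  rw [eq_top_iff]
  rintro v -
  obtain ⟨x, hx⟩ := hne
  obtain ⟨t, ht, hxt⟩ := h.exists_add_smul_mem hx v
  have h1 : v = t⁻¹ • ((x + t • v) - x) := by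
    rw [add_sub_cancel_left, smul_smul, inv_mul_cancel₀ ht.ne', one_smul]
  rw [h1]
  exact Submodule.smul_mem _ _ (Submodule.sub_mem _
    (Submodule.subset_span (subset_closure hxt)) (Submodule.subset_span (subset_closure hx)))

/-- If `A` preserves the cone and `e` is the only fixed boundary direction then the eigenvalue of
`e` bounds the growth of all orbits. -/
theorem growth_of_unique_fixed (h : IsConeOver Ω K ξ) (hne : K.Nonempty)
    {A : End ℝ (Fin (n + 1) → ℝ)} (hinj : Function.Injective A)
    (hA : ∀ x, A x ∈ closure K ↔ x ∈ closure K) {e : Fin (n + 1) → ℝ} (he : e ∈ closure K)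
    (he0 : e ≠ 0) {r₀ : ℝ} (hr₀ : 0 < r₀) (hAe : A e = r₀ • e)
    (hfix : ∀ v ∈ closure K, v ∉ K → v ≠ 0 → ∀ r : ℝ, A v = r • v → ∃ c : ℝ, v = c • e) :
    ∀ v, ∀ s, r₀ < s → ∃ C : ℝ, ∀ k : ℕ, ‖(A ^ k) v‖ ≤ C * s ^ k := by
  obtain ⟨c, hs⟩ := h.isSharpCone hne
  obtain ⟨r, hr, ⟨y, hy, hy0, hAy⟩, hgrow⟩ := hs.exists_eigenvector ⟨e, he, he0⟩ hinj
    (fun x hx => (hA x).2 hx)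
  rw [h.span_closure_eq_top hne] at hgrow
  have hrr₀ : r = r₀ := by
    -- If the eigenvector `y` is interior, `y - s e` leaves the closed cone for large `s`. Applying
    -- `A` multiplies `s` by `r₀ / r`, so if `r ≠ r₀`, iterating `A` or its inverse would keep `y -
    -- s e` in the cone for arbitrarily large `s`.
    by_cases hyK : y ∈ K
    · have hξe := h.pos e he he0
      obtain ⟨t, ht, hty⟩ := h.exists_add_smul_mem hyK (-e)
      have hstep : ∀ s : ℝ, y + s • -e ∈ closure K ↔ y + (s * (r₀ / r)) • -e ∈ closure K := by
        intro s
        rw [← hA]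
        have h1 : A (y + s • -e) = r • (y + (s * (r₀ / r)) • -e) := by
          rw [map_add, map_smul, map_neg, hAy, hAe, smul_add, smul_smul]
          have : r * (s * (r₀ / r)) = s * r₀ := by field_simp
          rw [this]; module
        rw [h1]
        constructor
        · intro h2
          have h3 := h.smul_mem_closure (inv_pos.2 hr) h2
          rwa [smul_smul, inv_mul_cancel₀ hr.ne', one_smul] at h3
        · exact fun h2 => h.smul_mem_closure hr h2
      have hbd : ∀ s : ℝ, y + s • -e ∈ closure K → s * ξ e ≤ ξ y := by
        intro s hs'
        by_cases h0 : y + s • -e = 0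
        · have := congrArg ξ h0
          simp only [map_add, map_smul, map_neg, smul_eq_mul, map_zero] at this
          linarith
        · have := h.pos _ hs' h0
          simp only [map_add, map_smul, map_neg, smul_eq_mul] at this
          linarith
      have hnot : ∀ q : ℝ, 1 < q → ¬ ∀ k : ℕ, y + (t * q ^ k) • -e ∈ closure K := by
        intro q hq hall
        obtain ⟨k, hk⟩ := pow_unbounded_of_one_lt (ξ y / (t * ξ e)) hq
        rw [div_lt_iff₀ (by positivity)] at hk
        have := hbd _ (hall k)
        nlinarith
      rcases lt_trichotomy r r₀ with hlt | heq | hgt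
      · exfalso
        refine hnot (r₀ / r) ((one_lt_div hr).2 hlt) fun k => ?_
        induction k with
        | zero => simpa using subset_closure hty
        | succ k ih =>
          rw [hstep] at ih
          rwa [pow_succ, ← mul_assoc]
      · exact heq
      · exfalso
        refine hnot (r / r₀) ((one_lt_div hr₀).2 hgt) fun k => ?_
        induction k with
        | zero => simpa using subset_closure hty
        | succ k ih =>
          rw [hstep]
          have : t * (r / r₀) ^ (k + 1) * (r₀ / r) = t * (r / r₀) ^ k := by
            rw [pow_succ]; field_simp
          rwa [this]
    · obtain ⟨d, rfl⟩ := hfix y hy hyK hy0 r hAy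
      have h1 : (r - r₀) • (d • e) = 0 := by
        rw [sub_smul, ← hAy, map_smul, hAe, smul_comm, sub_self]
      have h2 := (smul_eq_zero.1 h1).resolve_right hy0
      linarith
  rw [hrr₀] at hgrow
  exact fun v s hs => hgrow v trivial s hs

end IsConeOver

theorem slowGrowth_one {E : Type*} [NormedAddCommGroup E] [NormedSpace ℝ E] :
    SlowGrowth (1 : End ℝ E) := by
  intro v s hs
  refine ⟨‖v‖, fun k => ?_⟩
  rw [one_pow, Module.End.one_apply]
  exact le_mul_of_one_le_right (norm_nonneg v) (one_le_pow₀ hs.le)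

theorem slowGrowth_inv_smul {E : Type*} [NormedAddCommGroup E] [NormedSpace ℝ E] {A : End ℝ E}
    {r : ℝ} (hr : 0 < r)
    (h : ∀ v, ∀ s, r < s → ∃ C : ℝ, ∀ k : ℕ, ‖(A ^ k) v‖ ≤ C * s ^ k) :
    SlowGrowth (r⁻¹ • A) := by
  intro v s hs
  obtain ⟨C, hC⟩ := h v (r * s) (by nlinarith)
  refine ⟨C, fun k => ?_⟩
  rw [smul_pow, LinearMap.smul_apply, norm_smul, Real.norm_of_nonneg (by positivity), inv_pow,
    inv_mul_le_iff₀ (by positivity)]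
  calc _ ≤ _ := hC k
    _ = _ := by rw [mul_pow]; ring

/-- The determinant of `r⁻¹ A` is `± r⁻⁽ⁿ⁺¹⁾`, and slow growth bounds it by `1`. -/
theorem one_le_of_slowGrowth_inv_smul {A : End ℝ (Fin (n + 1) → ℝ)} {r : ℝ} (hr : 0 < r)
    (hdet : |LinearMap.det A| = 1) (h : SlowGrowth (r⁻¹ • A)) : 1 ≤ r := by
  have h1 := h.abs_det_le
  rw [LinearMap.det_smul, abs_mul, hdet, mul_one, abs_of_pos (by positivity), inv_pow,
    inv_le_one₀ (by positivity)] at h1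
  by_contra! hlt
  have hfr : finrank ℝ (Fin (n + 1) → ℝ) = n + 1 := by simp
  rw [hfr] at h1
  have : r ^ (n + 1) < 1 := pow_lt_one₀ hr.le hlt (Nat.succ_ne_zero n)
  linarith

end Parabolic

end ConvexProjective


namespace ConvexProjective

open Module Topology

/-! ### The invariant supporting hyperplane -/

section InvariantFunctional

variable {n : ℕ} {Ω : Set (RP n)} {K : Set (Fin (n + 1) → ℝ)} {ξ : (Fin (n + 1) → ℝ) →ₗ[ℝ] ℝ}

theorem smul_vec_ne_zero (g : GL (Fin (n + 1)) ℝ) {v : Fin (n + 1) → ℝ} (hv : v ≠ 0) :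
    g • v ≠ 0 := fun h => hv (by rw [← inv_smul_smul g v, h, smul_zero])

theorem exists_smul_eq_of_smul_mk_eq {g : GL (Fin (n + 1)) ℝ} {v w : Fin (n + 1) → ℝ} {hv : v ≠ 0}
    {hw : w ≠ 0} (h : g • Projectivization.mk ℝ v hv = Projectivization.mk ℝ w hw) :
    ∃ c : ℝ, c ≠ 0 ∧ g • v = c • w := by
  rw [Projectivization.smul_mk, Projectivization.mk_eq_mk_iff'] at h
  obtain ⟨c, hc⟩ := h
  exact ⟨c, fun h0 => smul_vec_ne_zero g hv (by rw [← hc, h0, zero_smul]), hc.symm⟩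

theorem smul_mk_eq_of_smul_eq {g : GL (Fin (n + 1)) ℝ} {v w : Fin (n + 1) → ℝ} {hv : v ≠ 0}
    {hw : w ≠ 0} {c : ℝ} (h : g • v = c • w) :
    g • Projectivization.mk ℝ v hv = Projectivization.mk ℝ w hw := by
  rw [Projectivization.smul_mk, Projectivization.mk_eq_mk_iff']
  exact ⟨c, h.symm⟩

namespace IsConeOver

theorem exists_boundary_vector (h : IsConeOver Ω K ξ) {p : RP n} (hp : p ∈ bdry Ω) :
    ∃ (e : Fin (n + 1) → ℝ) (he : e ≠ 0), p = Projectivization.mk ℝ e he ∧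
      e ∈ closure K ∧ e ∉ K := by
  induction p using Projectivization.ind with
  | h v hv =>
    rcases lt_or_gt_of_ne (h.ne_zero_of_mem_bdry v hv hp) with hneg | hpos
    · have h1 : Projectivization.mk ℝ v hv = Projectivization.mk ℝ (-v) (neg_ne_zero.2 hv) := by
        rw [Projectivization.mk_eq_mk_iff']
        exact ⟨-1, by simp⟩
      refine ⟨-v, neg_ne_zero.2 hv, h1, ?_⟩
      rw [h1, h.mem_bdry_iff _ _ (by rw [map_neg]; linarith)] at hp
      exact hp
    · exact ⟨v, hv, rfl, (h.mem_bdry_iff v hv hpos).1 hp⟩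

theorem mk_mem_bdry (h : IsConeOver Ω K ξ) {v : Fin (n + 1) → ℝ} (hv : v ≠ 0)
    (h1 : v ∈ closure K) (h2 : v ∉ K) : Projectivization.mk ℝ v hv ∈ bdry Ω :=
  (h.mem_bdry_iff v hv (h.pos v h1 hv)).2 ⟨h1, h2⟩

theorem nonempty_of_mem_bdry (h : IsConeOver Ω K ξ) {p : RP n} (hp : p ∈ bdry Ω) :
    K.Nonempty := by
  obtain ⟨e, -, -, he, -⟩ := h.exists_boundary_vector hp
  exact closure_nonempty_iff.1 ⟨e, he⟩

theorem smul_mem_iff_of_mem_SLdom (h : IsConeOver Ω K ξ) (hne : K.Nonempty)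
    {g : GL (Fin (n + 1)) ℝ} (hg : g ∈ SLdom Ω) (x : Fin (n + 1) → ℝ) : g • x ∈ K ↔ x ∈ K := by
  conv_lhs => rw [← h.smul_eq_of_mem_SLdom hne hg]
  exact Set.smul_mem_smul_set_iff

theorem continuous_smul_vec (g : GL (Fin (n + 1)) ℝ) :
    Continuous fun v : Fin (n + 1) → ℝ => g • v :=
  LinearMap.continuous_of_finiteDimensional (actEnd n g)

theorem smul_mem_closure_iff_of_mem_SLdom (h : IsConeOver Ω K ξ) (hne : K.Nonempty)
    {g : GL (Fin (n + 1)) ℝ} (hg : g ∈ SLdom Ω) (x : Fin (n + 1) → ℝ) :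
    g • x ∈ closure K ↔ x ∈ closure K := by
  have key : ∀ g' ∈ SLdom Ω, ∀ x ∈ closure K, g' • x ∈ closure K := fun g' hg' x hx =>
    map_mem_closure (continuous_smul_vec g') hx fun y hy =>
      (h.smul_mem_iff_of_mem_SLdom hne hg' y).2 hy
  refine ⟨fun hx => ?_, key g hg x⟩
  have := key g⁻¹ (inv_mem hg) _ hx
  rwa [inv_smul_smul] at this

/-- In a simply transitive group of automorphisms of `∂Ω ∖ {p}` the line `p` is fixed pointwise and
all elements have slow growth. -/
theorem smul_eq_and_slowGrowth (h : IsConeOver Ω K ξ) {e : Fin (n + 1) → ℝ} (he0 : e ≠ 0)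
    (he : e ∈ closure K) {W : Subgroup (GL (Fin (n + 1)) ℝ)}
    (hW : W ≤ SLfix Ω (Projectivization.mk ℝ e he0))
    (hst : ActsSimplyTransitivelyOn W (bdry Ω \ {Projectivization.mk ℝ e he0}))
    {w : GL (Fin (n + 1)) ℝ} (hw : w ∈ W) : w • e = e ∧ SlowGrowth (actEnd n w) := by
  have hne : K.Nonempty := closure_nonempty_iff.1 ⟨e, he⟩
  have hdom : ∀ w ∈ W, w ∈ SLdom Ω := fun w hw => (Subgroup.mem_inf.1 (hW hw)).1
  have heig : ∀ w ∈ W, ∃ c : ℝ, 0 < c ∧ w • e = c • e := by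
    intro w hw
    obtain ⟨c, hc0, hc⟩ := exists_smul_eq_of_smul_mk_eq
      (MulAction.mem_stabilizer_iff.1 (Subgroup.mem_inf.1 (hW hw)).2)
    refine ⟨c, ?_, hc⟩
    have h1 := h.pos _ ((h.smul_mem_closure_iff_of_mem_SLdom hne (hdom w hw) e).2 he)
      (smul_vec_ne_zero w he0)
    rw [hc, map_smul, smul_eq_mul] at h1
    exact pos_of_mul_pos_left h1 (h.pos e he he0).le
  -- Uniqueness in simple transitivity: an element with a fixed boundary point other than `p` is the
  -- identity.
  have huniq : ∀ w ∈ W, w ≠ 1 → ∀ v ∈ closure K, v ∉ K → v ≠ 0 → ∀ r : ℝ,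
      actEnd n w v = r • v → ∃ c : ℝ, v = c • e := by
    intro w hw hw1 v hv hvK hv0 r hr
    by_contra hcon
    have hvb : Projectivization.mk ℝ v hv0 ∈ bdry Ω \ {Projectivization.mk ℝ e he0} := by
      refine ⟨h.mk_mem_bdry hv0 hv hvK, fun h1 => hcon ?_⟩
      obtain ⟨c, hc⟩ := (Projectivization.mk_eq_mk_iff' ℝ _ _ hv0 he0).1 h1
      exact ⟨c, hc.symm⟩
    obtain ⟨w₀, -, hu⟩ := hst _ hvb _ hvb
    exact hw1 ((hu w ⟨hw, smul_mk_eq_of_smul_eq hr⟩).trans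
      (hu 1 ⟨one_mem W, one_smul _ _⟩).symm)
  have key : ∀ w ∈ W, w ≠ 1 → ∀ c : ℝ, 0 < c → w • e = c • e →
      1 ≤ c ∧ SlowGrowth (c⁻¹ • actEnd n w) := by
    intro w hw hw1 c hc hwe
    have h1 := slowGrowth_inv_smul hc (h.growth_of_unique_fixed (A := actEnd n w) hne
      (MulAction.injective w) (fun x => h.smul_mem_closure_iff_of_mem_SLdom hne (hdom w hw) x)
      he he0 hc hwe (huniq w hw hw1))
    exact ⟨one_le_of_slowGrowth_inv_smul hc (abs_det_actEnd (Subgroup.mem_inf.1 (hdom w hw)).1) h1,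
      h1⟩
  by_cases hw1 : w = 1
  · subst hw1
    exact ⟨one_smul _ _, by rw [map_one]; exact slowGrowth_one⟩
  · obtain ⟨c, hc, hwe⟩ := heig w hw
    obtain ⟨h1, h2⟩ := key w hw hw1 c hc hwe
    have hinv : w⁻¹ • e = c⁻¹ • e := by
      rw [inv_smul_eq_iff, smul_comm, hwe, smul_smul, inv_mul_cancel₀ hc.ne', one_smul]
    -- The bound `1 ≤ c` applies to the inverse as well, so `c = 1`.
    obtain ⟨h3, -⟩ := key w⁻¹ (inv_mem hw) (by simpa using hw1) c⁻¹ (inv_pos.2 hc) hinv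
    have hc1 : c = 1 := le_antisymm ((one_le_inv₀ hc).1 h3) h1
    rw [hc1, inv_one, one_smul] at h2
    rw [hc1, one_smul] at hwe
    exact ⟨hwe, h2⟩

end IsConeOver

/-- The contragredient representation on the space of continuous functionals. -/
noncomputable def dualEnd (n : ℕ) :
    GL (Fin (n + 1)) ℝ →* End ℝ ((Fin (n + 1) → ℝ) →L[ℝ] ℝ) where
  toFun g :=
    { toFun := fun φ => φ.comp (LinearMap.toContinuousLinearMap (actEnd n g⁻¹))
      map_add' := fun _ _ => rfl
      map_smul' := fun _ _ => rfl }
  map_one' := by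
    ext φ v
    simp
  map_mul' g g' := by
    refine LinearMap.ext fun φ => ContinuousLinearMap.ext fun v => ?_
    change φ ((g * g')⁻¹ • v) = φ (g'⁻¹ • g⁻¹ • v)
    rw [mul_inv_rev, mul_smul]

theorem dualEnd_apply (g : GL (Fin (n + 1)) ℝ) (φ : (Fin (n + 1) → ℝ) →L[ℝ] ℝ)
    (v : Fin (n + 1) → ℝ) : dualEnd n g φ v = φ (g⁻¹ • v) := rfl

theorem slowGrowth_dualEnd {g : GL (Fin (n + 1)) ℝ} (hg : SlowGrowth (actEnd n g⁻¹)) :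
    SlowGrowth (dualEnd n g) := by
  intro φ s hs
  choose C hC using fun i : Fin (n + 1) => hg (Pi.single i 1) s hs
  refine ⟨‖φ‖ * ∑ i, C i, fun k => ?_⟩
  have hCk : ∀ i, 0 ≤ C i * s ^ k := fun i => (norm_nonneg _).trans (hC i k)
  refine ContinuousLinearMap.opNorm_le_bound _ ?_ fun v => ?_
  · rw [mul_assoc, Finset.sum_mul]
    exact mul_nonneg (norm_nonneg _) (Finset.sum_nonneg fun i _ => hCk i)
  · have h1 : ((dualEnd n g ^ k) φ) v = φ ((actEnd n g⁻¹ ^ k) v) := by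
      rw [← map_pow, ← map_pow, dualEnd_apply, actEnd_apply, inv_pow]
    have h2 : (actEnd n g⁻¹ ^ k) v = ∑ i, v i • (actEnd n g⁻¹ ^ k) (Pi.single i 1) := by
      conv_lhs => rw [← Finset.univ_sum_single v]
      rw [map_sum]
      refine Finset.sum_congr rfl fun i _ => ?_
      rw [← map_smul, ← Pi.single_smul, smul_eq_mul, mul_one]
    rw [h1, mul_assoc, mul_assoc]
    refine (φ.le_opNorm _).trans (mul_le_mul_of_nonneg_left ?_ (norm_nonneg _))
    rw [h2, Finset.sum_mul]
    refine (norm_sum_le _ _).trans (Finset.sum_le_sum fun i _ => ?_)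
    rw [norm_smul, mul_comm, ← mul_assoc]
    exact mul_le_mul (hC i k) (norm_le_pi_norm v i) (norm_nonneg _) (hCk i)

namespace IsConeOver

/-- The functionals that are nonnegative on an open cone form a sharp cone. -/
theorem isSharpCone_dual (h : IsConeOver Ω K ξ) (hne : K.Nonempty) (e : Fin (n + 1) → ℝ) :
    ∃ ω : ((Fin (n + 1) → ℝ) →L[ℝ] ℝ) →ₗ[ℝ] ℝ,
      IsSharpCone {φ : (Fin (n + 1) → ℝ) →L[ℝ] ℝ | (∀ x ∈ K, 0 ≤ φ x) ∧ φ e = 0} ω := by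
  obtain ⟨x, hx⟩ := hne
  obtain ⟨δ, hδ, hball⟩ := Metric.isOpen_iff.1 h.isOpen x hx
  -- With the `δ`-ball around `x` inside `K`, the point `x - (δ / (2‖v‖)) v` is in `K`, so `φ v ≤ (2
  -- / δ) φ x ‖v‖`.
  refine ⟨(2 / δ) • (ContinuousLinearMap.apply ℝ ℝ x).toLinearMap, ?_, ?_, ?_, ?_⟩
  · have h1 : {φ : (Fin (n + 1) → ℝ) →L[ℝ] ℝ | (∀ x ∈ K, 0 ≤ φ x) ∧ φ e = 0} =
        (⋂ x ∈ K, {φ | 0 ≤ φ x}) ∩ {φ | φ e = 0} := by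
      ext φ
      simp
    rw [h1]
    refine IsClosed.inter (isClosed_biInter fun y _ => ?_) ?_
    · exact isClosed_le continuous_const (ContinuousLinearMap.apply ℝ ℝ y).continuous
    · exact isClosed_eq (ContinuousLinearMap.apply ℝ ℝ e).continuous continuous_const
  · rintro φ ⟨h1, h2⟩ ψ ⟨h3, h4⟩
    exact ⟨fun y hy => add_nonneg (h1 y hy) (h3 y hy), by
      rw [_root_.add_apply, h2, h4, add_zero]⟩
  · rintro c hc φ ⟨h1, h2⟩
    exact ⟨fun y hy => mul_nonneg hc (h1 y hy), by
      rw [_root_.smul_apply, h2, smul_zero]⟩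
  · rintro φ ⟨h1, -⟩
    have hx0 : 0 ≤ φ x := h1 x hx
    change ‖φ‖ ≤ (2 / δ) * φ x
    have h2 : ∀ v : Fin (n + 1) → ℝ, φ v ≤ (2 / δ) * φ x * ‖v‖ := by
      intro v
      rcases eq_or_ne v 0 with rfl | hv
      · simp
      · have hv' : 0 < ‖v‖ := norm_pos_iff.2 hv
        have h3 := h1 (x - (δ / (2 * ‖v‖)) • v) (hball (by
          rw [mem_ball_iff_norm, sub_sub_cancel_left, norm_neg, norm_smul,
            Real.norm_of_nonneg (by positivity)]
          field_simp
          linarith))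
        rw [map_sub, map_smul, smul_eq_mul, sub_nonneg] at h3
        have h4 : φ v = (2 * ‖v‖ / δ) * (δ / (2 * ‖v‖) * φ v) := by field_simp
        rw [h4]
        calc _ ≤ (2 * ‖v‖ / δ) * φ x := mul_le_mul_of_nonneg_left h3 (by positivity)
          _ = _ := by ring
    refine ContinuousLinearMap.opNorm_le_bound _ (by positivity) fun v => ?_
    rw [Real.norm_eq_abs, abs_le]
    have h3 := h2 (-v)
    rw [map_neg, norm_neg] at h3
    exact ⟨by linarith, h2 v⟩

/-- The functionals that support `K` at `e` form a nonzero sharp cone in the dual space, preserved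
by `W`, and a nilpotent group of slow growth fixes one of its nonzero elements. By strict convexity
its kernel touches the closed cone only along `e`. -/
theorem exists_invariant_functional (h : IsConeOver Ω K ξ) (hΩ : IsStrictlyConvex Ω)
    {e : Fin (n + 1) → ℝ} (he0 : e ≠ 0) (he : e ∈ closure K) (heK : e ∉ K)
    {W : Subgroup (GL (Fin (n + 1)) ℝ)} [Group.IsNilpotent W]
    (hW : W ≤ SLfix Ω (Projectivization.mk ℝ e he0))
    (hst : ActsSimplyTransitivelyOn W (bdry Ω \ {Projectivization.mk ℝ e he0})) :
    ∃ ζ : (Fin (n + 1) → ℝ) →ₗ[ℝ] ℝ, ζ e = 0 ∧ (∀ x ∈ K, 0 < ζ x) ∧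
      (∀ x ∈ closure K, x ∉ K → x ≠ 0 → ζ x ≤ 0 → ∃ c : ℝ, x = c • e) ∧
      ∀ w ∈ W, ∀ v, ζ (w • v) = ζ v := by
  have hne : K.Nonempty := closure_nonempty_iff.1 ⟨e, he⟩
  have hdom : ∀ w ∈ W, w ∈ SLdom Ω := fun w hw => (Subgroup.mem_inf.1 (hW hw)).1
  obtain ⟨ω, hω⟩ := h.isSharpCone_dual hne e
  have hnonzero : ∃ φ ∈ {φ : (Fin (n + 1) → ℝ) →L[ℝ] ℝ | (∀ x ∈ K, 0 ≤ φ x) ∧ φ e = 0},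
      φ ≠ 0 := by
    -- Scaling inside `K` turns the separation of `e` from `K` into `φ ≤ 0` on `K` and `φ e = 0`.
    obtain ⟨φ, hφ⟩ := geometric_hahn_banach_open_point h.convex h.isOpen heK
    have hneg : ∀ x ∈ K, φ x ≤ 0 := by
      intro x hx
      by_contra! hpos
      have h1 := hφ _ (h.smul_mem (max 1 (φ e / φ x)) (by positivity) x hx)
      rw [map_smul, smul_eq_mul] at h1
      have h2 : φ e / φ x * φ x ≤ max 1 (φ e / φ x) * φ x :=
        mul_le_mul_of_nonneg_right (le_max_right _ _) hpos.le
      rw [div_mul_cancel₀ _ hpos.ne'] at h2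
      linarith
    have hle : φ e ≤ 0 :=
      closure_minimal (s := K) (t := {x | φ x ≤ 0}) hneg
        (isClosed_le φ.continuous continuous_const) he
    have hge : 0 ≤ φ e := by
      have h1 := hφ _ hne.some_mem
      by_contra! hlt
      obtain ⟨x, hx⟩ := hne
      have hx1 := hφ x hx
      have hxneg : φ x < 0 := hx1.trans hlt
      have h2 := hφ _ (h.smul_mem (φ e / φ x) (div_pos_of_neg_of_neg hlt hxneg) x hx)
      rw [map_smul, smul_eq_mul, div_mul_cancel₀ _ hxneg.ne] at h2
      exact lt_irrefl _ h2
    refine ⟨-φ, ⟨fun x hx => ?_, ?_⟩, ?_⟩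
    · rw [_root_.neg_apply]; linarith [hneg x hx]
    · rw [_root_.neg_apply]; linarith
    · intro h0
      obtain ⟨x, hx⟩ := hne
      have h1 := hφ x hx
      rw [neg_eq_zero.1 h0] at h1
      simp at h1
  obtain ⟨φ, ⟨hφK, hφe⟩, hφ0, hφinv⟩ := exists_fixed_of_nilpotent (G := W) _ _
    ((dualEnd n).comp W.subtype) _ ω rfl
    (fun w => slowGrowth_dualEnd (h.smul_eq_and_slowGrowth he0 he hW hst (inv_mem w.2)).2) hω
    (by
      rintro w φ ⟨h1, h2⟩
      refine ⟨fun x hx => ?_, ?_⟩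
      · exact h1 _ ((h.smul_mem_iff_of_mem_SLdom hne (hdom _ (inv_mem w.2)) x).2 hx)
      · change φ ((w : GL (Fin (n + 1)) ℝ)⁻¹ • e) = 0
        rw [(h.smul_eq_and_slowGrowth he0 he hW hst (inv_mem w.2)).1, h2])
    hnonzero
  have hpos : ∀ x ∈ K, 0 < φ x := by
    intro x hx
    refine (hφK x hx).lt_of_ne' fun h0 => hφ0 (ContinuousLinearMap.ext fun v => ?_)
    have key : ∀ v, 0 ≤ φ v := by
      intro v
      obtain ⟨t, ht, hxt⟩ := h.exists_add_smul_mem hx v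
      have h1 := hφK _ hxt
      rw [map_add, map_smul, h0, zero_add, smul_eq_mul] at h1
      exact nonneg_of_mul_nonneg_right h1 ht
    have h1 := key (-v)
    rw [map_neg] at h1
    change φ v = 0
    exact le_antisymm (by linarith) (key v)
  refine ⟨φ.toLinearMap, hφe, hpos, fun x hx hxK hx0 hle => ?_, fun w hw v => ?_⟩
  · by_contra hcon
    have hli : LinearIndependent ℝ ![x, e] := by
      rw [LinearIndependent.pair_iff' hx0]
      intro a ha
      refine hcon ⟨a⁻¹, ?_⟩
      have ha0 : a ≠ 0 := fun h0 => he0 (by rw [← ha, h0, zero_smul])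
      rw [← ha, smul_smul, inv_mul_cancel₀ ha0, one_smul]
    have h1 := hpos _ (h.add_mem_of_linearIndependent hΩ hx he hli)
    rw [map_add, hφe, add_zero] at h1
    exact absurd hle (not_le.2 h1)
  · have h1 := congrArg (fun ψ => ψ v) (hφinv ⟨w⁻¹, inv_mem hw⟩)
    change φ (w⁻¹⁻¹ • v) = φ v at h1
    rwa [inv_inv] at h1

/-- Projective transitivity lifts to the vectors with `ζ = 1`, since invariance of `ζ` forces the
scalar to be `1`. -/
theorem exists_smul_eq (h : IsConeOver Ω K ξ)
    {e : Fin (n + 1) → ℝ} (he0 : e ≠ 0)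
    {W : Subgroup (GL (Fin (n + 1)) ℝ)}
    (hst : ActsSimplyTransitivelyOn W (bdry Ω \ {Projectivization.mk ℝ e he0}))
    {ζ : (Fin (n + 1) → ℝ) →ₗ[ℝ] ℝ} (hζe : ζ e = 0) (hζ : ∀ w ∈ W, ∀ v, ζ (w • v) = ζ v)
    {x y : Fin (n + 1) → ℝ} (hx : x ∈ closure K) (hxK : x ∉ K) (hy : y ∈ closure K) (hyK : y ∉ K)
    (hx1 : ζ x = 1) (hy1 : ζ y = 1) :
    ∃ w ∈ W, w • x = y := by
  have hne0 : ∀ x, ζ x = 1 → x ≠ 0 := fun x hx h0 => by rw [h0, map_zero] at hx; simp at hx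
  have hmem : ∀ (x : Fin (n + 1) → ℝ) (hx1 : ζ x = 1), x ∈ closure K → x ∉ K →
      Projectivization.mk ℝ x (hne0 x hx1) ∈ bdry Ω \ {Projectivization.mk ℝ e he0} := by
    intro x hx1 hx hxK
    refine ⟨h.mk_mem_bdry _ hx hxK, fun h1 => ?_⟩
    obtain ⟨c, hc⟩ := (Projectivization.mk_eq_mk_iff' ℝ _ _ _ he0).1 h1
    rw [← hc, map_smul, hζe, smul_zero] at hx1
    exact zero_ne_one hx1
  obtain ⟨w, ⟨hw, hwx⟩, -⟩ := hst _ (hmem x hx1 hx hxK) _ (hmem y hy1 hy hyK)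
  obtain ⟨c, -, hc⟩ := exists_smul_eq_of_smul_mk_eq hwx
  have h1 := hζ w hw x
  rw [hc, map_smul, hx1, hy1, smul_eq_mul, mul_one] at h1
  exact ⟨w, hw, by rw [hc, h1, one_smul]⟩

end IsConeOver

end InvariantFunctional

end ConvexProjective


namespace ConvexProjective

open Module Topology

/-! ### The domain as the epigraph of a homogeneous convex function -/

section Frame

variable {n : ℕ} {Ω : Set (RP n)} {K : Set (Fin (n + 1) → ℝ)} {ξ : (Fin (n + 1) → ℝ) →ₗ[ℝ] ℝ}

/-- A group `W` of automorphisms of a strictly convex cone `K` that fixes a boundary vector `e` and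
a functional `ζ`, is transitive on the boundary of the slice `ζ = 1`, and a splitting of `ℝⁿ⁺¹` as
`(ker ζ ⊓ ker η) ⊕ ℝ x₀ ⊕ ℝ e`. -/
structure ParabolicFrame (Ω : Set (RP n)) (K : Set (Fin (n + 1) → ℝ))
    (ξ : (Fin (n + 1) → ℝ) →ₗ[ℝ] ℝ) (W : Subgroup (GL (Fin (n + 1)) ℝ))
    (e x₀ : Fin (n + 1) → ℝ) (ζ η : (Fin (n + 1) → ℝ) →ₗ[ℝ] ℝ) : Prop where
  cone : IsConeOver Ω K ξ
  strict : IsStrictlyConvex Ω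
  nonempty : K.Nonempty
  ne_zero : e ≠ 0
  mem : e ∈ closure K
  zeta_e : ζ e = 0
  zeta_base : ζ x₀ = 1
  eta_e : η e = 1
  eta_base : η x₀ = 0
  zeta_pos : ∀ x ∈ K, 0 < ζ x
  smul_e : ∀ w ∈ W, w • e = e
  slow : ∀ w ∈ W, SlowGrowth (actEnd n w)
  zeta_smul : ∀ w ∈ W, ∀ v, ζ (w • v) = ζ v
  smul_mem_iff : ∀ w ∈ W, ∀ x, w • x ∈ K ↔ x ∈ K
  transitive : ∀ x ∈ closure K, x ∉ K → ζ x = 1 → ∀ y ∈ closure K, y ∉ K → ζ y = 1 →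
    ∃ w ∈ W, w • x = y

/-- The middle summand of the splitting given by two functionals. -/
abbrev midSpace (ζ η : (Fin (n + 1) → ℝ) →ₗ[ℝ] ℝ) : Submodule ℝ (Fin (n + 1) → ℝ) :=
  LinearMap.ker ζ ⊓ LinearMap.ker η

namespace ParabolicFrame

variable {W : Subgroup (GL (Fin (n + 1)) ℝ)} {e x₀ : Fin (n + 1) → ℝ}
  {ζ η : (Fin (n + 1) → ℝ) →ₗ[ℝ] ℝ}

theorem zeta_mid (v : midSpace ζ η) : ζ v = 0 := LinearMap.mem_ker.1 v.2.1

theorem eta_mid (v : midSpace ζ η) : η v = 0 := LinearMap.mem_ker.1 v.2.2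

/-- The projection to the middle summand. -/
noncomputable def proj (P : ParabolicFrame Ω K ξ W e x₀ ζ η) :
    (Fin (n + 1) → ℝ) →ₗ[ℝ] midSpace ζ η :=
  LinearMap.codRestrict _
    (LinearMap.id - ζ.smulRight x₀ - η.smulRight e) fun v => by
      refine ⟨?_, ?_⟩ <;>
      simp [P.zeta_e, P.zeta_base, P.eta_e, P.eta_base]

theorem proj_coe (P : ParabolicFrame Ω K ξ W e x₀ ζ η) (v : Fin (n + 1) → ℝ) :
    (P.proj v : Fin (n + 1) → ℝ) = v - ζ v • x₀ - η v • e := rfl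

theorem proj_mid (P : ParabolicFrame Ω K ξ W e x₀ ζ η) (v : midSpace ζ η) :
    P.proj v = v := by
  apply Subtype.ext
  rw [P.proj_coe, zeta_mid, eta_mid]
  simp

theorem proj_e (P : ParabolicFrame Ω K ξ W e x₀ ζ η) : P.proj e = 0 := by
  apply Subtype.ext
  rw [P.proj_coe, P.zeta_e, P.eta_e]
  simp

theorem proj_base (P : ParabolicFrame Ω K ξ W e x₀ ζ η) : P.proj x₀ = 0 := by
  apply Subtype.ext
  rw [P.proj_coe, P.zeta_base, P.eta_base]
  simp

/-- The point of the slice `ζ = 1` with coordinates `v` and `t`. -/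
def pt (_ : ParabolicFrame Ω K ξ W e x₀ ζ η) (v : midSpace ζ η) (t : ℝ) : Fin (n + 1) → ℝ :=
  v + x₀ + t • e

variable (P : ParabolicFrame Ω K ξ W e x₀ ζ η)


theorem zeta_pt (v : midSpace ζ η) (t : ℝ) : ζ (P.pt v t) = 1 := by
  simp [pt, P.zeta_e, P.zeta_base, zeta_mid]

theorem proj_pt (v : midSpace ζ η) (t : ℝ) : P.proj (P.pt v t) = v := by
  rw [pt, map_add, map_add, map_smul, P.proj_e, P.proj_base, P.proj_mid]
  simp

theorem pt_proj {x : Fin (n + 1) → ℝ} (hx : ζ x = 1) : P.pt (P.proj x) (η x) = x := by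
  rw [pt, P.proj_coe, hx]
  module

theorem pt_add_smul (v : midSpace ζ η) (t c : ℝ) : P.pt v t + c • e = P.pt v (t + c) := by
  rw [pt, pt]; module

/-- The projection of the slice of the cone. -/
def base : Set (midSpace ζ η) := {v | ∃ t : ℝ, P.pt v t ∈ K}

/-- The function whose strict epigraph is the slice of the cone. -/
noncomputable def height (v : midSpace ζ η) : ℝ := sInf {t : ℝ | P.pt v t ∈ K}

theorem bddBelow (v : midSpace ζ η) : BddBelow {t : ℝ | P.pt v t ∈ K} := by
  have he := P.cone.pos e P.mem P.ne_zero
  refine ⟨-(ξ (v + x₀)) / ξ e, fun t ht => ?_⟩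
  have h1 := P.cone.pos_of_mem _ ht
  rw [pt, map_add, map_smul, smul_eq_mul] at h1
  rw [div_le_iff₀ he]
  linarith

theorem pt_mem_of_lt {v : midSpace ζ η} {s t : ℝ} (h : P.pt v s ∈ K) (hst : s < t) :
    P.pt v t ∈ K := by
  have h1 := P.cone.add_mem h (P.cone.smul_mem_closure (sub_pos.2 hst) P.mem)
  rwa [P.pt_add_smul, add_sub_cancel] at h1

theorem pt_mem_iff {v : midSpace ζ η} {t : ℝ} : P.pt v t ∈ K ↔ v ∈ P.base ∧ P.height v < t := by
  constructor
  · intro h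
    refine ⟨⟨t, h⟩, ?_⟩
    obtain ⟨s, hs, hs'⟩ := P.cone.exists_add_smul_mem h (-e)
    have h1 : P.pt v (t - s) ∈ K := by
      have h2 : P.pt v t + s • -e = P.pt v (t - s) := by rw [pt, pt]; module
      rwa [h2] at hs'
    exact (csInf_le (P.bddBelow v) h1).trans_lt (by linarith)
  · rintro ⟨hv, ht⟩
    obtain ⟨s, hs, hst⟩ := exists_lt_of_csInf_lt hv ht
    exact P.pt_mem_of_lt hs hst

theorem linearIndependent_e (P : ParabolicFrame Ω K ξ W e x₀ ζ η) {x : Fin (n + 1) → ℝ} (hx : ζ x = 1) :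
    LinearIndependent ℝ ![x, e] := by
  rw [LinearIndependent.pair_iff]
  intro a b hab
  have h1 := congrArg ζ hab
  rw [map_add, map_smul, map_smul, hx, P.zeta_e, map_zero, smul_zero, add_zero, smul_eq_mul,
    mul_one] at h1
  rw [h1, zero_smul, zero_add] at hab
  exact ⟨h1, (smul_eq_zero.1 hab).resolve_right P.ne_zero⟩

/-- By strict convexity every point strictly above a boundary point in the direction `e` is in `K`.
So the slice has no vertical walls, and its boundary is exactly the graph of the height. -/
theorem pt_mem_boundary_iff {v : midSpace ζ η} {t : ℝ} :
    (P.pt v t ∈ closure K ∧ P.pt v t ∉ K) ↔ v ∈ P.base ∧ t = P.height v := by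
  constructor
  · rintro ⟨h1, h2⟩
    have key : ∀ c : ℝ, 0 < c → v ∈ P.base ∧ P.height v < t + c := by
      intro c hc
      rw [← P.pt_mem_iff, ← P.pt_add_smul]
      refine P.cone.add_mem_of_linearIndependent P.strict h1 (P.cone.smul_mem_closure hc P.mem) ?_
      have h3 := P.linearIndependent_e (P.zeta_pt v t)
      rw [LinearIndependent.pair_iff] at h3 ⊢
      intro a b hab
      rw [smul_smul] at hab
      obtain ⟨h4, h5⟩ := h3 _ _ hab
      exact ⟨h4, (mul_eq_zero.1 h5).resolve_right hc.ne'⟩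
    have hv := (key 1 one_pos).1
    refine ⟨hv, le_antisymm ?_ (le_of_forall_pos_lt_add fun c hc => (key c hc).2)⟩
    by_contra! hlt
    exact h2 (P.pt_mem_iff.2 ⟨hv, hlt⟩)
  · rintro ⟨hv, rfl⟩
    refine ⟨?_, fun h => lt_irrefl _ (P.pt_mem_iff.1 h).2⟩
    have hc : Filter.Tendsto (fun c : ℝ => P.pt v c) (𝓝[>] P.height v) (𝓝 (P.pt v (P.height v))) := by
      refine Filter.Tendsto.mono_left (Continuous.tendsto ?_ _) nhdsWithin_le_nhds
      unfold pt
      fun_prop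
    refine mem_closure_of_tendsto hc ?_
    filter_upwards [self_mem_nhdsWithin] with c hc
    exact P.pt_mem_iff.2 ⟨hv, hc⟩

theorem isOpen_base : IsOpen P.base := by
  have h1 : P.base = ⋃ t : ℝ, (fun v : midSpace ζ η => P.pt v t) ⁻¹' K := by
    ext v; simp [base]
  rw [h1]
  refine isOpen_iUnion fun t => P.cone.isOpen.preimage ?_
  unfold pt
  fun_prop

theorem base_nonempty : P.base.Nonempty := by
  obtain ⟨x, hx⟩ := P.nonempty
  have hζ := P.zeta_pos x hx
  have h1 := P.cone.smul_mem (ζ x)⁻¹ (inv_pos.2 hζ) x hx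
  have h2 : ζ ((ζ x)⁻¹ • x) = 1 := by rw [map_smul, smul_eq_mul, inv_mul_cancel₀ hζ.ne']
  exact ⟨P.proj ((ζ x)⁻¹ • x), η ((ζ x)⁻¹ • x), by rwa [P.pt_proj h2]⟩

theorem combo_pt (u v : midSpace ζ η) (s t : ℝ) {a b : ℝ} (hab : a + b = 1) :
    a • P.pt u s + b • P.pt v t = P.pt (a • u + b • v) (a • s + b • t) := by
  simp only [pt, Submodule.coe_add, Submodule.coe_smul, smul_eq_mul]
  have hb : b = 1 - a := by linarith
  subst hb
  module

theorem strictConvexOn_height : StrictConvexOn ℝ P.base P.height := by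
  constructor
  · rintro u ⟨s, hs⟩ v ⟨t, ht⟩ a b ha hb hab
    exact ⟨a • s + b • t, by rw [← P.combo_pt u v s t hab]; exact P.cone.convex hs ht ha hb hab⟩
  · intro u hu v hv huv a b ha hb hab
    have h1 := P.pt_mem_boundary_iff.2 ⟨hu, rfl⟩
    have h2 := P.pt_mem_boundary_iff.2 ⟨hv, rfl⟩
    refine (P.pt_mem_iff.1 ?_).2
    rw [← P.combo_pt u v _ _ hab]
    refine P.cone.add_mem_of_linearIndependent P.strict (P.cone.smul_mem_closure ha h1.1)
      (P.cone.smul_mem_closure hb h2.1) ?_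
    rw [LinearIndependent.pair_iff]
    intro c d hcd
    have h3 := congrArg ζ hcd
    have h4 := congrArg P.proj hcd
    simp only [map_add, map_smul, P.zeta_pt, P.proj_pt, map_zero, smul_eq_mul, mul_one] at h3 h4
    have h5 : (c * a) • (u - v) = 0 := by
      have h6 : d * b = -(c * a) := by linarith
      rw [smul_smul, smul_smul, h6] at h4
      rw [← h4]; module
    have h6 := (smul_eq_zero.1 h5).resolve_right (sub_ne_zero.2 huv)
    rw [h6, zero_add] at h3
    exact ⟨(mul_eq_zero.1 h6).resolve_right ha.ne', (mul_eq_zero.1 h3).resolve_right hb.ne'⟩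

/-- The linear part of the action on the projection of the slice. -/
noncomputable def linearPart : W →* End ℝ (midSpace ζ η) where
  toFun w := P.proj ∘ₗ actEnd n w ∘ₗ (midSpace ζ η).subtype
  map_one' := by
    refine LinearMap.ext fun v => ?_
    simp [P.proj_mid]
  map_mul' w w' := by
    refine LinearMap.ext fun v => ?_
    change P.proj ((w * w' : GL (Fin (n + 1)) ℝ) • (v : Fin (n + 1) → ℝ)) =
      P.proj ((w : GL (Fin (n + 1)) ℝ) • (P.proj ((w' : GL (Fin (n + 1)) ℝ) •
        (v : Fin (n + 1) → ℝ)) : Fin (n + 1) → ℝ))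
    rw [P.proj_coe, P.zeta_smul _ w'.2, zeta_mid, zero_smul, sub_zero, smul_sub, smul_comm _ _ e,
      P.smul_e _ w.2, map_sub, P.proj.map_smul, P.proj_e, smul_zero, sub_zero, mul_smul]

theorem linearPart_apply (w : W) (v : midSpace ζ η) :
    P.linearPart w v = P.proj ((w : GL (Fin (n + 1)) ℝ) • (v : Fin (n + 1) → ℝ)) := rfl

/-- The translation part of the action on the projection of the slice. -/
noncomputable def shift (w : W) : midSpace ζ η := P.proj ((w : GL (Fin (n + 1)) ℝ) • x₀)

/-- Since `W` fixes `e` and `ζ`, it acts on the slice by an affine map of the base and a vertical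
shift that is affine in the base point, as `AffinelyHomogeneous` requires. -/
theorem smul_pt (w : W) (v : midSpace ζ η) (t : ℝ) :
    (w : GL (Fin (n + 1)) ℝ) • P.pt v t = P.pt (P.linearPart w v + P.shift w)
      (t + (η ((w : GL (Fin (n + 1)) ℝ) • (v : Fin (n + 1) → ℝ)) +
        η ((w : GL (Fin (n + 1)) ℝ) • x₀))) := by
  have h1 : ζ ((w : GL (Fin (n + 1)) ℝ) • P.pt v t) = 1 := by
    rw [P.zeta_smul _ w.2, P.zeta_pt]
  rw [← P.pt_proj h1]
  have h2 : (w : GL (Fin (n + 1)) ℝ) • P.pt v t = (w : GL (Fin (n + 1)) ℝ) •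
      (v : Fin (n + 1) → ℝ) + (w : GL (Fin (n + 1)) ℝ) • x₀ + t • e := by
    rw [pt, smul_add, smul_add, smul_comm _ t e, P.smul_e _ w.2]
  congr 1
  · rw [h2, map_add, map_add, P.proj.map_smul, P.proj_e, smul_zero, add_zero]; rfl
  · rw [h2, map_add, map_add, η.map_smul, P.eta_e, smul_eq_mul, mul_one]; ring

theorem slowGrowth_linearPart (w : W) : SlowGrowth (P.linearPart w) := by
  intro v s hs
  obtain ⟨C, hC⟩ := P.slow _ w.2 v s hs
  refine ⟨‖LinearMap.toContinuousLinearMap P.proj‖ * C, fun k => ?_⟩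
  rw [← map_pow, P.linearPart_apply, mul_assoc]
  refine ((LinearMap.toContinuousLinearMap P.proj).le_opNorm _).trans
    (mul_le_mul_of_nonneg_left ?_ (norm_nonneg _))
  have h1 := hC k
  rwa [← map_pow] at h1

theorem affinelyHomogeneous : AffinelyHomogeneous P.linearPart P.base P.height := by
  intro x hx y hy
  obtain ⟨w, hw, hxy⟩ := P.transitive _ (P.pt_mem_boundary_iff.2 ⟨hx, rfl⟩).1
    (P.pt_mem_boundary_iff.2 ⟨hx, rfl⟩).2 (P.zeta_pt _ _) _
    (P.pt_mem_boundary_iff.2 ⟨hy, rfl⟩).1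
    (P.pt_mem_boundary_iff.2 ⟨hy, rfl⟩).2 (P.zeta_pt _ _)
  have hmem : ∀ u t, P.pt (P.linearPart ⟨w, hw⟩ u + P.shift ⟨w, hw⟩)
      (t + (η (w • (u : Fin (n + 1) → ℝ)) + η (w • x₀))) ∈ K ↔ P.pt u t ∈ K := fun u t => by
    rw [← P.smul_mem_iff w hw (P.pt u t), ← P.smul_pt ⟨w, hw⟩]
  have hbase : ∀ u, P.linearPart ⟨w, hw⟩ u + P.shift ⟨w, hw⟩ ∈ P.base ↔ u ∈ P.base := by
    refine fun u => ⟨fun ⟨t, ht⟩ => ?_, fun ⟨t, ht⟩ => ⟨_, (hmem u t).2 ht⟩⟩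
    refine ⟨t - (η (w • (u : Fin (n + 1) → ℝ)) + η (w • x₀)), (hmem _ _).1 ?_⟩
    rwa [sub_add_cancel]
  refine ⟨⟨w, hw⟩, P.shift ⟨w, hw⟩, ?_, hbase, η ∘ₗ actEnd n w ∘ₗ (midSpace ζ η).subtype,
    η (w • x₀), fun u hu => ?_⟩
  · have h1 := congrArg P.proj (P.smul_pt ⟨w, hw⟩ x (P.height x))
    rw [P.proj_pt] at h1
    rw [← h1, hxy, P.proj_pt]
  · have h1 : ∀ t, P.height (P.linearPart ⟨w, hw⟩ u + P.shift ⟨w, hw⟩) <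
        t + (η (w • (u : Fin (n + 1) → ℝ)) + η (w • x₀)) ↔ P.height u < t := by
      intro t
      have h2 := hmem u t
      rw [P.pt_mem_iff, P.pt_mem_iff, hbase] at h2
      simpa [hu] using h2
    change _ = P.height u + η (w • (u : Fin (n + 1) → ℝ)) + η (w • x₀)
    apply le_antisymm
    · refine le_of_forall_pos_lt_add fun c hc => ?_
      have := (h1 (P.height u + c)).2 (by linarith)
      linarith
    · by_contra! hlt
      have := (h1 (P.height (P.linearPart ⟨w, hw⟩ u + P.shift ⟨w, hw⟩) -
        (η (w • (u : Fin (n + 1) → ℝ)) + η (w • x₀)) + (P.height u +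
          η (w • (u : Fin (n + 1) → ℝ)) + η (w • x₀) -
          P.height (P.linearPart ⟨w, hw⟩ u + P.shift ⟨w, hw⟩)) / 2)).1 (by linarith)
      linarith

theorem height_eq_quadratic : P.base = Set.univ ∧
    ∃ (b : midSpace ζ η →ₗ[ℝ] midSpace ζ η →ₗ[ℝ] ℝ) (ℓ : midSpace ζ η →ₗ[ℝ] ℝ) (k : ℝ),
      (∀ v t, b v t = b t v) ∧ (∀ v, v ≠ 0 → 0 < b v v) ∧
      ∀ v, P.height v = b v v + ℓ v + k :=
  AffinelyHomogeneous.eq_quadratic _ _ P.linearPart P.base P.height rfl P.affinelyHomogeneous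
    P.slowGrowth_linearPart P.isOpen_base P.base_nonempty P.strictConvexOn_height

end ParabolicFrame

end Frame

end ConvexProjective


namespace ConvexProjective

open Module Topology

/-! ### Paraboloid coordinates -/

section NormalForm

theorem exists_linearEquiv_euclidean {F : Type*} [AddCommGroup F] [Module ℝ F]
    [FiniteDimensional ℝ F] {m : ℕ} (hm : finrank ℝ F = m) (b : F →ₗ[ℝ] F →ₗ[ℝ] ℝ)
    (hsymm : ∀ v t, b v t = b t v) (hpos : ∀ v, v ≠ 0 → 0 < b v v) :
    ∃ T : F ≃ₗ[ℝ] EuclideanSpace ℝ (Fin m), ∀ v, ‖T v‖ ^ 2 = b v v := by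
  let core : InnerProductSpace.Core ℝ F :=
    { inner := fun v t => b v t
      conj_inner_symm := fun v t => hsymm t v
      re_inner_nonneg := fun v => by
        rcases eq_or_ne v 0 with rfl | hv
        · simp
        · exact (hpos v hv).le
      add_left := fun u v t => by simp
      smul_left := fun u v r => by simp
      definite := fun v hv => by
        by_contra h
        exact (hpos v h).ne' hv }
  let : NormedAddCommGroup F := core.toNormedAddCommGroup
  let : InnerProductSpace ℝ F := InnerProductSpace.ofCore core.toCore
  subst hm
  refine ⟨(stdOrthonormalBasis ℝ F).repr.toLinearEquiv, fun v => ?_⟩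
  have h1 : ‖(stdOrthonormalBasis ℝ F).repr v‖ = ‖v‖ := LinearIsometryEquiv.norm_map _ v
  rw [LinearIsometryEquiv.coe_toLinearEquiv, h1, ← real_inner_self_eq_norm_sq]
  rfl

/-- The space of the paraboloid model. -/
abbrev Model (m : ℕ) : Type := EuclideanSpace ℝ (Fin m) × ℝ × ℝ

/-- The quadratic form `|v|² - s t`. -/
noncomputable def modelForm {m : ℕ} (x : Model m) : ℝ := ‖x.1‖ ^ 2 - x.2.1 * x.2.2

theorem modelForm_smul {m : ℕ} (c : ℝ) (x : Model m) : modelForm (c • x) = c ^ 2 * modelForm x := by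
  simp only [modelForm, Prod.smul_fst, Prod.smul_snd, norm_smul, smul_eq_mul, mul_pow,
    Real.norm_eq_abs, sq_abs]
  ring

variable {n : ℕ} {Ω : Set (RP n)} {K : Set (Fin (n + 1) → ℝ)} {ξ : (Fin (n + 1) → ℝ) →ₗ[ℝ] ℝ}

namespace ParabolicFrame

variable {W : Subgroup (GL (Fin (n + 1)) ℝ)} {e x₀ : Fin (n + 1) → ℝ}
  {ζ η : (Fin (n + 1) → ℝ) →ₗ[ℝ] ℝ}

theorem mk_mem_bdry_iff_of_zeta_eq_zero (P : ParabolicFrame Ω K ξ W e x₀ ζ η)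
    (hray : ∀ x ∈ closure K, x ∉ K → x ≠ 0 → ζ x ≤ 0 → ∃ c : ℝ, x = c • e) (heK : e ∉ K)
    {x : Fin (n + 1) → ℝ} (hx : x ≠ 0) (hζ : ζ x = 0) :
    Projectivization.mk ℝ x hx ∈ bdry Ω ↔ ∃ c : ℝ, x = c • e := by
  constructor
  · intro h
    obtain ⟨y, hy0, hxy, hy, hyK⟩ := P.cone.exists_boundary_vector h
    obtain ⟨c, rfl⟩ := (Projectivization.mk_eq_mk_iff' ℝ _ _ hx hy0).1 hxy
    have hc : c ≠ 0 := fun h0 => hx (by rw [h0, zero_smul])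
    rw [map_smul, smul_eq_zero] at hζ
    obtain ⟨d, rfl⟩ := hray y hy hyK hy0 (hζ.resolve_left hc).le
    exact ⟨c * d, smul_smul _ _ _⟩
  · rintro ⟨c, hc⟩
    have h1 : Projectivization.mk ℝ x hx = Projectivization.mk ℝ e P.ne_zero :=
      (Projectivization.mk_eq_mk_iff' ℝ _ _ _ _).2 ⟨c, hc.symm⟩
    rw [h1]
    exact P.cone.mk_mem_bdry _ P.mem heK

theorem mk_mem_bdry_iff_of_zeta_eq_one (P : ParabolicFrame Ω K ξ W e x₀ ζ η)
    {x : Fin (n + 1) → ℝ} (hx : x ≠ 0) (hζ : ζ x = 1) :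
    Projectivization.mk ℝ x hx ∈ bdry Ω ↔ P.proj x ∈ P.base ∧ η x = P.height (P.proj x) := by
  rw [← P.pt_mem_boundary_iff, P.pt_proj hζ]
  constructor
  · intro h
    obtain ⟨y, hy0, hxy, hy, hyK⟩ := P.cone.exists_boundary_vector h
    obtain ⟨c, rfl⟩ := (Projectivization.mk_eq_mk_iff' ℝ _ _ hx hy0).1 hxy
    have hyζ : 0 ≤ ζ y :=
      closure_minimal (s := K) (t := {x | 0 ≤ ζ x}) (fun z hz => (P.zeta_pos z hz).le)
        (isClosed_le continuous_const (LinearMap.continuous_of_finiteDimensional ζ)) hy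
    rw [map_smul, smul_eq_mul] at hζ
    have hc : 0 < c := pos_of_mul_pos_left (by rw [hζ]; exact one_pos) hyζ
    refine ⟨P.cone.smul_mem_closure hc hy, fun h1 => hyK ?_⟩
    have h2 := P.cone.smul_mem c⁻¹ (inv_pos.2 hc) _ h1
    rwa [smul_smul, inv_mul_cancel₀ hc.ne', one_smul] at h2
  · exact fun h => P.cone.mk_mem_bdry _ h.1 h.2

theorem finrank_midSpace (P : ParabolicFrame Ω K ξ W e x₀ ζ η) {m : ℕ} (hm : n = m + 1) :
    finrank ℝ (midSpace ζ η) = m := by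
  let ψ : (Fin (n + 1) → ℝ) →ₗ[ℝ] ℝ × ℝ := ζ.prod η
  have hker : LinearMap.ker ψ = midSpace ζ η := LinearMap.ker_prod ζ η
  have hsurj : LinearMap.range ψ = ⊤ := by
    rw [LinearMap.range_eq_top]
    rintro ⟨s, t⟩
    refine ⟨s • x₀ + t • e, ?_⟩
    simp [ψ, P.zeta_e, P.zeta_base, P.eta_e, P.eta_base]
  have h1 := LinearMap.finrank_range_add_finrank_ker ψ
  rw [hker, hsurj, finrank_top] at h1
  simp at h1
  change finrank ℝ (midSpace ζ η : Submodule ℝ (Fin (n + 1) → ℝ)) = m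
  omega

/-- Removing the affine part `ℓ + k` of the height from `η` turns the graph into `t = ‖v‖²`,
homogenized to `‖v‖² = s t` with `s = ζ`. For `s = 0` only multiples of `e` remain, in accordance
with `hray`. -/
theorem exists_chart (P : ParabolicFrame Ω K ξ W e x₀ ζ η) {m : ℕ} (hm : n = m + 1)
    (hray : ∀ x ∈ closure K, x ∉ K → x ≠ 0 → ζ x ≤ 0 → ∃ c : ℝ, x = c • e) (heK : e ∉ K) :
    ∃ φ : (Fin (n + 1) → ℝ) ≃ₗ[ℝ] Model m, φ e = (0, 0, 1) ∧ (∀ x, (φ x).2.1 = ζ x) ∧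
      ∀ (x : Fin (n + 1) → ℝ) (hx : x ≠ 0),
        Projectivization.mk ℝ x hx ∈ bdry Ω ↔ modelForm (φ x) = 0 := by
  obtain ⟨huniv, b, ℓ, k, hsymm, hpos, hb⟩ := P.height_eq_quadratic
  obtain ⟨T, hT⟩ := exists_linearEquiv_euclidean (P.finrank_midSpace hm) b hsymm hpos
  let φ₁ : (Fin (n + 1) → ℝ) →ₗ[ℝ] Model m :=
    (T.toLinearMap ∘ₗ P.proj).prod (ζ.prod (η - ℓ ∘ₗ P.proj - k • ζ))
  let ψ : Model m → (Fin (n + 1) → ℝ) := fun x =>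
    (T.symm x.1 : Fin (n + 1) → ℝ) + x.2.1 • x₀ + (x.2.2 + ℓ (T.symm x.1) + k * x.2.1) • e
  have hφ₁ : ∀ x, φ₁ x = (T (P.proj x), ζ x, η x - ℓ (P.proj x) - k * ζ x) := fun x => rfl
  have hprojψ : ∀ x, P.proj (ψ x) = T.symm x.1 := fun x => by
    simp only [ψ, map_add, map_smul, P.proj_e, P.proj_base, P.proj_mid, smul_zero, add_zero]
  have hζψ : ∀ x, ζ (ψ x) = x.2.1 := fun x => by
    simp only [ψ, map_add, map_smul, P.zeta_e, P.zeta_base, zeta_mid, smul_eq_mul]; ring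
  have hηψ : ∀ x, η (ψ x) = x.2.2 + ℓ (T.symm x.1) + k * x.2.1 := fun x => by
    simp only [ψ, map_add, map_smul, P.eta_e, P.eta_base, eta_mid, smul_eq_mul]; ring
  have hl : Function.LeftInverse ψ φ₁ := fun x => by
    simp only [hφ₁, ψ, LinearEquiv.symm_apply_apply]
    rw [P.proj_coe]
    module
  have hr : Function.RightInverse ψ φ₁ := fun x => by
    rw [hφ₁, hprojψ, hζψ, hηψ, LinearEquiv.apply_symm_apply]
    refine Prod.ext rfl (Prod.ext rfl ?_)
    ring
  let φ : (Fin (n + 1) → ℝ) ≃ₗ[ℝ] Model m := { φ₁ with invFun := ψ, left_inv := hl, right_inv := hr }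
  have hφ : ∀ x, φ x = (T (P.proj x), ζ x, η x - ℓ (P.proj x) - k * ζ x) := fun x => rfl
  have hφe : φ e = (0, 0, 1) := by
    rw [hφ, P.proj_e, P.zeta_e, P.eta_e]; simp
  refine ⟨φ, hφe, fun x => rfl, fun x hx => ?_⟩
  by_cases hζ : ζ x = 0
  · rw [P.mk_mem_bdry_iff_of_zeta_eq_zero hray heK hx hζ]
    constructor
    · rintro ⟨c, rfl⟩
      rw [map_smul, modelForm_smul, hφe]
      simp [modelForm]
    · intro h
      rw [modelForm, hφ] at h
      simp only [hζ, zero_mul, sub_zero, ne_eq, OfNat.ofNat_ne_zero, not_false_eq_true,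
        pow_eq_zero_iff, norm_eq_zero, LinearEquiv.map_eq_zero_iff] at h
      refine ⟨η x, ?_⟩
      have h1 := congrArg Subtype.val h
      rw [P.proj_coe, hζ] at h1
      have h2 : x - (0 : ℝ) • x₀ - η x • e = 0 := h1
      rw [zero_smul, sub_zero, sub_eq_zero] at h2
      exact h2
  · have hy0 : (ζ x)⁻¹ • x ≠ 0 := smul_ne_zero (inv_ne_zero hζ) hx
    have h1 : Projectivization.mk ℝ x hx = Projectivization.mk ℝ ((ζ x)⁻¹ • x) hy0 :=
      (Projectivization.mk_eq_mk_iff' ℝ _ _ _ _).2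
        ⟨ζ x, by rw [smul_smul, mul_inv_cancel₀ hζ, one_smul]⟩
    have h2 : ζ ((ζ x)⁻¹ • x) = 1 := by rw [map_smul, smul_eq_mul, inv_mul_cancel₀ hζ]
    rw [h1, P.mk_mem_bdry_iff_of_zeta_eq_one hy0 h2]
    have h3 : modelForm (φ x) = 0 ↔ modelForm (φ ((ζ x)⁻¹ • x)) = 0 := by
      rw [map_smul, modelForm_smul]
      have : ((ζ x)⁻¹) ^ 2 ≠ 0 := pow_ne_zero _ (inv_ne_zero hζ)
      simp [hζ]
    rw [h3, huniv, hb, modelForm, hφ]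
    simp only [h2, hT, Set.mem_univ, true_and, mul_one, one_mul]
    constructor <;> intro h <;> linarith

end ParabolicFrame

theorem IsConeOver.exists_parabolicFrame (h : IsConeOver Ω K ξ) (hΩ : IsStrictlyConvex Ω)
    {e : Fin (n + 1) → ℝ} (he0 : e ≠ 0) (he : e ∈ closure K) (heK : e ∉ K)
    {W : Subgroup (GL (Fin (n + 1)) ℝ)} [Group.IsNilpotent W]
    (hW : W ≤ SLfix Ω (Projectivization.mk ℝ e he0))
    (hst : ActsSimplyTransitivelyOn W (bdry Ω \ {Projectivization.mk ℝ e he0})) :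
    ∃ (x₀ : Fin (n + 1) → ℝ) (ζ η : (Fin (n + 1) → ℝ) →ₗ[ℝ] ℝ),
      ParabolicFrame Ω K ξ W e x₀ ζ η ∧
      ∀ x ∈ closure K, x ∉ K → x ≠ 0 → ζ x ≤ 0 → ∃ c : ℝ, x = c • e := by
  have hne : K.Nonempty := closure_nonempty_iff.1 ⟨e, he⟩
  obtain ⟨ζ, hζe, hζpos, hray, hζ⟩ := h.exists_invariant_functional hΩ he0 he heK hW hst
  obtain ⟨x, hx⟩ := hne
  have hζx := hζpos x hx
  have hξe := h.pos e he he0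
  obtain ⟨x₁, hx₁⟩ : ∃ x₁, ζ x₁ = 1 :=
    ⟨(ζ x)⁻¹ • x, by rw [map_smul, smul_eq_mul, inv_mul_cancel₀ hζx.ne']⟩
  -- The multiple of `e` makes `η` vanish at the base point and leaves `ζ` unchanged there.
  refine ⟨x₁ - ((ξ e)⁻¹ * ξ x₁) • e, ζ, (ξ e)⁻¹ • ξ, ?_, hray⟩
  exact
    { cone := h
      strict := hΩ
      nonempty := ⟨x, hx⟩
      ne_zero := he0
      mem := he
      zeta_e := hζe
      zeta_base := by rw [map_sub, map_smul, hζe, hx₁, smul_zero, sub_zero]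
      eta_e := by rw [LinearMap.smul_apply, smul_eq_mul, inv_mul_cancel₀ hξe.ne']
      eta_base := by
        rw [LinearMap.smul_apply, map_sub, map_smul, smul_eq_mul, smul_eq_mul]
        field_simp
        ring
      zeta_pos := hζpos
      smul_e := fun w hw => (h.smul_eq_and_slowGrowth he0 he hW hst hw).1
      slow := fun w hw => (h.smul_eq_and_slowGrowth he0 he hW hst hw).2
      zeta_smul := hζ
      smul_mem_iff := fun w hw =>
        h.smul_mem_iff_of_mem_SLdom ⟨x, hx⟩ (Subgroup.mem_inf.1 (hW hw)).1
      transitive := fun x hx hxK hx1 y hy hyK hy1 =>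
        h.exists_smul_eq he0 hst hζe hζ hx hxK hy hyK hx1 hy1 }

end NormalForm

end ConvexProjective


namespace ConvexProjective

open Module Topology

/-! ### Translations and parabolic isometries of the paraboloid model -/

section Model

variable {m : ℕ}

/-- The null vector at the point at infinity of the paraboloid. -/
noncomputable def modelPole (m : ℕ) : Model m := (0, 0, 1)

/-- The null vector at the apex of the paraboloid. -/
noncomputable def modelApex (m : ℕ) : Model m := (0, 1, 0)

/-- The translation of the paraboloid by `a`. -/
noncomputable def modelTranslation (a : EuclideanSpace ℝ (Fin m)) : End ℝ (Model m) where
  toFun x := (x.1 + x.2.1 • a, x.2.1, x.2.2 + 2 * inner ℝ a x.1 + x.2.1 * ‖a‖ ^ 2)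
  map_add' x y := by
    refine Prod.ext ?_ (Prod.ext rfl ?_)
    · change x.1 + y.1 + (x.2.1 + y.2.1) • a = x.1 + x.2.1 • a + (y.1 + y.2.1 • a)
      module
    · change x.2.2 + y.2.2 + 2 * inner ℝ a (x.1 + y.1) + (x.2.1 + y.2.1) * ‖a‖ ^ 2 =
        x.2.2 + 2 * inner ℝ a x.1 + x.2.1 * ‖a‖ ^ 2 + (y.2.2 + 2 * inner ℝ a y.1 + y.2.1 * ‖a‖ ^ 2)
      rw [inner_add_right]; ring
  map_smul' c x := by
    refine Prod.ext ?_ (Prod.ext rfl ?_)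
    · change c • x.1 + (c * x.2.1) • a = c • (x.1 + x.2.1 • a)
      module
    · change c * x.2.2 + 2 * inner ℝ a (c • x.1) + c * x.2.1 * ‖a‖ ^ 2 =
        c * (x.2.2 + 2 * inner ℝ a x.1 + x.2.1 * ‖a‖ ^ 2)
      rw [inner_smul_right]; ring

theorem modelTranslation_apply (a : EuclideanSpace ℝ (Fin m)) (x : Model m) :
    modelTranslation a x =
      (x.1 + x.2.1 • a, x.2.1, x.2.2 + 2 * inner ℝ a x.1 + x.2.1 * ‖a‖ ^ 2) := rfl

theorem modelTranslation_zero : modelTranslation (0 : EuclideanSpace ℝ (Fin m)) = 1 := by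
  refine LinearMap.ext fun x => ?_
  simp [modelTranslation_apply]

theorem modelTranslation_add (a b : EuclideanSpace ℝ (Fin m)) :
    modelTranslation (a + b) = modelTranslation a * modelTranslation b := by
  refine LinearMap.ext fun x => ?_
  simp only [Module.End.mul_apply, modelTranslation_apply]
  refine Prod.ext ?_ (Prod.ext rfl ?_)
  · dsimp only; module
  · dsimp only
    rw [inner_add_left, inner_add_right, inner_smul_right, norm_add_sq_real]; ring

theorem modelForm_modelTranslation (a : EuclideanSpace ℝ (Fin m)) (x : Model m) :
    modelForm (modelTranslation a x) = modelForm x := by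
  simp only [modelForm, modelTranslation_apply]
  rw [norm_add_sq_real, inner_smul_right, norm_smul, mul_pow, Real.norm_eq_abs, sq_abs,
    real_inner_comm]
  ring

theorem modelTranslation_pole (a : EuclideanSpace ℝ (Fin m)) :
    modelTranslation a (modelPole m) = modelPole m := by
  simp [modelTranslation_apply, modelPole]

theorem modelTranslation_sub_one_pow (a : EuclideanSpace ℝ (Fin m)) :
    (modelTranslation a - 1) ^ 3 = 0 := by
  have h : ∀ x, (modelTranslation a - 1) x =
      (x.2.1 • a, 0, 2 * inner ℝ a x.1 + x.2.1 * ‖a‖ ^ 2) := fun x => by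
    rw [LinearMap.sub_apply, modelTranslation_apply, Module.End.one_apply]
    refine Prod.ext ?_ (Prod.ext ?_ ?_)
    · change x.1 + x.2.1 • a - x.1 = x.2.1 • a
      abel
    · change x.2.1 - x.2.1 = 0
      ring
    · change x.2.2 + 2 * inner ℝ a x.1 + x.2.1 * ‖a‖ ^ 2 - x.2.2 = _
      ring
  refine LinearMap.ext fun x => ?_
  rw [pow_succ, pow_two, Module.End.mul_apply, Module.End.mul_apply, h, h, h]
  simp

/-- The dilation `(v, s, t) ↦ (2v, s, 4t)` conjugates the translation by `a` to the translation by
`2a`, its square. So the determinant equals its own square, and it is nonzero. -/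
theorem det_modelTranslation (a : EuclideanSpace ℝ (Fin m)) :
    LinearMap.det (modelTranslation a) = 1 := by
  let D : Model m ≃ₗ[ℝ] Model m := (LinearEquiv.smulOfNeZero ℝ _ (2 : ℝ) two_ne_zero).prodCongr
    ((LinearEquiv.refl ℝ ℝ).prodCongr (LinearEquiv.smulOfNeZero ℝ ℝ (4 : ℝ) four_ne_zero))
  have hD : ∀ x, (D : Model m →ₗ[ℝ] Model m) x = ((2 : ℝ) • x.1, x.2.1, 4 * x.2.2) := fun x => rfl
  have h1 : modelTranslation a * modelTranslation a * (D : End ℝ (Model m)) =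
      (D : End ℝ (Model m)) * modelTranslation a := by
    refine LinearMap.ext fun x => ?_
    rw [← modelTranslation_add, Module.End.mul_apply, Module.End.mul_apply, hD, hD]
    simp only [modelTranslation_apply]
    refine Prod.ext ?_ (Prod.ext rfl ?_)
    · dsimp only; module
    · dsimp only
      rw [inner_add_left, inner_smul_right, norm_add_sq_real, real_inner_self_eq_norm_sq]; ring
  have h2 := congrArg LinearMap.det h1
  have h3 : LinearMap.det (D : End ℝ (Model m)) ≠ 0 := (LinearEquiv.isUnit_det' D).ne_zero
  have h4 : LinearMap.det (modelTranslation a) ≠ 0 := by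
    intro h0
    have h5 : modelTranslation a * modelTranslation (-a) = 1 := by
      rw [← modelTranslation_add, add_neg_cancel, modelTranslation_zero]
    have h6 := congrArg LinearMap.det h5
    rw [map_mul, h0, zero_mul, map_one] at h6
    exact zero_ne_one h6
  rw [map_mul, map_mul, map_mul, mul_comm (LinearMap.det (D : End ℝ (Model m)))] at h2
  exact mul_right_cancel₀ h4 ((mul_right_cancel₀ h3 h2).trans (one_mul _).symm)

/-- The endomorphisms of the model that preserve the quadratic form and fix the pole. -/
structure IsModelParabolic (A : End ℝ (Model m)) : Prop where
  form : ∀ x, modelForm (A x) = modelForm x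
  pole : A (modelPole m) = modelPole m

theorem modelForm_add_smul_pole (x : Model m) (t : ℝ) :
    modelForm (x + t • modelPole m) = modelForm x - t * x.2.1 := by
  simp only [modelForm, modelPole, Prod.smul_mk, Prod.fst_add, Prod.snd_add, smul_zero, add_zero,
    smul_eq_mul, mul_one]
  ring

/-- The linear part of an endomorphism of the model. -/
noncomputable def modelLinearPart (A : End ℝ (Model m)) : End ℝ (EuclideanSpace ℝ (Fin m)) :=
  LinearMap.fst ℝ _ _ ∘ₗ A ∘ₗ LinearMap.inl ℝ _ (ℝ × ℝ)

theorem modelLinearPart_apply (A : End ℝ (Model m)) (v : EuclideanSpace ℝ (Fin m)) :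
    modelLinearPart A v = (A (v, 0, 0)).1 := rfl

/-- The translation part of an endomorphism of the model. -/
noncomputable def modelShift (A : End ℝ (Model m)) : EuclideanSpace ℝ (Fin m) :=
  (A (modelApex m)).1

theorem model_eq (x : Model m) :
    x = (x.1, 0, 0) + x.2.1 • modelApex m + x.2.2 • modelPole m := by
  refine Prod.ext ?_ (Prod.ext ?_ ?_) <;> simp [modelApex, modelPole]

namespace IsModelParabolic

variable {A B : End ℝ (Model m)}

/-- Adding the pole to `x` lowers the form by exactly the coordinate `s`, and both the form and the
pole are preserved. -/
theorem snd_fst (hA : IsModelParabolic A) (x : Model m) : (A x).2.1 = x.2.1 := by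
  have h1 := hA.form (x + (1 : ℝ) • modelPole m)
  rw [map_add, map_smul, hA.pole, modelForm_add_smul_pole, modelForm_add_smul_pole, hA.form] at h1
  linarith

theorem fst (hA : IsModelParabolic A) (x : Model m) :
    (A x).1 = modelLinearPart A x.1 + x.2.1 • modelShift A := by
  conv_lhs => rw [model_eq x]
  rw [map_add, map_add, map_smul, map_smul, hA.pole]
  simp [modelLinearPart_apply, modelShift, modelPole]

theorem norm_linearPart (hA : IsModelParabolic A) (v : EuclideanSpace ℝ (Fin m)) :
    ‖modelLinearPart A v‖ = ‖v‖ := by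
  have h1 := hA.form (v, 0, 0)
  rw [modelForm, hA.snd_fst, modelForm, ← modelLinearPart_apply] at h1
  simp only [zero_mul, sub_zero] at h1
  exact (sq_eq_sq₀ (norm_nonneg _) (norm_nonneg _)).1 h1

theorem linearPart_mul (hA : IsModelParabolic A) (hB : IsModelParabolic B) :
    modelLinearPart (A * B) = modelLinearPart A * modelLinearPart B := by
  refine LinearMap.ext fun v => ?_
  rw [modelLinearPart_apply, Module.End.mul_apply, hA.fst, hB.snd_fst, Module.End.mul_apply,
    ← modelLinearPart_apply]
  simp

theorem shift_mul (hA : IsModelParabolic A) (hB : IsModelParabolic B) :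
    modelShift (A * B) = modelLinearPart A (modelShift B) + modelShift A := by
  rw [modelShift, Module.End.mul_apply, hA.fst, hB.snd_fst]
  simp [modelShift, modelApex]

/-- A parabolic endomorphism with trivial linear part is a translation. -/
theorem eq_translation (hA : IsModelParabolic A) (h : modelLinearPart A = 1) :
    A = modelTranslation (modelShift A) := by
  -- On the slice `s = 1` the form determines `t` from `v`. Every vector is a difference of
  -- multiples of slice vectors and the apex.
  have key : ∀ x : Model m, x.2.1 = 1 → A x = modelTranslation (modelShift A) x := by
    intro x hx
    have h1 := hA.form x
    rw [← modelForm_modelTranslation (modelShift A) x] at h1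
    have h2 : (A x).1 = (modelTranslation (modelShift A) x).1 := by
      rw [hA.fst, h]; rfl
    have h3 : (A x).2.1 = (modelTranslation (modelShift A) x).2.1 := hA.snd_fst x
    rw [modelForm, modelForm, h2, hA.snd_fst, modelTranslation_apply, hx] at h1
    refine Prod.ext h2 (Prod.ext h3 ?_)
    rw [modelTranslation_apply, hx]
    simp only [one_mul, one_smul] at h1 ⊢
    linarith
  refine LinearMap.ext fun x => ?_
  have h1 : x = (x + (1 - x.2.1) • modelApex m) - (1 - x.2.1) • modelApex m := by abel
  rw [h1, map_sub, map_sub, key, map_smul, map_smul, key]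
  · rfl
  · simp [modelApex]

/-- A unipotent isometry is trivial. -/
theorem _root_.ConvexProjective.eq_one_of_isNilpotent_sub_one {E : Type*} [NormedAddCommGroup E]
    [InnerProductSpace ℝ E] {β : End ℝ E} (hβ : ∀ v, ‖β v‖ = ‖v‖) (h : IsNilpotent (β - 1)) :
    β = 1 := by
  have hinner : ∀ u v, inner ℝ (β u) (β v) = inner ℝ u v :=
    (LinearMap.norm_map_iff_inner_map_map β).1 hβ
  -- Vectors fixed by an isometry are orthogonal to the range of `β - 1`, so a fixed vector in that
  -- range is zero.
  have hsq : ∀ u, (β - 1) ((β - 1) u) = 0 → (β - 1) u = 0 := by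
    intro u hu
    have h1 : β ((β - 1) u) = (β - 1) u := sub_eq_zero.1 hu
    have h2 : inner ℝ ((β - 1) u) ((β - 1) u) = 0 := by
      have h3 := hinner u ((β - 1) u)
      rw [h1] at h3
      have h4 : inner ℝ (β u - u) ((β - 1) u) = 0 := by rw [inner_sub_left, h3, sub_self]
      exact h4
    exact inner_self_eq_zero.1 h2
  obtain ⟨k, hk⟩ := h
  have key : ∀ k : ℕ, (β - 1) ^ (k + 1) = 0 → β - 1 = 0 := by
    intro k
    induction k with
    | zero => exact fun h => by rwa [zero_add, pow_one] at h
    | succ k ih =>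
      refine fun h => ih (LinearMap.ext fun u => ?_)
      have h1 := LinearMap.congr_fun h u
      rw [pow_succ', pow_succ', Module.End.mul_apply, Module.End.mul_apply] at h1
      rw [pow_succ', Module.End.mul_apply]
      exact hsq _ h1
  exact sub_eq_zero.1 (key k (by rw [pow_succ, hk, zero_mul]))

/-- On the hyperplane `s = 0` the first coordinate intertwines `A - 1` with the linear part minus
`1`, which is therefore nilpotent; a unipotent isometry is trivial. -/
theorem linearPart_eq_one (hA : IsModelParabolic A) (h : IsNilpotent (A - 1)) :
    modelLinearPart A = 1 := by
  refine eq_one_of_isNilpotent_sub_one hA.norm_linearPart ?_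
  obtain ⟨k, hk⟩ := h
  refine ⟨k, LinearMap.ext fun v => ?_⟩
  have key : ∀ k : ℕ, (((A - 1) ^ k) (v, 0, 0)).2.1 = 0 ∧
      (((A - 1) ^ k) (v, 0, 0)).1 = ((modelLinearPart A - 1) ^ k) v := by
    intro k
    induction k with
    | zero => simp
    | succ k ih =>
      rw [pow_succ', pow_succ', Module.End.mul_apply, Module.End.mul_apply, ← ih.2,
        LinearMap.sub_apply, LinearMap.sub_apply, Prod.snd_sub, Prod.fst_sub, Prod.fst_sub,
        hA.snd_fst, hA.fst, ih.1]
      simp [ih.1]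
  rw [← (key k).2, hk]
  rfl

end IsModelParabolic

end Model

end ConvexProjective


namespace ConvexProjective

open Module Topology

/-! ### From the model to the Lorentz form and its pure translations -/

section Lorentz

variable {m n : ℕ}

/-- A real matrix is unipotent if and only if all its complex eigenvalues are `1`. -/
theorem isNilpotent_sub_one_iff {k : ℕ} (A : Matrix (Fin k) (Fin k) ℝ) :
    IsNilpotent (A - 1) ↔ ∀ μ : ℂ, Polynomial.aeval μ A.charpoly = 0 → μ = 1 := by
  have hroot : ∀ μ : ℂ, Polynomial.aeval μ A.charpoly =
      (Matrix.scalar (Fin k) μ - A.map (algebraMap ℝ ℂ)).det := fun μ => by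
    rw [Polynomial.aeval_def, ← Polynomial.eval_map, ← Matrix.charpoly_map, Matrix.eval_charpoly]
  constructor
  · intro h μ hμ
    by_contra hne
    have h1 : IsNilpotent (-(A.map (algebraMap ℝ ℂ) - 1)) := by
      have h2 := h.map (algebraMap ℝ ℂ).mapMatrix
      rw [map_sub, map_one] at h2
      exact h2.neg
    have h2 : IsUnit (Matrix.scalar (Fin k) (μ - 1)) :=
      (IsUnit.mk0 _ (sub_ne_zero.2 hne)).map (Matrix.scalar (Fin k))
    have h3 := h1.isUnit_add_left_of_commute h2
      (Matrix.scalar_commute _ (fun r => Commute.all _ r) _).symm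
    have h4 : Matrix.scalar (Fin k) (μ - 1) + -(A.map (algebraMap ℝ ℂ) - 1) =
        Matrix.scalar (Fin k) μ - A.map (algebraMap ℝ ℂ) := by
      rw [map_sub, map_one]; abel
    rw [h4, Matrix.isUnit_iff_isUnit_det, ← hroot, hμ] at h3
    exact not_isUnit_zero h3
  · intro h
    have hmonic := A.charpoly_monic.map (algebraMap ℝ ℂ)
    have h1 := (IsAlgClosed.splits (A.charpoly.map (algebraMap ℝ ℂ))).eq_prod_roots_of_monic hmonic
    have h2 : (A.charpoly.map (algebraMap ℝ ℂ)).roots =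
        Multiset.replicate (A.charpoly.map (algebraMap ℝ ℂ)).roots.card 1 := by
      refine Multiset.eq_replicate_card.2 fun μ hμ => h μ ?_
      rw [Polynomial.aeval_def, ← Polynomial.eval_map]
      exact (Polynomial.mem_roots'.1 hμ).2
    set d := (A.charpoly.map (algebraMap ℝ ℂ)).roots.card
    rw [h2, Multiset.map_replicate, Multiset.prod_replicate] at h1
    have h3 : A.charpoly = (Polynomial.X - Polynomial.C 1) ^ d := by
      apply Polynomial.map_injective (algebraMap ℝ ℂ) (algebraMap ℝ ℂ).injective
      rw [h1]; simp
    have h4 := Matrix.aeval_self_charpoly A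
    rw [h3] at h4
    exact ⟨d, by simpa using h4⟩

/-- The linear isomorphism that takes the form of the model to the Lorentz form. -/
noncomputable def lorentzEquiv (m : ℕ) : Model m ≃ₗ[ℝ] (Fin (m + 1 + 1) → ℝ) where
  toFun x := Fin.snoc (α := fun _ => ℝ) (Fin.snoc (α := fun _ => ℝ) (fun i => x.1 i)
    ((x.2.2 - x.2.1) / 2)) ((x.2.2 + x.2.1) / 2)
  invFun y := (WithLp.toLp 2 fun i => y i.castSucc.castSucc,
    y (Fin.last _) - y (Fin.last _).castSucc, y (Fin.last _) + y (Fin.last _).castSucc)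
  map_add' x y := by
    funext i
    refine Fin.lastCases ?_ (fun i => Fin.lastCases ?_ (fun i => ?_) i) i
    · simp; ring
    · simp; ring
    · simp
  map_smul' c x := by
    funext i
    refine Fin.lastCases ?_ (fun i => Fin.lastCases ?_ (fun i => ?_) i) i
    · simp; ring
    · simp; ring
    · simp
  left_inv x := by
    refine Prod.ext ?_ (Prod.ext ?_ ?_)
    · ext i; simp
    · simp; ring
    · simp; ring
  right_inv y := by
    funext i
    refine Fin.lastCases ?_ (fun i => Fin.lastCases ?_ (fun i => ?_) i) i
    · simp
    · simp
    · simp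

/-- `((t - s) / 2)² - ((t + s) / 2)² = -s t`. -/
theorem lorentz_lorentzEquiv (x : Model m) : lorentz (lorentzEquiv m x) = modelForm x := by
  simp only [lorentz, lorentzEquiv, LinearEquiv.coe_mk, LinearMap.coe_mk, AddHom.coe_mk,
    Fin.sum_univ_castSucc, Fin.snoc_castSucc, Fin.snoc_last, modelForm,
    EuclideanSpace.real_norm_sq_eq]
  ring

theorem lorentz_smul (c : ℝ) (v : Fin (n + 1) → ℝ) : lorentz (c • v) = c ^ 2 * lorentz v := by
  simp only [lorentz, Pi.smul_apply, smul_eq_mul, mul_pow, ← Finset.mul_sum]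
  ring

theorem mk_mem_unitSphere_iff {v : Fin (n + 1) → ℝ} (hv : v ≠ 0) :
    Projectivization.mk ℝ v hv ∈ unitSphere n ↔ lorentz v = 0 := by
  change (∀ w ∈ (Projectivization.mk ℝ v hv).submodule, lorentz w = 0) ↔ _
  rw [Projectivization.submodule_mk]
  constructor
  · exact fun h => h v (Submodule.mem_span_singleton_self v)
  · intro h w hw
    obtain ⟨c, rfl⟩ := Submodule.mem_span_singleton.1 hw
    rw [lorentz_smul, h, mul_zero]

/-- The matrix of a linear automorphism. -/
noncomputable def glOf (M : (Fin (n + 1) → ℝ) ≃ₗ[ℝ] (Fin (n + 1) → ℝ)) : GL (Fin (n + 1)) ℝ :=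
  Matrix.GeneralLinearGroup.toLin.symm (LinearMap.GeneralLinearGroup.ofLinearEquiv M)

theorem actEnd_glOf (M : (Fin (n + 1) → ℝ) ≃ₗ[ℝ] (Fin (n + 1) → ℝ)) :
    actEnd n (glOf M) = M.toLinearMap := by
  have h1 := Matrix.GeneralLinearGroup.toLin.apply_symm_apply
    (LinearMap.GeneralLinearGroup.ofLinearEquiv M)
  exact congrArg Units.val h1

theorem glOf_smul (M : (Fin (n + 1) → ℝ) ≃ₗ[ℝ] (Fin (n + 1) → ℝ)) (v : Fin (n + 1) → ℝ) :
    glOf M • v = M v := LinearMap.congr_fun (actEnd_glOf M) v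

/-- Every linear automorphism has a multiple with determinant `± 1`. -/
theorem exists_mem_SLpm_smul (M : (Fin (n + 1) → ℝ) ≃ₗ[ℝ] (Fin (n + 1) → ℝ)) :
    ∃ g ∈ SLpm n, ∃ c : ℝ, c ≠ 0 ∧ ∀ v, g • v = c • M v := by
  set d := |LinearMap.det M.toLinearMap| with hd
  have hd0 : 0 < d := abs_pos.2 (LinearEquiv.isUnit_det' M).ne_zero
  set c := (d⁻¹) ^ (((n + 1 : ℕ) : ℝ)⁻¹) with hc
  have hc0 : 0 < c := Real.rpow_pos_of_pos (inv_pos.2 hd0) _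
  have hcn : c ^ (n + 1) = d⁻¹ := Real.rpow_inv_natCast_pow (inv_pos.2 hd0).le (Nat.succ_ne_zero n)
  let M' := M.trans (LinearEquiv.smulOfNeZero ℝ (Fin (n + 1) → ℝ) c hc0.ne')
  refine ⟨glOf M', ?_, c, hc0.ne', fun v => glOf_smul M' v⟩
  have h1 : (M' : (Fin (n + 1) → ℝ) →ₗ[ℝ] (Fin (n + 1) → ℝ)) = c • M.toLinearMap :=
    LinearMap.ext fun v => rfl
  have h2 : LinearMap.det (actEnd n (glOf M')) = c ^ (n + 1) * LinearMap.det M.toLinearMap := by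
    rw [actEnd_glOf, h1, LinearMap.det_smul]
    simp
  rw [actEnd_eq_toLin', LinearMap.det_toLin'] at h2
  rw [mem_SLpm_iff, h2, hcn, abs_mul, ← hd, abs_of_pos (inv_pos.2 hd0), inv_mul_cancel₀ hd0.ne']

/-- The action of matrices in coordinates. -/
noncomputable def modelRep (φ : (Fin (n + 1) → ℝ) ≃ₗ[ℝ] Model m) :
    GL (Fin (n + 1)) ℝ →* End ℝ (Model m) :=
  (φ.conjRingEquiv : End ℝ (Fin (n + 1) → ℝ) →* End ℝ (Model m)).comp (actEnd n)

variable (φ : (Fin (n + 1) → ℝ) ≃ₗ[ℝ] Model m)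

theorem modelRep_apply (g : GL (Fin (n + 1)) ℝ) (x : Model m) :
    modelRep φ g x = φ (g • φ.symm x) := rfl

theorem modelRep_injective : Function.Injective (modelRep φ) :=
  φ.conjRingEquiv.injective.comp actEnd_injective

theorem isNilpotent_modelRep_sub_one_iff (g : GL (Fin (n + 1)) ℝ) :
    IsNilpotent (modelRep φ g - 1) ↔
      IsNilpotent ((g : Matrix (Fin (n + 1)) (Fin (n + 1)) ℝ) - 1) := by
  have h1 : modelRep φ g - 1 = (Matrix.toLinAlgEquiv'.toRingEquiv.trans φ.conjRingEquiv)
      ((g : Matrix (Fin (n + 1)) (Fin (n + 1)) ℝ) - 1) := by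
    rw [map_sub, map_one]; rfl
  rw [h1]
  exact IsNilpotent.map_iff (RingEquiv.injective _)

theorem isEllipsoid_of_chart {S : Set (RP (m + 1))} (φ : (Fin (m + 1 + 1) → ℝ) ≃ₗ[ℝ] Model m)
    (hS : ∀ (x : Fin (m + 1 + 1) → ℝ) (hx : x ≠ 0),
      Projectivization.mk ℝ x hx ∈ S ↔ modelForm (φ x) = 0) : IsEllipsoid S := by
  refine ⟨(glOf (φ.trans (lorentzEquiv m)))⁻¹, Set.ext fun p => ?_⟩
  induction p using Projectivization.ind with
  | h v hv =>
    rw [hS, Set.mem_inv_smul_set_iff, Projectivization.smul_mk, mk_mem_unitSphere_iff, glOf_smul,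
      LinearEquiv.trans_apply, lorentz_lorentzEquiv]

/-- A group that acts in the model as the group of all translations is conjugate to the group of
pure translations. -/
theorem isConjToPureTranslations_of_chart (φ : (Fin (m + 1 + 1) → ℝ) ≃ₗ[ℝ] Model m)
    {W : Subgroup (GL (Fin (m + 1 + 1)) ℝ)}
    (hW : ∀ w ∈ W, ∃ a, modelRep φ w = modelTranslation a)
    (hsurj : ∀ a, ∃ w ∈ W, modelRep φ w = modelTranslation a) : IsConjToPureTranslations W := by
  obtain ⟨g, hg, c, hc, hgv⟩ := exists_mem_SLpm_smul (φ.trans (lorentzEquiv m))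
  have hq : ∀ v, lorentz (g • v) = c ^ 2 * modelForm (φ v) := fun v => by
    rw [hgv, lorentz_smul, LinearEquiv.trans_apply, lorentz_lorentzEquiv]
  set e := φ.symm (modelPole m) with he
  have he0 : e ≠ 0 := by
    intro h0
    have h1 : modelPole m = 0 := by rw [← φ.apply_symm_apply (modelPole m), ← he, h0, map_zero]
    exact one_ne_zero (congrArg (fun x : Model m => x.2.2) h1)
  have hform : ∀ w : GL (Fin (m + 1 + 1)) ℝ, g * w * g⁻¹ ∈ lorentzGroup (m + 1) ↔
      ∀ x, modelForm (modelRep φ w x) = modelForm x := by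
    intro w
    change (∀ v, lorentz ((g * w * g⁻¹) • v) = lorentz v) ↔ _
    constructor
    · intro h x
      have h1 := h (g • φ.symm x)
      rw [mul_smul, inv_smul_smul, mul_smul, hq, hq, φ.apply_symm_apply] at h1
      exact mul_left_cancel₀ (pow_ne_zero 2 hc) h1
    · intro h v
      have h1 := h (φ (g⁻¹ • v))
      rw [modelRep_apply, φ.symm_apply_apply] at h1
      rw [mul_smul, mul_smul, hq, h1, ← hq, smul_inv_smul]
  have hpure : ∀ w : GL (Fin (m + 1 + 1)) ℝ,
      g * w * g⁻¹ ∈ pureTranslations (g • Projectivization.mk ℝ e he0) ↔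
      (∀ x, modelForm (modelRep φ w x) = modelForm x) ∧
      w • Projectivization.mk ℝ e he0 = Projectivization.mk ℝ e he0 ∧
      IsNilpotent (modelRep φ w - 1) := by
    intro w
    have h1 : (g * w * g⁻¹) • (g • Projectivization.mk ℝ e he0) =
        g • Projectivization.mk ℝ e he0 ↔
        w • Projectivization.mk ℝ e he0 = Projectivization.mk ℝ e he0 := by
      rw [mul_smul, inv_smul_smul, mul_smul, smul_left_cancel_iff]
    have h2 : ((g * w * g⁻¹ : GL (Fin (m + 1 + 1)) ℝ) :
        Matrix (Fin (m + 1 + 1)) (Fin (m + 1 + 1)) ℝ).charpoly =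
        (w : Matrix (Fin (m + 1 + 1)) (Fin (m + 1 + 1)) ℝ).charpoly := by
      rw [Units.val_mul, Units.val_mul, Matrix.coe_units_inv, Matrix.charpoly_units_conj]
    change (g * w * g⁻¹ ∈ lorentzGroup (m + 1) ⊓ MulAction.stabilizer _ _ ∧ _) ↔ _
    rw [Subgroup.mem_inf, MulAction.mem_stabilizer_iff, hform, h1, h2,
      isNilpotent_modelRep_sub_one_iff, isNilpotent_sub_one_iff, and_assoc]
  refine ⟨g, hg, g • Projectivization.mk ℝ e he0, ?_, Set.ext fun A => ?_⟩
  · rw [Projectivization.smul_mk, mk_mem_unitSphere_iff, hq, he, φ.apply_symm_apply]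
    simp [modelForm, modelPole]
  · constructor
    · rintro ⟨w, hw, rfl⟩
      obtain ⟨a, ha⟩ := hW w hw
      refine (hpure w).2 ⟨fun x => by rw [ha, modelForm_modelTranslation], ?_, ?_⟩
      · refine smul_mk_eq_of_smul_eq (c := 1) ?_
        have h1 := modelRep_apply φ w (modelPole m)
        rw [ha, modelTranslation_pole] at h1
        rw [one_smul]
        exact φ.injective (h1.symm.trans (φ.apply_symm_apply _).symm)
      · rw [ha]
        exact ⟨3, modelTranslation_sub_one_pow a⟩
    · intro hA
      have hconj : A = g * (g⁻¹ * A * g) * g⁻¹ := by group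
      rw [hconj, hpure] at hA
      obtain ⟨h1, h2, h3⟩ := hA
      set w := g⁻¹ * A * g
      obtain ⟨d, -, hd⟩ := exists_smul_eq_of_smul_mk_eq h2
      have hpole : modelRep φ w (modelPole m) = d • modelPole m := by
        rw [modelRep_apply, ← he, hd, map_smul, he, φ.apply_symm_apply]
      -- The element fixes the pole only projectively; unipotence forces its eigenvalue there to be
      -- `1`.
      have hd1 : d = 1 := by
        obtain ⟨k, hk⟩ := h3
        have key : ∀ k : ℕ, ((modelRep φ w - 1) ^ k) (modelPole m) =
            (d - 1) ^ k • modelPole m := by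
          intro k
          induction k with
          | zero => simp
          | succ k ih =>
            rw [pow_succ', Module.End.mul_apply, ih, map_smul, LinearMap.sub_apply, hpole,
              Module.End.one_apply, pow_succ]
            module
        have h4 := key k
        rw [hk] at h4
        have h5 := congrArg (fun x : Model m => x.2.2) h4
        simp only [LinearMap.zero_apply, modelPole, Prod.smul_mk, Prod.snd_zero, smul_eq_mul,
          mul_one] at h5
        exact sub_eq_zero.1 (eq_zero_of_pow_eq_zero h5.symm)
      have hpar : IsModelParabolic (modelRep φ w) := ⟨h1, by rw [hpole, hd1, one_smul]⟩
      have h4 := hpar.eq_translation (hpar.linearPart_eq_one h3)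
      obtain ⟨w', hw', h5⟩ := hsurj (modelShift (modelRep φ w))
      rw [← h4] at h5
      exact ⟨w', hw', by rw [modelRep_injective φ h5]; exact hconj.symm⟩

end Lorentz

end ConvexProjective


namespace ConvexProjective

open Module Topology

/-! ### Both directions of the theorem -/

section Main

variable {m n : ℕ} {Ω : Set (RP n)} {K : Set (Fin (n + 1) → ℝ)} {ξ : (Fin (n + 1) → ℝ) →ₗ[ℝ] ℝ}

theorem IsConeOver.smul_mem_bdry (h : IsConeOver Ω K ξ) {g : GL (Fin (n + 1)) ℝ}
    (hg : g ∈ SLdom Ω) {p : RP n} (hp : p ∈ bdry Ω) : g • p ∈ bdry Ω := by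
  have hne := h.nonempty_of_mem_bdry hp
  obtain ⟨v, hv, rfl, hvK, hvK'⟩ := h.exists_boundary_vector hp
  rw [Projectivization.smul_mk]
  exact h.mk_mem_bdry _ ((h.smul_mem_closure_iff_of_mem_SLdom hne hg v).2 hvK)
    fun h1 => hvK' ((h.smul_mem_iff_of_mem_SLdom hne hg v).1 h1)

namespace ParabolicFrame

variable {W : Subgroup (GL (Fin (n + 1)) ℝ)} {e x₀ : Fin (n + 1) → ℝ}
  {ζ η : (Fin (n + 1) → ℝ) →ₗ[ℝ] ℝ}

/-- A priori only null vectors go to null vectors. If `s ≠ 0`, adding a suitable multiple of the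
pole to `x` gives a null vector, and that multiple times `s` is the form at `x`. As the pole and `s`
are preserved, so is the form. The case `s = 0` follows from the parallelogram identity with the
apex. -/
theorem isModelParabolic_modelRep (P : ParabolicFrame Ω K ξ W e x₀ ζ η)
    (hW : W ≤ SLdom Ω) {φ : (Fin (n + 1) → ℝ) ≃ₗ[ℝ] Model m}
    (hφe : φ e = modelPole m) (hφζ : ∀ x, (φ x).2.1 = ζ x)
    (hφ : ∀ (x : Fin (n + 1) → ℝ) (hx : x ≠ 0),
      Projectivization.mk ℝ x hx ∈ bdry Ω ↔ modelForm (φ x) = 0)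
    {w : GL (Fin (n + 1)) ℝ} (hw : w ∈ W) : IsModelParabolic (modelRep φ w) := by
  have hpole : modelRep φ w (modelPole m) = modelPole m := by
    rw [modelRep_apply, ← hφe, φ.symm_apply_apply, P.smul_e w hw]
  have hsnd : ∀ x, (modelRep φ w x).2.1 = x.2.1 := fun x => by
    rw [modelRep_apply, hφζ, P.zeta_smul w hw, ← hφζ, φ.apply_symm_apply]
  have hnull : ∀ x, x ≠ 0 → modelForm x = 0 → modelForm (modelRep φ w x) = 0 := by
    intro x hx0 hx
    have hy : φ.symm x ≠ 0 := by simpa using hx0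
    have h1 := P.cone.smul_mem_bdry (hW hw) ((hφ _ hy).2 (by rwa [φ.apply_symm_apply]))
    rw [Projectivization.smul_mk, hφ] at h1
    exact h1
  have hslice : ∀ x : Model m, x.2.1 ≠ 0 → modelForm (modelRep φ w x) = modelForm x := by
    intro x hx
    have h1 := hnull (x + (modelForm x / x.2.1) • modelPole m) (by
      intro h0
      have := congrArg (fun y : Model m => y.2.1) h0
      simp only [modelPole, Prod.snd_add, Prod.fst_add, Prod.smul_mk, smul_zero, add_zero,
        Prod.snd_zero, Prod.fst_zero] at this
      exact hx this) (by
        rw [modelForm_add_smul_pole, div_mul_cancel₀ _ hx, sub_self])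
    rw [map_add, map_smul, hpole, modelForm_add_smul_pole, hsnd, div_mul_cancel₀ _ hx] at h1
    linarith
  have hpar : ∀ x y : Model m, modelForm (x + y) + modelForm (x - y) =
      2 * modelForm x + 2 * modelForm y := by
    intro x y
    simp only [modelForm, Prod.fst_add, Prod.snd_add, Prod.fst_sub, Prod.snd_sub]
    have := parallelogram_law_with_norm ℝ x.1 y.1
    nlinarith
  refine ⟨fun x => ?_, hpole⟩
  by_cases hx : x.2.1 = 0
  · have ha : (modelApex m).2.1 = 1 := rfl
    have h1 := hslice (x + modelApex m) (by rw [Prod.snd_add, Prod.fst_add, hx, ha]; norm_num)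
    have h2 := hslice (x - modelApex m) (by rw [Prod.snd_sub, Prod.fst_sub, hx, ha]; norm_num)
    have h3 := hslice (modelApex m) (by rw [ha]; exact one_ne_zero)
    have h4 := hpar x (modelApex m)
    have h5 := hpar (modelRep φ w x) (modelRep φ w (modelApex m))
    rw [map_add] at h1
    rw [map_sub] at h2
    linarith
  · exact hslice x hx

/-- Transitivity moves the apex to the paraboloid point `(a, 1, ‖a‖²)`. -/
theorem exists_modelRep_apex (P : ParabolicFrame Ω K ξ W e x₀ ζ η)
    {φ : (Fin (n + 1) → ℝ) ≃ₗ[ℝ] Model m} (hφζ : ∀ x, (φ x).2.1 = ζ x)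
    (hφ : ∀ (x : Fin (n + 1) → ℝ) (hx : x ≠ 0),
      Projectivization.mk ℝ x hx ∈ bdry Ω ↔ modelForm (φ x) = 0)
    (a : EuclideanSpace ℝ (Fin m)) : ∃ w ∈ W, modelShift (modelRep φ w) = a := by
  have key : ∀ x : Model m, x.2.1 = 1 → modelForm x = 0 →
      φ.symm x ∈ closure K ∧ φ.symm x ∉ K ∧ ζ (φ.symm x) = 1 := by
    intro x hx hx0
    have hζ : ζ (φ.symm x) = 1 := by rw [← hφζ, φ.apply_symm_apply, hx]
    have hy : φ.symm x ≠ 0 := fun h0 => by rw [h0, map_zero] at hζ; exact zero_ne_one hζ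
    have h1 := (hφ _ hy).2 (by rwa [φ.apply_symm_apply])
    rw [P.mk_mem_bdry_iff_of_zeta_eq_one hy hζ, ← P.pt_mem_boundary_iff, P.pt_proj hζ] at h1
    exact ⟨h1.1, h1.2, hζ⟩
  obtain ⟨h1, h2, h3⟩ := key (modelApex m) rfl (by simp [modelForm, modelApex])
  obtain ⟨h4, h5, h6⟩ := key (a, 1, ‖a‖ ^ 2) rfl (by simp [modelForm])
  obtain ⟨w, hw, h7⟩ := P.transitive _ h1 h2 h3 _ h4 h5 h6
  refine ⟨w, hw, ?_⟩
  rw [modelShift, modelRep_apply, h7, φ.apply_symm_apply]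

end ParabolicFrame

/-- A nilpotent group that acts simply transitively on the complement of a point of the boundary
of a strictly convex domain acts by translations of a paraboloid. -/
theorem isEllipsoid_and_isConjToPureTranslations {Ω : Set (RP (m + 1))} (hopen : IsOpen Ω)
    (hΩ : IsStrictlyConvex Ω) {p : RP (m + 1)} (hp : p ∈ bdry Ω)
    {W : Subgroup (GL (Fin (m + 1 + 1)) ℝ)} [Group.IsNilpotent W] (hW : W ≤ SLfix Ω p)
    (hst : ActsSimplyTransitivelyOn W (bdry Ω \ {p})) :
    IsEllipsoid (bdry Ω) ∧ IsConjToPureTranslations W := by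
  obtain ⟨K, ξ, h⟩ := exists_isConeOver hopen hΩ.1
  obtain ⟨e, he0, rfl, he, heK⟩ := h.exists_boundary_vector hp
  obtain ⟨x₀, ζ, η, P, hray⟩ := h.exists_parabolicFrame hΩ he0 he heK hW hst
  obtain ⟨φ, hφe, hφζ, hφ⟩ := P.exists_chart rfl hray heK
  have hdom : W ≤ SLdom Ω := hW.trans inf_le_left
  have hpar : ∀ w : W, IsModelParabolic (modelRep φ w) := fun w =>
    P.isModelParabolic_modelRep hdom hφe hφζ hφ w.2
  let ρ : W →* End ℝ (EuclideanSpace ℝ (Fin m)) :=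
    { toFun := fun w => modelLinearPart (modelRep φ w)
      map_one' := by
        rw [Subgroup.coe_one, map_one]
        exact LinearMap.ext fun v => rfl
      map_mul' := fun w w' => by
        rw [Subgroup.coe_mul, map_mul, (hpar w).linearPart_mul (hpar w')] }
  have hsurj := P.exists_modelRep_apex hφζ hφ
  have hρ : ∀ w, ρ w = 1 := linear_part_eq_one_of_nilpotent ρ (fun w => modelShift (modelRep φ w))
    (fun w w' => by
      rw [Subgroup.coe_mul, map_mul, (hpar w).shift_mul (hpar w')]; rfl)
    (fun w v => (hpar w).norm_linearPart v)
    (fun a => by obtain ⟨w, hw, ha⟩ := hsurj a; exact ⟨⟨w, hw⟩, ha⟩)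
  have htrans : ∀ w ∈ W, modelRep φ w = modelTranslation (modelShift (modelRep φ w)) :=
    fun w hw => (hpar ⟨w, hw⟩).eq_translation (hρ ⟨w, hw⟩)
  refine ⟨isEllipsoid_of_chart φ hφ, isConjToPureTranslations_of_chart φ
    (fun w hw => ⟨_, htrans w hw⟩) fun a => ?_⟩
  obtain ⟨w, hw, ha⟩ := hsurj a
  exact ⟨w, hw, by rw [htrans w hw, ha]⟩

/-- The translations of the model in linear coordinates. -/
noncomputable def chartTranslation (φ : (Fin (n + 1) → ℝ) ≃ₗ[ℝ] Model m) :
    Multiplicative (EuclideanSpace ℝ (Fin m)) →* GL (Fin (n + 1)) ℝ :=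
  Matrix.GeneralLinearGroup.toLin.symm.toMonoidHom.comp
    (MonoidHom.toHomUnits
      { toFun := fun a => φ.symm.conjRingEquiv (modelTranslation a.toAdd)
        map_one' := by
          rw [toAdd_one, modelTranslation_zero, map_one]
        map_mul' := fun a b => by
          rw [toAdd_mul, modelTranslation_add, map_mul] })

theorem actEnd_chartTranslation (φ : (Fin (n + 1) → ℝ) ≃ₗ[ℝ] Model m)
    (a : Multiplicative (EuclideanSpace ℝ (Fin m))) :
    actEnd n (chartTranslation φ a) = φ.symm.conjRingEquiv (modelTranslation a.toAdd) :=
  congrArg Units.val (Matrix.GeneralLinearGroup.toLin.apply_symm_apply _)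

theorem map_chartTranslation_smul (φ : (Fin (n + 1) → ℝ) ≃ₗ[ℝ] Model m)
    (a : Multiplicative (EuclideanSpace ℝ (Fin m))) (v : Fin (n + 1) → ℝ) :
    φ (chartTranslation φ a • v) = modelTranslation a.toAdd (φ v) := by
  have h1 : chartTranslation φ a • v = φ.symm (modelTranslation a.toAdd (φ v)) :=
    LinearMap.congr_fun (actEnd_chartTranslation φ a) v
  rw [h1, φ.apply_symm_apply]

theorem chartTranslation_mem_SLpm (φ : (Fin (n + 1) → ℝ) ≃ₗ[ℝ] Model m)
    (a : Multiplicative (EuclideanSpace ℝ (Fin m))) : chartTranslation φ a ∈ SLpm n := by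
  have h1 : LinearMap.det (actEnd n (chartTranslation φ a)) = 1 := by
    rw [actEnd_chartTranslation, ← det_modelTranslation a.toAdd]
    exact LinearMap.det_conj (modelTranslation a.toAdd) φ.symm
  rw [actEnd_eq_toLin', LinearMap.det_toLin'] at h1
  rw [mem_SLpm_iff, h1, abs_one]

/-- Along the path `r ↦ T (r a) x` the form keeps its nonzero value, so the path never meets the
boundary of `K` and stays in `K`. The side of the quadric on which `K` lies need not be known. -/
theorem IsConeOver.chartTranslation_mem_SLdom (h : IsConeOver Ω K ξ)
    {φ : (Fin (n + 1) → ℝ) ≃ₗ[ℝ] Model m}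
    (hφ : ∀ (x : Fin (n + 1) → ℝ) (hx : x ≠ 0),
      Projectivization.mk ℝ x hx ∈ bdry Ω ↔ modelForm (φ x) = 0)
    (a : Multiplicative (EuclideanSpace ℝ (Fin m))) : chartTranslation φ a ∈ SLdom Ω := by
  have hboundary : ∀ x ∈ closure K, x ∉ K → modelForm (φ x) = 0 := by
    intro x hx hxK
    rcases eq_or_ne x 0 with rfl | hx0
    · simp [modelForm]
    · exact (hφ x hx0).1 (h.mk_mem_bdry hx0 hx hxK)
  have hK : ∀ x ∈ K, modelForm (φ x) ≠ 0 := by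
    intro x hx h0
    have hx0 : x ≠ 0 := fun h1 => h.zero_notMem (h1 ▸ hx)
    exact ((h.mem_bdry_iff x hx0 (h.pos_of_mem x hx)).1 ((hφ x hx0).2 h0)).2 hx
  have key : ∀ (a : Multiplicative (EuclideanSpace ℝ (Fin m))), ∀ x ∈ K,
      chartTranslation φ a • x ∈ K := by
    intro a x hx
    let γ : ℝ → (Fin (n + 1) → ℝ) := fun r =>
      chartTranslation φ (Multiplicative.ofAdd (r • a.toAdd)) • x
    have hγ : ∀ r, γ r = φ.symm (modelTranslation (r • a.toAdd) (φ x)) := fun r => by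
      rw [← φ.symm_apply_apply (γ r), map_chartTranslation_smul, toAdd_ofAdd]
    have hcont : Continuous γ := by
      have h1 : γ = fun r => φ.symm (modelTranslation (r • a.toAdd) (φ x)) := funext hγ
      rw [h1]
      refine (LinearMap.continuous_of_finiteDimensional φ.symm.toLinearMap).comp ?_
      simp only [modelTranslation_apply]
      fun_prop
    have hpre : γ ⁻¹' K = γ ⁻¹' closure K := by
      refine Set.Subset.antisymm (Set.preimage_mono subset_closure) fun r hr => ?_
      by_contra hnot
      have h1 := hboundary _ hr hnot
      rw [hγ, φ.apply_symm_apply, modelForm_modelTranslation] at h1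
      exact hK x hx h1
    have hclopen : IsClopen (γ ⁻¹' K) :=
      ⟨by rw [hpre]; exact isClosed_closure.preimage hcont, h.isOpen.preimage hcont⟩
    have h0 : (0 : ℝ) ∈ γ ⁻¹' K := by
      have h1 : γ 0 = x := by
        rw [hγ, zero_smul, modelTranslation_zero, Module.End.one_apply, φ.symm_apply_apply]
      rw [Set.mem_preimage, h1]
      exact hx
    have h1 : (1 : ℝ) ∈ γ ⁻¹' K := by
      rw [hclopen.eq_univ ⟨0, h0⟩]
      trivial
    have h2 : γ 1 = chartTranslation φ a • x := by
      change chartTranslation φ (Multiplicative.ofAdd ((1 : ℝ) • a.toAdd)) • x = _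
      rw [one_smul]
      rfl
    rw [← h2]
    exact h1
  refine h.mem_SLdom (chartTranslation_mem_SLpm φ a) (Set.Subset.antisymm ?_ fun x hx => ?_)
  · rintro _ ⟨x, hx, rfl⟩
    exact key a x hx
  · rw [Set.mem_smul_set_iff_inv_smul_mem, ← map_inv]
    exact key a⁻¹ x hx

/-- If the boundary of a convex domain is an ellipsoid then a group of translations of a paraboloid
acts simply transitively on the complement of a point. -/
theorem exists_nilpotent_of_isEllipsoid {Ω : Set (RP (m + 1))} (hopen : IsOpen Ω)
    (hΩ : IsStrictlyConvex Ω) (hell : IsEllipsoid (bdry Ω)) :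
    ∃ p ∈ bdry Ω, ∃ W : Subgroup (GL (Fin (m + 1 + 1)) ℝ), W ≤ SLfix Ω p ∧ Group.IsNilpotent W ∧
      ActsSimplyTransitivelyOn W (bdry Ω \ {p}) := by
  obtain ⟨K, ξ, h⟩ := exists_isConeOver hopen hΩ.1
  obtain ⟨g, hg⟩ := hell
  let φ : (Fin (m + 1 + 1) → ℝ) ≃ₗ[ℝ] Model m :=
    (DistribMulAction.toLinearEquiv ℝ (Fin (m + 1 + 1) → ℝ) g⁻¹).trans (lorentzEquiv m).symm
  have hφ : ∀ (x : Fin (m + 1 + 1) → ℝ) (hx : x ≠ 0),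
      Projectivization.mk ℝ x hx ∈ bdry Ω ↔ modelForm (φ x) = 0 := by
    intro x hx
    rw [hg, Set.mem_smul_set_iff_inv_smul_mem, Projectivization.smul_mk, mk_mem_unitSphere_iff,
      ← lorentz_lorentzEquiv, LinearEquiv.trans_apply, LinearEquiv.apply_symm_apply]
    rfl
  set e := φ.symm (modelPole m) with he
  have hφe : φ e = modelPole m := φ.apply_symm_apply _
  have he0 : e ≠ 0 := by
    intro h0
    rw [h0, map_zero] at hφe
    exact zero_ne_one (congrArg (fun x : Model m => x.2.2) hφe)
  have hp : Projectivization.mk ℝ e he0 ∈ bdry Ω := by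
    rw [hφ, hφe]
    simp [modelForm, modelPole]
  have hslice : ∀ x ∈ bdry Ω \ {Projectivization.mk ℝ e he0}, ∃ (v : Fin (m + 1 + 1) → ℝ)
      (hv : v ≠ 0) (a : EuclideanSpace ℝ (Fin m)), x = Projectivization.mk ℝ v hv ∧
      φ v = (a, 1, ‖a‖ ^ 2) := by
    rintro x ⟨hx, hxe⟩
    induction x using Projectivization.ind with
    | h v hv =>
      rw [hφ, modelForm] at hx
      have hs : (φ v).2.1 ≠ 0 := by
        intro h0
        rw [h0, zero_mul, sub_zero, pow_eq_zero_iff two_ne_zero, norm_eq_zero] at hx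
        refine hxe ((Projectivization.mk_eq_mk_iff' ℝ _ _ _ _).2 ⟨(φ v).2.2, φ.injective ?_⟩)
        rw [map_smul, hφe]
        refine Prod.ext ?_ (Prod.ext ?_ ?_)
        · simp [modelPole, hx]
        · simp [modelPole, h0]
        · simp [modelPole]
      refine ⟨(φ v).2.1⁻¹ • v, smul_ne_zero (inv_ne_zero hs) hv, (φ v).2.1⁻¹ • (φ v).1,
        (Projectivization.mk_eq_mk_iff' ℝ _ _ _ _).2 ⟨(φ v).2.1, ?_⟩, ?_⟩
      · rw [smul_smul, mul_inv_cancel₀ hs, one_smul]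
      · rw [map_smul]
        refine Prod.ext rfl (Prod.ext ?_ ?_)
        · simp [hs]
        · change (φ v).2.1⁻¹ * (φ v).2.2 = _
          rw [norm_smul, mul_pow, Real.norm_eq_abs, sq_abs, sub_eq_zero.1 hx]
          field_simp
  refine ⟨_, hp, (chartTranslation φ).range, ?_, ?_, ?_⟩
  · rintro _ ⟨a, rfl⟩
    refine Subgroup.mem_inf.2 ⟨h.chartTranslation_mem_SLdom hφ a, ?_⟩
    rw [MulAction.mem_stabilizer_iff]
    refine smul_mk_eq_of_smul_eq (c := 1) (φ.injective ?_)
    rw [map_chartTranslation_smul, one_smul, hφe, modelTranslation_pole]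
  · exact Group.nilpotent_of_surjective _ (chartTranslation φ).rangeRestrict_surjective
  · intro x hx y hy
    obtain ⟨v, hv, a, rfl, hva⟩ := hslice x hx
    obtain ⟨u, hu, b, rfl, hub⟩ := hslice y hy
    refine ⟨chartTranslation φ (Multiplicative.ofAdd (b - a)), ⟨⟨_, rfl⟩, ?_⟩, ?_⟩
    · refine smul_mk_eq_of_smul_eq (c := 1) (φ.injective ?_)
      rw [map_chartTranslation_smul, one_smul, hva, hub, modelTranslation_apply, toAdd_ofAdd]
      refine Prod.ext ?_ (Prod.ext rfl ?_)
      · simp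
      · have h1 : b = a + (b - a) := by abel
        have h2 := norm_add_sq_real a (b - a)
        rw [← h1, real_inner_comm] at h2
        change ‖a‖ ^ 2 + 2 * inner ℝ (b - a) a + 1 * ‖b - a‖ ^ 2 = ‖b‖ ^ 2
        linarith
    -- The coordinate `s` fixes the scalar to be `1`, and then the first coordinate gives `c = b -
    -- a`.
    · rintro _ ⟨⟨c, rfl⟩, hc⟩
      obtain ⟨d, -, hd⟩ := exists_smul_eq_of_smul_mk_eq hc
      have h1 := map_chartTranslation_smul φ c v
      rw [hd, map_smul, hva, hub, modelTranslation_apply] at h1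
      have h2 : d * 1 = 1 := congrArg (fun x : Model m => x.2.1) h1
      have h3 : d • b = a + (1 : ℝ) • c.toAdd := congrArg (fun x : Model m => x.1) h1
      rw [mul_one] at h2
      rw [h2, one_smul, one_smul] at h3
      rw [h3, add_sub_cancel_left, ofAdd_toAdd]

end Main

end ConvexProjective

theorem mainTheorem4 (n : ℕ) (hn : 1 ≤ n) (Ω : Set (ConvexProjective.RP n))
    (hopen : IsOpen Ω) (hΩ : ConvexProjective.IsStrictlyConvex Ω) :
    (∀ p ∈ ConvexProjective.bdry Ω, ∀ W : Subgroup (GL (Fin (n + 1)) ℝ),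
      W ≤ ConvexProjective.SLfix Ω p → Group.IsNilpotent W →
      ConvexProjective.ActsSimplyTransitivelyOn W (ConvexProjective.bdry Ω \ {p}) →
        ConvexProjective.IsEllipsoid (ConvexProjective.bdry Ω) ∧
          ConvexProjective.IsConjToPureTranslations W) ∧
    (ConvexProjective.IsEllipsoid (ConvexProjective.bdry Ω) →
      ∃ p ∈ ConvexProjective.bdry Ω, ∃ W : Subgroup (GL (Fin (n + 1)) ℝ),
        W ≤ ConvexProjective.SLfix Ω p ∧ Group.IsNilpotent W ∧
        ConvexProjective.ActsSimplyTransitivelyOn W (ConvexProjective.bdry Ω \ {p})) := by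
  -- The model has dimension `m + 2 = n + 1`, which is where `1 ≤ n` is needed.
  obtain ⟨m, rfl⟩ : ∃ m, n = m + 1 := ⟨n - 1, by omega⟩
  refine ⟨fun p hp W hW hnil hst => ?_, fun hell => ?_⟩
  · exact ConvexProjective.isEllipsoid_and_isConjToPureTranslations hopen hΩ hp hW hst
  · exact ConvexProjective.exists_nilpotent_of_isEllipsoid hopen hΩ hell
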